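/- Let $f\in\mathcal C^3([0,+\infty),\mathbb R)$ with $f(1)=0$ and $f'(1)<0$. Put $c_s=\sqrt{-2f'(1)}$ and $F(r)=\int_r^1 f(\rho)\,d\rho$, and assume (H1) $\frac{c_s^2}{4}(1-\rho)^2\le F(\rho)$ for all $\rho\ge 0$; (H2) there are $M\ge 0$ and $q\in[2,+\infty)$ with $F(\rho)\le M|1-\rho|^q$ for all $\rho\ge 2$; (H3) $f''(1)+3f'(1)\neq 0$. For $k\ge 0$ let $\mathcal X^k(\mathbb R)=H^{k+1}(\mathbb R)\times H^k(\mathbb R)$ (real-valued functions) with $\|(\eta,v)\|_{\mathcal X^k}^2=\|\eta\|_{H^{k+1}}^2+\|v\|_{H^k}^2$, let $\mathcal{NX}^k(\mathbb R)=\{(\eta,v)\in\mathcal X^k(\mathbb R):\max_{\mathbb R}\eta<1\}$, and write $\mathcal X=\mathcal X^0(\mathbb R)$, $\mathcal{NX}=\mathcal{NX}^0(\mathbb R)$. The momentum is $p(\eta,v)=\frac12\int_{\mathbb R}\eta v$. A travelling wave of speed $c$ is a pair $(\eta,v)\in\mathcal{NX}$, not constant, that is a classical ($\mathcal C^2$)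 solution on $\mathbb R$ of $$\frac c2\eta=v(1-\eta),\qquad cv=f(1-\eta)-v^2-\frac{\eta''}{2(1-\eta)}-\frac{(\eta')^2}{4(1-\eta)^2}.$$ A transonic branch consists of $c_0\in(0,c_s)$ and a map $c\mapsto Q_c$ of class $\mathcal C^2$ from $(c_0,c_s)$ to $\mathcal{NX}^2(\mathbb R)$ such that, for every $c\in(c_0,c_s)$, $Q_c$ is a travelling wave of speed $c$, every travelling wave of speed $c$ is a translate of $Q_c$, and $\frac{d}{dc}p(Q_c)<0$. For such a branch set $Q_{c,a}=Q_c(\cdot-a)$, and for $N\in\mathbb N$ $$\mathrm{Adm}_N=\{\mathfrak c\in(c_0,c_s)^N: c_1<\dots<c_N\},\qquad \mathrm{Pos}_N(L)=\{\mathfrak a\in\mathbb R^N: a_{k+1}-a_k>L,\ 1\le k\le N-1\},$$ $$R_{\mathfrak c,\mathfrak a}=\sum_{k=1}^N Q_{c_k,a_k},\qquad \mathcal U_{\mathfrak c}(\alpha,L)=\Big\{Q\in\mathcal X:\inf_{\mathfrak a\in\mathrm{Pos}_N(L)}\|Q-R_{\mathfrak c,\mathfrak a}\|_{\mathcal X}<\alpha\Big\}.$$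 Then a transonic branch exists, and for every transonic branch, every $N$ and every $\mathfrak c^*\in\mathrm{Adm}_N$ the following holds. There exist constants $\alpha_1,L_1,K_1>0$, depending only on $\mathfrak c^*$ (for the given $f$ and branch), and two functions $\mathfrak C=(c_1,\dots,c_N)$ and $\mathfrak A=(a_1,\dots,a_N)$ with $(\mathfrak C,\mathfrak A)\in\mathcal C^1\big(\mathcal U_{\mathfrak c^*}(\alpha_1,L_1),\mathbb R^{2N}\big)$ and $\mathfrak C$ valued in $\mathrm{Adm}_N$, such that for every $Q\in\mathcal U_{\mathfrak c^*}(\alpha_1,L_1)$ the perturbation $\varepsilon(Q)=Q-R_{\mathfrak C(Q),\mathfrak A(Q)}$ satisfies the $2N$ orthogonality conditions $$\big\langle\varepsilon(Q),\partial_xQ_{c_k(Q),a_k(Q)}\big\rangle_{L^2\times L^2}=\nabla p\big(Q_{c_k(Q),a_k(Q)}\big).\varepsilon(Q)=0,\qquad k=1,\dots,N.$$ Moreover, if $\alpha\le\alpha_1$, $L\ge L_1$ and $\mathfrak a^*\in\mathrm{Pos}_N(L)$ satisfy $\|Q-R_{\mathfrak c^*,\mathfrak a^*}\|_{\mathcal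 X}\le\alpha$, then $$\|\varepsilon(Q)\|_{\mathcal X}+|\mathfrak C(Q)-\mathfrak c^*|+|\mathfrak A(Q)-\mathfrak a^*|\le K_1\alpha .$$ -/

import Mathlib

open MeasureTheory Set
open scoped ContDiff

noncomputable section

namespace DarkSoliton

/-! ### Sobolev spaces on the line -/

/-- `L²(ℝ)`, real valued, for the Lebesgue measure. -/
abbrev L2 : Type := Lp ℝ 2 (volume : Measure ℝ)

/-- `g` is the weak derivative of `u`. -/
def HasWeakDeriv (u g : L2) : Prop :=
  ∀ φ : ℝ → ℝ, ContDiff ℝ ∞ φ → HasCompactSupport φ →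
    ∫ x, u x * deriv φ x = -∫ x, g x * φ x

theorem integrable_mul_test (u : L2) {φ : ℝ → ℝ} (hφ : Continuous φ)
    (hc : HasCompactSupport φ) : Integrable (fun x => u x * φ x) volume :=
  have h : MemLp φ 2 (volume : Measure ℝ) := hφ.memLp_of_hasCompactSupport hc
  (Lp.memLp u).integrable_mul h

theorem HasWeakDeriv.zero : HasWeakDeriv 0 0 := by
  intro φ _ _
  have h : ((0 : L2) : ℝ → ℝ) =ᵐ[volume] 0 := Lp.coeFn_zero _ _ _
  rw [integral_eq_zero_of_ae, integral_eq_zero_of_ae, neg_zero]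
  · filter_upwards [h] with x hx
    rw [hx]; simp
  · filter_upwards [h] with x hx
    rw [hx]; simp

theorem HasWeakDeriv.add {u g u' g' : L2} (h : HasWeakDeriv u g) (h' : HasWeakDeriv u' g') :
    HasWeakDeriv (u + u') (g + g') := by
  intro φ hφ hc
  have hd : Continuous (deriv φ) := hφ.continuous_deriv (by simp)
  have e1 : (∫ x, (u + u' : L2) x * deriv φ x)
      = ∫ x, (u x * deriv φ x + u' x * deriv φ x) := by
    refine integral_congr_ae ?_
    filter_upwards [Lp.coeFn_add u u'] with x hx
    rw [hx, Pi.add_apply, add_mul]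
  have e2 : (∫ x, (g + g' : L2) x * φ x) = ∫ x, (g x * φ x + g' x * φ x) := by
    refine integral_congr_ae ?_
    filter_upwards [Lp.coeFn_add g g'] with x hx
    rw [hx, Pi.add_apply, add_mul]
  rw [e1, e2, integral_add (integrable_mul_test u hd hc.deriv)
    (integrable_mul_test u' hd hc.deriv),
    integral_add (integrable_mul_test g hφ.continuous hc)
    (integrable_mul_test g' hφ.continuous hc), h φ hφ hc, h' φ hφ hc]
  ring

theorem HasWeakDeriv.smul {u g : L2} (r : ℝ) (h : HasWeakDeriv u g) :
    HasWeakDeriv (r • u) (r • g) := by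
  intro φ hφ hc
  have e1 : (∫ x, (r • u : L2) x * deriv φ x) = ∫ x, r * (u x * deriv φ x) := by
    refine integral_congr_ae ?_
    filter_upwards [Lp.coeFn_smul r u] with x hx
    simp [hx, mul_assoc]
  have e2 : (∫ x, (r • g : L2) x * φ x) = ∫ x, r * (g x * φ x) := by
    refine integral_congr_ae ?_
    filter_upwards [Lp.coeFn_smul r g] with x hx
    simp [hx, mul_assoc]
  rw [e1, e2, integral_const_mul, integral_const_mul, h φ hφ hc]
  ring

/-- The translate `u(· - a)` of a function of `L²(ℝ)`. -/
def L2.translate (a : ℝ) (u : L2) : L2 :=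
  Lp.compMeasurePreserving (fun x : ℝ => x - a) (measurePreserving_sub_right volume a) u

theorem L2.coeFn_translate (a : ℝ) (u : L2) :
    (L2.translate a u : ℝ → ℝ) =ᵐ[volume] fun x => u (x - a) :=
  Lp.coeFn_compMeasurePreserving u (measurePreserving_sub_right volume a)

theorem HasWeakDeriv.translate {u g : L2} (a : ℝ) (h : HasWeakDeriv u g) :
    HasWeakDeriv (L2.translate a u) (L2.translate a g) := by
  intro φ hφ hc
  have e1 : (∫ x, L2.translate a u x * deriv φ x)
      = ∫ x, u x * deriv (fun y => φ (y + a)) x := by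
    rw [← integral_sub_right_eq_self (fun x => u x * deriv (fun y => φ (y + a)) x) a]
    refine integral_congr_ae ?_
    filter_upwards [L2.coeFn_translate a u] with x hx
    simp [hx, deriv_comp_add_const]
  have e2 : (∫ x, L2.translate a g x * φ x) = ∫ x, g x * φ (x + a) := by
    rw [← integral_sub_right_eq_self (fun x => g x * φ (x + a)) a]
    refine integral_congr_ae ?_
    filter_upwards [L2.coeFn_translate a g] with x hx
    simp [hx]
  rw [e1, e2]
  exact h (fun y => φ (y + a)) (hφ.comp (contDiff_id.add contDiff_const))
    (hc.comp_homeomorph (Homeomorph.addRight a))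

/-- The Sobolev space `H^k(ℝ)`: a function `u ∈ L²` is recorded together with its successive weak
derivatives, as the tuple `(u, u', …, u^(k))` of `(L²)^(k+1)`.  The norm is the Euclidean one,
`‖u‖² = ∑_{j ≤ k} ‖u^(j)‖²_{L²}`. -/
def sobolevSubmodule (k : ℕ) : Submodule ℝ (PiLp 2 (fun _ : Fin (k + 1) => L2)) where
  carrier := {u | ∀ j : Fin k, HasWeakDeriv (u j.castSucc) (u j.succ)}
  zero_mem' := fun _ => HasWeakDeriv.zero
  add_mem' := fun hu hv j => (hu j).add (hv j)
  smul_mem' := fun r _ hu j => (hu j).smul r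

/-- `H^k(ℝ)` with its Hilbert norm. -/
abbrev H (k : ℕ) : Type := sobolevSubmodule k

/-- The `j`-th weak derivative, `j ≤ k`, of an element of `H^k(ℝ)`; for `j = 0` the function
itself. -/
def H.der {k : ℕ} (u : H k) (j : Fin (k + 1)) : L2 := (u : PiLp 2 (fun _ => L2)) j

/-- The translate `u(· - a)` in `H^k(ℝ)`. -/
def H.translate {k : ℕ} (a : ℝ) (u : H k) : H k :=
  ⟨WithLp.toLp 2 fun j => L2.translate a (u.der j), fun j => (u.2 j).translate a⟩

/-- The inclusion `H^m(ℝ) ⊆ H^k(ℝ)` for `k ≤ m`. -/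
def H.incl {k m : ℕ} (h : k ≤ m) (u : H m) : H k :=
  ⟨WithLp.toLp 2 fun j => u.der (Fin.castLE (Nat.succ_le_succ h) j),
    fun j => u.2 (Fin.castLE h j)⟩

/-! ### The hydrodynamical energy spaces -/

/-- `X^k(ℝ) = H^{k+1}(ℝ) × H^k(ℝ)` with the norm
`‖(η, v)‖² = ‖η‖²_{H^{k+1}} + ‖v‖²_{H^k}`. -/
abbrev X (k : ℕ) : Type := WithLp 2 (H (k + 1) × H k)

/-- The first component `η`, as a function. -/
def X.eta {k : ℕ} (Q : X k) : ℝ → ℝ := Q.fst.der 0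

/-- The second component `v`, as a function. -/
def X.vel {k : ℕ} (Q : X k) : ℝ → ℝ := Q.snd.der 0

/-- The translate `Q(· - a)`. -/
def X.translate {k : ℕ} (a : ℝ) (Q : X k) : X k :=
  WithLp.toLp 2 (H.translate a Q.fst, H.translate a Q.snd)

/-- The inclusion `X^m(ℝ) ⊆ X^0(ℝ)`. -/
def X.toX0 {m : ℕ} (Q : X m) : X 0 :=
  WithLp.toLp 2 (H.incl (Nat.succ_le_succ (Nat.zero_le m)) Q.fst, H.incl (Nat.zero_le m) Q.snd)

/-- The non-vanishing subset `{(η, v) ∈ X^k(ℝ) : max η < 1}`. Here `η` is continuous and vanishes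
at infinity, so `max η < 1` says that `η` stays below some constant `m < 1`. -/
def NX (k : ℕ) : Set (X k) := {Q | ∃ m < (1 : ℝ), ∀ᵐ x, Q.eta x ≤ m}

/-- The momentum `p(η, v) = (1/2) ∫ η v`. -/
def momentum (Q : X 0) : ℝ := (1 / 2) * ∫ x, Q.eta x * Q.vel x

/-! ### Travelling waves -/

/-- The speed of sound `c_s = √(-2 f'(1))`. -/
def soundSpeed (f : ℝ → ℝ) : ℝ := Real.sqrt (-2 * deriv f 1)

/-- `F(r) = ∫_r^1 f(ρ) dρ`. -/
def potential (f : ℝ → ℝ) (r : ℝ) : ℝ := ∫ ρ in r..1, f ρ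

/-- The hydrodynamical travelling wave equation of speed `c` at every point, for a classical
solution `(η, v)`. -/
def SolvesTW (f : ℝ → ℝ) (c : ℝ) (η v : ℝ → ℝ) : Prop :=
  ContDiff ℝ 2 η ∧ ContDiff ℝ 2 v ∧ (∀ x, η x < 1) ∧
  (∀ x, c / 2 * η x = v x * (1 - η x)) ∧
  ∀ x, c * v x = f (1 - η x) - v x ^ 2 - deriv (deriv η) x / (2 * (1 - η x))
      - (deriv η x) ^ 2 / (4 * (1 - η x) ^ 2)

/-- `Q` is a non-constant travelling wave of speed `c` in the non-vanishing energy set. -/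
def IsTravellingWave (f : ℝ → ℝ) (c : ℝ) (Q : X 0) : Prop :=
  Q ∈ NX 0 ∧ ∃ η v : ℝ → ℝ, Q.eta =ᵐ[volume] η ∧ Q.vel =ᵐ[volume] v ∧
    SolvesTW f c η v ∧ ∃ x y, (η x, v x) ≠ (η y, v y)

/-- A transonic branch of solitons `c ↦ Q_c`, `c ∈ (c₀, c_s)`: for every such `c`, `Q_c` is a
non-constant travelling wave of speed `c`, and it is the only one up to translations; moreover
`c ↦ Q_c` is `C²` with values in `NX²(ℝ)`, and `d/dc p(Q_c) < 0`. -/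
structure IsTransonicBranch (f : ℝ → ℝ) (c₀ : ℝ) (Q : ℝ → X 2) : Prop where
  pos : 0 < c₀
  lt_soundSpeed : c₀ < soundSpeed f
  mem_NX : ∀ c ∈ Ioo c₀ (soundSpeed f), Q c ∈ NX 2
  isTravellingWave : ∀ c ∈ Ioo c₀ (soundSpeed f), IsTravellingWave f c (Q c).toX0
  unique : ∀ c ∈ Ioo c₀ (soundSpeed f), ∀ P : X 0, IsTravellingWave f c P →
    ∃ a : ℝ, P = ((Q c).translate a).toX0
  contDiffOn : ContDiffOn ℝ 2 Q (Ioo c₀ (soundSpeed f))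
  deriv_momentum_neg : ∀ c ∈ Ioo c₀ (soundSpeed f), deriv (fun s => momentum (Q s).toX0) c < 0

/-! ### Chains of solitons -/

/-- Ordered admissible speeds `c₀ < c_1 < ... < c_N < c_s`. -/
def Adm (N : ℕ) (f : ℝ → ℝ) (c₀ : ℝ) : Set (Fin N → ℝ) :=
  {c | (∀ k, c k ∈ Ioo c₀ (soundSpeed f)) ∧ StrictMono c}

/-- Positions with `a_{k+1} - a_k > L` for all `k`. -/
def Pos (N : ℕ) (L : ℝ) : Set (Fin N → ℝ) :=
  {a | ∀ j k : Fin N, (k : ℕ) = j + 1 → L < a k - a j}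

/-- The chain `R_{c,a} = ∑_k Q_{c_k}(· - a_k)`. -/
def chain {N : ℕ} (Q : ℝ → X 2) (c a : Fin N → ℝ) : X 0 :=
  ∑ k, ((Q (c k)).translate (a k)).toX0

/-- The neighbourhood `{P ∈ X(ℝ) : inf_{a ∈ Pos_N(L)} ‖P - R_{c,a}‖ < α}` of the chains of
speeds `c`. -/
def tube {N : ℕ} (Q : ℝ → X 2) (c : Fin N → ℝ) (α L : ℝ) : Set (X 0) :=
  {P | ⨅ a : Pos N L, ‖P - chain Q c a‖ < α}

/-- The `L² × L²` scalar product of `ε` with `∂_x S`. -/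
def innerDx (ε : X 0) (S : X 2) : ℝ :=
  inner ℝ (ε.fst.der 0) (S.fst.der 1) + inner ℝ (ε.snd.der 0) (S.snd.der 1)

end DarkSoliton

end

open DarkSoliton

/-! Modulation. The orthogonality conditions see a perturbation only through its class in L² × L²,
so the implicit function argument is run on the Hilbert space `L2Pair`, on which translations form a
strongly continuous group of isometries. Let G(v, z) collect the products of v - R_z with ∂_x Q_k
and with ∇p(Q_k), where z stands for all speeds and positions. On the chain itself the z-derivative
of G is block diagonal up to interactions of distinct solitons. These vanish as the spacing grows,
because translates tend weakly to 0 (`L2.tendsto_inner_shift`); no rate of decay is needed. By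
equivariance the 2 × 2 block of a soliton does not depend on its position. Since p is translation
invariant, ∂_x Q is orthogonal to ∇p(Q), so the block is triangular with entries dp/dc and ‖∂_x Q‖²
up to sign. Both are nonzero: the first by the transonic condition, the second because a translation
invariant element of L² × L² vanishes (`IsTransonicBranch.nondegenerate`).

The derivative of G is therefore uniformly close to a fixed invertible map on a ball whose radius is
the same for all well-spaced chains, and a quantitative inverse function theorem gives exactly one
zero there, at a distance controlled linearly by the distance from v to the chain
(`exists_local_modulation`). The zeros found from different chains near the same v must agree: two
close, well-spaced chains with the same speeds have close positions (`norm_sub_le_of_chain_close`).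
This uses that solitons of different speeds are not translates of each other
(`eq_of_ae_eq_solvesTW`). The implicit function theorem makes the zero C¹ in v, and the Lipschitz
dependence of R_z on z in the norm of X gives the bound on ε.

Existence of a branch. A travelling wave has v = cη / (2(1 - η)) and satisfies the first integral
(η')² = V₀(η) - c²η² with V₀(η) = 4(1 - η)F(1 - η). Write s for the speed of sound, e^l = s² - c²
and g(η) = s² - V₀(η)/η²; then (η')² = η²(e^l - g(η)), and g(η) ~ γη at 0 with γ > 0 by (H1)
(`Well.γ_pos`). The square root is singular at the crest, so the equation is uniformised by a phase
θ with g(η) = e^l sech²θ. If Y is the inverse of y ↦ log g(e^y) (`exists_logProfile`), then η =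
exp(Y(l + log sech²θ)), η' = -e^{l/2} tanh(θ) η, and θ solves the regular equation Y'(l + log
sech²θ) θ' = e^{l/2}/2. In this form the profile is twice differentiable in l, and the profile and
its derivatives in l are exponentially small in x up to polynomial factors, locally uniformly in l.
Dominated convergence turns this into a C² curve in H³ × H².

Taking θ as the variable of integration, the momentum becomes c √(s² - c²) / 2 times an integral
that increases with l (`momentum_branch`, `totalDens_mono`). Near c = s the first factor strictly
decreases in c and the second does not increase, so dp/dc < 0. For uniqueness, any travelling wave
satisfies the same first integral and is nonnegative by (H1). Its maximum is forced to be exp(Y(l)),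
and uniqueness for the second order equation identifies it with a translate of the profile
(`SolvesTW.eq_translate`). -/

noncomputable section

namespace DarkSoliton

open Filter Topology

/-! ### The translation group on `L²(ℝ)` -/

/-- The translation `u ↦ u(· - a)` as a linear isometry of `L²(ℝ)`. -/
def L2.shift (a : ℝ) : L2 →ₗᵢ[ℝ] L2 :=
  Lp.compMeasurePreservingₗᵢ ℝ (fun x : ℝ => x - a) (measurePreserving_sub_right volume a)

theorem L2.coeFn_shift (a : ℝ) (u : L2) :
    (L2.shift a u : ℝ → ℝ) =ᵐ[volume] fun x => u (x - a) :=
  L2.coeFn_translate a u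

theorem ae_comp_sub {p : ℝ → Prop} (h : ∀ᵐ x, p x) (a : ℝ) : ∀ᵐ x, p (x - a) :=
  (measurePreserving_sub_right volume a).quasiMeasurePreserving.ae h

theorem L2.shift_shift (a b : ℝ) (u : L2) : L2.shift a (L2.shift b u) = L2.shift (a + b) u := by
  refine Lp.ext ?_
  filter_upwards [L2.coeFn_shift a (L2.shift b u), L2.coeFn_shift (a + b) u,
    ae_comp_sub (L2.coeFn_shift b u) a] with x h1 h2 h3
  rw [h1, h2, h3]
  congr 1
  ring

theorem L2.shift_zero (u : L2) : L2.shift 0 u = u := by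
  refine Lp.ext ?_
  filter_upwards [L2.coeFn_shift 0 u] with x h1
  rw [h1, sub_zero]

theorem L2.continuous_shift : Continuous fun p : ℝ × L2 => L2.shift p.1 p.2 := by
  refine Continuous.compMeasurePreservingLp (f := fun p : ℝ × L2 => p.2)
    (g := fun p : ℝ × L2 => (⟨fun x : ℝ => x - p.1, by fun_prop⟩ : C(ℝ, ℝ)))
    continuous_snd ?_ (fun p => measurePreserving_sub_right volume p.1) (by simp)
  exact ContinuousMap.continuous_of_continuous_uncurry _ (by
    change Continuous fun q : (ℝ × L2) × ℝ => q.2 - q.1.1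
    fun_prop)

theorem inner_eq_integral (u w : L2) : inner ℝ u w = ∫ x, u x * w x := by
  rw [L2.inner_def]
  simp [mul_comm]

theorem L2.inner_shift_eq_integral (a : ℝ) (u w : L2) :
    inner ℝ (L2.shift a u) w = ∫ x, u (x - a) * w x := by
  rw [inner_eq_integral]
  refine integral_congr_ae ?_
  filter_upwards [L2.coeFn_shift a u] with x hx
  rw [hx]

theorem exists_compactSupport_approx (u : L2) {ε : ℝ} (hε : 0 < ε) :
    ∃ w : L2, ‖u - w‖ ≤ ε ∧ ∃ R : ℝ, ∀ᵐ x, R < |x| → w x = 0 := by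
  obtain ⟨g, hg1, hg2, hg3, hg4⟩ := (Lp.memLp u).exists_hasCompactSupport_eLpNorm_sub_le
    (by simp) (ε := ENNReal.ofReal ε) (by simpa using hε)
  refine ⟨hg4.toLp g, ?_, ?_⟩
  · rw [Lp.norm_def]
    refine ENNReal.toReal_le_of_le_ofReal hε.le (le_trans (le_of_eq ?_) hg2)
    refine eLpNorm_congr_ae ?_
    filter_upwards [Lp.coeFn_sub u (hg4.toLp g), hg4.coeFn_toLp] with x h1 h2
    rw [h1, Pi.sub_apply, Pi.sub_apply, h2]
  · obtain ⟨R, hR⟩ := hg1.isCompact.isBounded.subset_closedBall 0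
    refine ⟨R, ?_⟩
    filter_upwards [hg4.coeFn_toLp] with x h2 hx
    rw [h2]
    by_contra hne
    have := hR (subset_tsupport g hne)
    simp at this
    linarith

/-- Once both functions are replaced by compactly supported ones, the supports separate as soon as
|a| exceeds the sum of their radii, and the product is exactly 0. This is the only decay used in the
modulation argument. -/
theorem L2.tendsto_inner_shift (u w : L2) :
    Tendsto (fun a => inner ℝ (L2.shift a u) w) (cocompact ℝ) (𝓝 0) := by
  rw [Metric.tendsto_nhds]
  intro ε hε
  obtain ⟨δ, hδ, hδε⟩ : ∃ δ > 0, δ * ‖w‖ + (‖u‖ + δ) * δ < ε := by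
    have hc : Tendsto (fun δ : ℝ => δ * ‖w‖ + (‖u‖ + δ) * δ) (𝓝[>] 0) (𝓝 0) := by
      refine tendsto_nhdsWithin_of_tendsto_nhds ?_
      have : Continuous fun δ : ℝ => δ * ‖w‖ + (‖u‖ + δ) * δ := by fun_prop
      simpa using this.tendsto 0
    obtain ⟨δ, h1, h2⟩ := ((hc.eventually_lt_const hε).and self_mem_nhdsWithin).exists
    exact ⟨δ, h2, h1⟩
  obtain ⟨u', hu', R, hR⟩ := exists_compactSupport_approx u hδ
  obtain ⟨w', hw', S, hS⟩ := exists_compactSupport_approx w hδ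
  have hev : ∀ᶠ a : ℝ in cocompact ℝ, R + S < |a| := by
    have := (tendsto_norm_cocompact_atTop (E := ℝ)).eventually_gt_atTop (R + S)
    simpa using this
  filter_upwards [hev] with a ha
  have h0 : inner ℝ (L2.shift a u') w' = (0 : ℝ) := by
    rw [L2.inner_shift_eq_integral]
    refine integral_eq_zero_of_ae ?_
    filter_upwards [hS, ae_comp_sub hR a] with x h1 h2
    by_cases hx : S < |x|
    · simp [h1 hx]
    · have : R < |x - a| := by
        have := abs_sub_abs_le_abs_sub a x
        rw [abs_sub_comm] at this
        linarith
      simp [h2 this]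
  have e : inner ℝ (L2.shift a u) w
      = inner ℝ (L2.shift a (u - u')) w + inner ℝ (L2.shift a u') (w - w') := by
    rw [map_sub, inner_sub_left, inner_sub_right, h0]
    ring
  have hnu : ‖u'‖ ≤ ‖u‖ + δ := by
    have := norm_sub_le u (u - u')
    rw [sub_sub_cancel] at this
    linarith
  rw [dist_zero_right, e]
  calc _ ≤ ‖inner ℝ (L2.shift a (u - u')) w‖ + ‖inner ℝ (L2.shift a u') (w - w')‖ :=
        norm_add_le _ _
    _ ≤ ‖u - u'‖ * ‖w‖ + ‖u'‖ * ‖w - w'‖ := by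
        gcongr
        · simpa only [LinearIsometry.norm_map] using
            norm_inner_le_norm (𝕜 := ℝ) (L2.shift a (u - u')) w
        · simpa only [LinearIsometry.norm_map] using
            norm_inner_le_norm (𝕜 := ℝ) (L2.shift a u') (w - w')
    _ ≤ δ * ‖w‖ + (‖u‖ + δ) * δ := by gcongr
    _ < ε := hδε

/-! ### Weak derivatives -/

/-- A continuous compactly supported function as an element of `L²(ℝ)`. -/
def testL2 (φ : ℝ → ℝ) (hφ : Continuous φ) (hc : HasCompactSupport φ) : L2 :=
  (show MemLp φ 2 volume from hφ.memLp_of_hasCompactSupport hc).toLp φ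

theorem inner_testL2 (u : L2) {φ : ℝ → ℝ} (hφ : Continuous φ) (hc : HasCompactSupport φ) :
    inner ℝ u (testL2 φ hφ hc) = ∫ x, u x * φ x := by
  rw [inner_eq_integral]
  refine integral_congr_ae ?_
  filter_upwards [MemLp.coeFn_toLp (hφ.memLp_of_hasCompactSupport hc :
    MemLp φ 2 (volume : Measure ℝ))] with x hx
  rw [testL2, hx]

theorem eq_of_integral_test_eq {u w : L2} (h : ∀ φ : ℝ → ℝ, ContDiff ℝ ∞ φ →
    HasCompactSupport φ → ∫ x, u x * φ x = ∫ x, w x * φ x) : u = w := by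
  refine Lp.ext ?_
  refine ae_eq_of_integral_contDiff_smul_eq
    ((Lp.memLp u).locallyIntegrable (by norm_num)) ((Lp.memLp w).locallyIntegrable (by norm_num)) ?_
  intro φ hφ hc
  simpa [mul_comm] using h φ hφ hc

theorem HasWeakDeriv.unique {u g g' : L2} (h : HasWeakDeriv u g) (h' : HasWeakDeriv u g') :
    g = g' := by
  refine eq_of_integral_test_eq fun φ hφ hc => ?_
  have h1 := h φ hφ hc
  have h2 := h' φ hφ hc
  linarith

theorem hasWeakDeriv_iff_inner {u g : L2} : HasWeakDeriv u g ↔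
    ∀ (φ : ℝ → ℝ) (hφ : ContDiff ℝ ∞ φ) (hc : HasCompactSupport φ),
      inner ℝ u (testL2 (deriv φ) (hφ.continuous_deriv (by simp)) hc.deriv)
        + inner ℝ g (testL2 φ hφ.continuous hc) = (0 : ℝ) := by
  refine forall_congr' fun φ => forall_congr' fun hφ => forall_congr' fun hc => ?_
  rw [inner_testL2, inner_testL2]
  exact eq_neg_iff_add_eq_zero

/-- Each test function imposes a condition that is continuous on L² × L². This is what makes H^k
complete, so that one can project onto it. -/
theorem isClosed_hasWeakDeriv : IsClosed {p : L2 × L2 | HasWeakDeriv p.1 p.2} := by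
  simp only [hasWeakDeriv_iff_inner, ofPred_forall]
  refine isClosed_iInter fun φ => isClosed_iInter fun hφ => isClosed_iInter fun hc => ?_
  exact isClosed_eq (by fun_prop) continuous_const

theorem hasWeakDeriv_of_hasDerivAt {u g : L2} {φ φ' : ℝ → ℝ} (hu : u =ᵐ[volume] φ)
    (hg : g =ᵐ[volume] φ') (h : ∀ x, HasDerivAt φ (φ' x) x) : HasWeakDeriv u g := by
  intro ψ hψ hc
  have e1 : (∫ x, u x * deriv ψ x) = ∫ x, φ x * deriv ψ x :=
    integral_congr_ae (by filter_upwards [hu] with x hx; rw [hx])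
  have e2 : (∫ x, g x * ψ x) = ∫ x, φ' x * ψ x :=
    integral_congr_ae (by filter_upwards [hg] with x hx; rw [hx])
  have hd : Continuous (deriv ψ) := hψ.continuous_deriv (by simp)
  rw [e1, e2]
  refine integral_mul_deriv_eq_deriv_mul_of_integrable (fun x _ => h x)
    (fun x _ => (hψ.differentiable (by simp) x).hasDerivAt) ?_ ?_ ?_
  · refine (integrable_mul_test u hd hc.deriv).congr ?_
    filter_upwards [hu] with x hx
    simp [hx]
  · refine (integrable_mul_test g hψ.continuous hc).congr ?_
    filter_upwards [hg] with x hx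
    simp [hx]
  · refine (integrable_mul_test u hψ.continuous hc).congr ?_
    filter_upwards [hu] with x hx
    simp [hx]

theorem hasDerivAt_integral_mul_comp_add (u : L2) {φ : ℝ → ℝ} (hφ : ContDiff ℝ ∞ φ)
    (hc : HasCompactSupport φ) (a : ℝ) :
    HasDerivAt (fun a => ∫ x, u x * φ (x + a)) (∫ x, u x * deriv φ (x + a)) a := by
  obtain ⟨C, hC⟩ := hc.deriv.exists_bound_of_continuous (hφ.continuous_deriv (by simp))
  obtain ⟨R, hR⟩ := hc.deriv.isCompact.isBounded.subset_closedBall 0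
  have hC0 : 0 ≤ C := (norm_nonneg _).trans (hC 0)
  have hsh : ∀ b : ℝ, HasCompactSupport fun x => φ (x + b) := fun b =>
    hc.comp_homeomorph (Homeomorph.addRight b)
  have hsh' : ∀ b : ℝ, HasCompactSupport fun x => deriv φ (x + b) := fun b =>
    hc.deriv.comp_homeomorph (Homeomorph.addRight b)
  have hdc : Continuous (deriv φ) := hφ.continuous_deriv (by simp)
  have hφc := hφ.continuous
  refine (hasDerivAt_integral_of_dominated_loc_of_deriv_le (s := Metric.ball a 1)
    -- For |b - a| < 1 the support of φ'(· + b) stays in this fixed ball, where an L² function is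
    -- integrable.
    (bound := (Metric.closedBall (-a) (R + 1)).indicator fun x => C * |u x|)
    (F' := fun b x => u x * deriv φ (x + b))
    (Metric.ball_mem_nhds a one_pos) ?_ ?_ ?_ ?_ ?_ ?_).2
  · exact Eventually.of_forall fun b =>
      (integrable_mul_test u (by fun_prop) (hsh b)).aestronglyMeasurable
  · exact integrable_mul_test u (by fun_prop) (hsh a)
  · exact (integrable_mul_test u (by fun_prop) (hsh' a)).aestronglyMeasurable
  · refine Eventually.of_forall fun x b hb => ?_
    by_cases hx : x ∈ Metric.closedBall (-a) (R + 1)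
    · rw [indicator_of_mem hx, norm_mul, mul_comm]
      simp only [Real.norm_eq_abs]
      exact mul_le_mul_of_nonneg_right (hC _) (abs_nonneg _)
    · have : deriv φ (x + b) = 0 := by
        by_contra hne
        have h1 := hR (subset_tsupport (deriv φ) hne)
        refine hx ?_
        simp only [Metric.mem_closedBall, Real.dist_eq, Metric.mem_ball] at h1 hb ⊢
        rw [abs_le] at h1 ⊢
        rw [abs_lt] at hb
        constructor <;> linarith [h1.1, h1.2, hb.1, hb.2]
      rw [this, mul_zero, norm_zero]
      exact indicator_nonneg (fun x _ => by positivity) x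
  · rw [integrable_indicator_iff measurableSet_closedBall]
    refine Integrable.const_mul ?_ C
    have hl : LocallyIntegrable (fun x => u x) volume :=
      (Lp.memLp u).locallyIntegrable (by norm_num)
    exact (hl.integrableOn_isCompact (isCompact_closedBall _ _)).abs
  · refine Eventually.of_forall fun x b _ => ?_
    have := ((hφ.differentiable (by simp) (x + b)).hasDerivAt).comp_const_add x b
    exact this.const_mul _

/-- Testing against smooth functions yields the identity T_a u = u - ∫_0^a T_s g ds in L². Since s ↦
T_s g is continuous, the fundamental theorem of calculus differentiates it. -/
theorem L2.hasDerivAt_shift {u g : L2} (h : HasWeakDeriv u g) (a : ℝ) :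
    HasDerivAt (fun a => L2.shift a u) (-L2.shift a g) a := by
  have hcont : Continuous fun s => L2.shift s g :=
    L2.continuous_shift.comp (continuous_id.prodMk continuous_const)
  have key : ∀ a, L2.shift a u = u - ∫ s in (0 : ℝ)..a, L2.shift s g := by
    intro a
    refine eq_of_integral_test_eq fun φ hφ hc => ?_
    rw [← inner_testL2 _ hφ.continuous hc, ← inner_testL2 _ hφ.continuous hc, inner_sub_left]
    have hI : inner ℝ (∫ s in (0 : ℝ)..a, L2.shift s g) (testL2 φ hφ.continuous hc)
        = ∫ s in (0 : ℝ)..a, inner ℝ (L2.shift s g) (testL2 φ hφ.continuous hc) := by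
      have := (innerSL ℝ (testL2 φ hφ.continuous hc)).intervalIntegral_comp_comm
        (hcont.intervalIntegrable (μ := volume) 0 a)
      simp only [innerSL_apply_apply] at this
      rw [real_inner_comm, ← this]
      simp only [real_inner_comm]
    have hsh : ∀ (w : L2) (s : ℝ), inner ℝ (L2.shift s w) (testL2 φ hφ.continuous hc)
        = ∫ x, w x * φ (x + s) := by
      intro w s
      rw [inner_testL2, ← integral_sub_right_eq_self (fun x => w x * φ (x + s)) s]
      refine integral_congr_ae ?_
      filter_upwards [L2.coeFn_shift s w] with x hx
      rw [hx, sub_add_cancel]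
    have hw : ∀ s, ∫ x, u x * deriv φ (x + s) = -∫ x, g x * φ (x + s) := by
      intro s
      have := h (fun x => φ (x + s)) (hφ.comp (contDiff_id.add contDiff_const))
        (hc.comp_homeomorph (Homeomorph.addRight s))
      simpa only [deriv_comp_add_const] using this
    have hftc : ∫ s in (0 : ℝ)..a, inner ℝ (L2.shift s g) (testL2 φ hφ.continuous hc)
        = -(∫ x, u x * φ (x + a)) + ∫ x, u x * φ (x + 0) := by
      have := intervalIntegral.integral_eq_sub_of_hasDerivAt (a := 0) (b := a)
        (f := fun s => -∫ x, u x * φ (x + s))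
        (f' := fun s => inner ℝ (L2.shift s g) (testL2 φ hφ.continuous hc)) ?_ ?_
      · rw [this]; ring
      · intro s _
        have := (hasDerivAt_integral_mul_comp_add u hφ hc s).neg
        rwa [hw, neg_neg, ← hsh] at this
      · exact (hcont.inner continuous_const).intervalIntegrable _ _
    rw [hI, hftc, hsh, inner_testL2]
    simp
  have h2 : (fun a => L2.shift a u) = fun a => u - ∫ s in (0 : ℝ)..a, L2.shift s g := funext key
  rw [h2]
  exact (intervalIntegral.integral_hasDerivAt_right (hcont.intervalIntegrable _ _)
    (hcont.stronglyMeasurableAtFilter _ _) hcont.continuousAt).const_sub u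

/-! ### A quantitative inverse function theorem -/

section Quantitative

variable {Z : Type*} [NormedAddCommGroup Z] [NormedSpace ℝ Z]
  {G : Z → Z} {G' : Z → Z →L[ℝ] Z} {D : Z ≃L[ℝ] Z} {z₀ : Z} {ρ m : ℝ}

/-- G - D is Lipschitz with constant 1/(2m) on the ball and ‖D⁻¹‖ ≤ m, so half of ‖z - z'‖ is
absorbed on the left. -/
theorem norm_sub_le_of_fderiv_close (hm : 0 < m) (hDm : ‖(D.symm : Z →L[ℝ] Z)‖ ≤ m)
    (hG : ∀ z ∈ Metric.closedBall z₀ ρ, HasFDerivAt G (G' z) z)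
    (hG' : ∀ z ∈ Metric.closedBall z₀ ρ, ‖G' z - D‖ ≤ 1 / (2 * m)) {z z' : Z}
    (hz : z ∈ Metric.closedBall z₀ ρ) (hz' : z' ∈ Metric.closedBall z₀ ρ) :
    ‖z - z'‖ ≤ 2 * m * ‖G z - G z'‖ := by
  have h1 : ‖G z - G z' - D (z - z')‖ ≤ 1 / (2 * m) * ‖z - z'‖ :=
    (convex_closedBall z₀ ρ).norm_image_sub_le_of_norm_hasFDerivWithin_le'
      (fun x hx => (hG x hx).hasFDerivWithinAt) hG' hz' hz
  have h2 : ‖z - z'‖ ≤ m * ‖D (z - z')‖ := by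
    have := (D.symm : Z →L[ℝ] Z).le_opNorm (D (z - z'))
    simp only [ContinuousLinearEquiv.coe_coe, ContinuousLinearEquiv.symm_apply_apply] at this
    exact this.trans (by gcongr)
  have h3 : ‖D (z - z')‖ ≤ ‖G z - G z'‖ + 1 / (2 * m) * ‖z - z'‖ := by
    calc ‖D (z - z')‖ = ‖(G z - G z') - (G z - G z' - D (z - z'))‖ := by rw [sub_sub_cancel]
      _ ≤ _ := (norm_sub_le _ _).trans (by gcongr)
  have h4 : m * (1 / (2 * m) * ‖z - z'‖) = ‖z - z'‖ / 2 := by field_simp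
  nlinarith [mul_le_mul_of_nonneg_left h3 hm.le]

theorem exists_zero_of_fderiv_close [CompleteSpace Z] (hm : 0 < m) (hρ : 0 ≤ ρ)
    (hDm : ‖(D.symm : Z →L[ℝ] Z)‖ ≤ m)
    (hG : ∀ z ∈ Metric.closedBall z₀ ρ, HasFDerivAt G (G' z) z)
    (hG' : ∀ z ∈ Metric.closedBall z₀ ρ, ‖G' z - D‖ ≤ 1 / (2 * m))
    (h0 : 2 * m * ‖G z₀‖ ≤ ρ) : ∃ z ∈ Metric.closedBall z₀ ρ, G z = 0 := by
  have hA : ApproximatesLinearOn G (D : Z →L[ℝ] Z) (Metric.closedBall z₀ ρ)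
      (Real.toNNReal (1 / (2 * m))) := by
    intro x hx y hy
    rw [Real.coe_toNNReal _ (by positivity)]
    exact (convex_closedBall z₀ ρ).norm_image_sub_le_of_norm_hasFDerivWithin_le'
      (fun x hx => (hG x hx).hasFDerivWithinAt) hG' hy hx
  have hS := hA.surjOn_closedBall_of_nonlinearRightInverse
    (ContinuousLinearMap.NonlinearRightInverse.mk (fun y => D.symm y) (Real.toNNReal m)
      (fun y => by
        rw [Real.coe_toNNReal _ hm.le]
        exact ((D.symm : Z →L[ℝ] Z).le_opNorm y).trans (by gcongr)) (fun y => by simp))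
    hρ le_rfl
  have : (0 : Z) ∈ Metric.closedBall (G z₀)
      ((((Real.toNNReal m : NNReal) : ℝ)⁻¹ - (Real.toNNReal (1 / (2 * m)) : NNReal)) * ρ) := by
    rw [Real.coe_toNNReal _ hm.le, Real.coe_toNNReal _ (by positivity), Metric.mem_closedBall,
      dist_zero_left]
    -- The image of the ball contains a ball of radius (‖D⁻¹‖⁻¹ bound minus Lipschitz constant) · ρ
    -- around G(z₀), here ρ/(2m).
    have : (m⁻¹ - 1 / (2 * m)) * ρ = ρ / (2 * m) := by field_simp; ring
    rw [this, le_div_iff₀ (by positivity)]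
    linarith
  obtain ⟨z, hz, hz0⟩ := hS this
  exact ⟨z, hz, hz0⟩

end Quantitative

/-! ### Spaced positions -/

theorem Pos.lt_sub {N : ℕ} {L : ℝ} (hL : 0 ≤ L) {a : Fin N → ℝ} (ha : a ∈ Pos N L) {j k : Fin N}
    (h : j < k) : L < a k - a j := by
  have key : ∀ n : ℕ, ∀ j k : Fin N, (k : ℕ) = j + (n + 1) → L < a k - a j := by
    intro n
    induction n with
    | zero => intro j k hk; exact ha j k (by omega)
    | succ n ih =>
      intro j k hk
      have hlt : (j : ℕ) + (n + 1) < N := by omega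
      have h1 := ih j ⟨j + (n + 1), hlt⟩ rfl
      have h2 := ha ⟨j + (n + 1), hlt⟩ k (by simp; omega)
      linarith
  have h' : (j : ℕ) < k := h
  exact key (k - j - 1) j k (by omega)

theorem Pos.lt_abs_sub {N : ℕ} {L : ℝ} (hL : 0 ≤ L) {a : Fin N → ℝ} (ha : a ∈ Pos N L)
    {j k : Fin N} (h : j ≠ k) : L < |a j - a k| := by
  rcases lt_or_gt_of_ne h with h | h
  · rw [abs_sub_comm]
    exact (Pos.lt_sub hL ha h).trans_le (le_abs_self _)
  · exact (Pos.lt_sub hL ha h).trans_le (le_abs_self _)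

theorem Pos.mono {N : ℕ} {L L' : ℝ} (h : L ≤ L') : Pos N L' ⊆ Pos N L :=
  fun _ ha j k hjk => h.trans_lt (ha j k hjk)

theorem Pos.nonempty (N : ℕ) (L : ℝ) : (Pos N L).Nonempty := by
  refine ⟨fun k => (k : ℝ) * (L + 1), fun j k hjk => ?_⟩
  simp only [hjk]
  push_cast
  linarith

/-! ### Translation groups on a Hilbert space -/

/-- A strongly continuous group of isometries whose orbits tend weakly to `0` at infinity. -/
structure IsTranslationGroup {V : Type*} [NormedAddCommGroup V] [InnerProductSpace ℝ V]
    (T : ℝ → V →ₗᵢ[ℝ] V) : Prop where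
  comp : ∀ a b u, T a (T b u) = T (a + b) u
  zero : ∀ u, T 0 u = u
  continuous : Continuous fun p : ℝ × V => T p.1 p.2
  tendsto_inner : ∀ u w, Tendsto (fun a => inner ℝ (T a u) w) (cocompact ℝ) (𝓝 0)

section Group

variable {V : Type*} [NormedAddCommGroup V] [InnerProductSpace ℝ V] {T : ℝ → V →ₗᵢ[ℝ] V}

namespace IsTranslationGroup

theorem inner_comm (hT : IsTranslationGroup T) (a b : ℝ) (u w : V) :
    inner ℝ (T a u) (T b w) = inner ℝ (T (a - b) u) w := by
  rw [← (T b).inner_map_map (T (a - b) u) w, hT.comp]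
  congr 3
  ring

/-- A period makes the product of T_{ns} u and u equal to ‖u‖² for every n, whereas it must tend to
0. -/
theorem eq_zero_of_periodic (hT : IsTranslationGroup T) {s : ℝ} (hs : s ≠ 0) {u : V}
    (h : T s u = u) : u = 0 := by
  have hn : ∀ n : ℕ, T (n * s) u = u := by
    intro n
    induction n with
    | zero => simpa using hT.zero u
    | succ n ih =>
      have : ((n + 1 : ℕ) : ℝ) * s = n * s + s := by push_cast; ring
      rw [this, ← hT.comp, h, ih]
  have hc : Tendsto (fun n : ℕ => (n : ℝ) * s) atTop (cocompact ℝ) := by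
    rw [← Metric.cobounded_eq_cocompact, ← tendsto_norm_atTop_iff_cobounded]
    simp only [norm_mul, Real.norm_natCast]
    exact tendsto_natCast_atTop_atTop.atTop_mul_const (norm_pos_iff.2 hs)
  have h1 := (hT.tendsto_inner u u).comp hc
  have h2 : (fun a => inner ℝ (T a u) u) ∘ (fun n : ℕ => (n : ℝ) * s)
      = fun _ => inner ℝ u u := by
    funext n
    simp [hn]
  rw [h2] at h1
  exact inner_self_eq_zero.1 (tendsto_nhds_unique tendsto_const_nhds h1)

/-- An ultrafilter that does not escape every compact set contains one, and converges there. Working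
along an ultrafilter replaces the successive extraction of subsequences. -/
theorem exists_limit_or_cocompact {ι : Type*} (𝒰 : Ultrafilter ι) (d : ι → ℝ) :
    (∃ s, Tendsto d 𝒰 (𝓝 s)) ∨ Tendsto d 𝒰 (cocompact ℝ) := by
  by_cases h : Tendsto d 𝒰 (cocompact ℝ)
  · exact Or.inr h
  · left
    rw [Tendsto, Filter.not_le] at h
    obtain ⟨t, ht, ht'⟩ := h
    obtain ⟨K, hK, hKt⟩ := mem_cocompact.1 ht
    have h1 : Kᶜ ∉ 𝒰.map d := fun hmem => ht' (mem_of_superset hmem hKt)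
    have h2 : K ∈ 𝒰.map d := by
      have := Ultrafilter.compl_mem_iff_notMem.2 h1
      rwa [compl_compl] at this
    obtain ⟨s, _, hs⟩ := hK.ultrafilter_le_nhds (𝒰.map d) (le_principal_iff.2 h2)
    exact ⟨s, hs⟩

/-- Two sums of well-separated translates of the same profiles, no two of which are translates of
each other, can only be close if the positions are close. -/
theorem norm_sub_le_of_chain_close (hT : IsTranslationGroup T) {N : ℕ} {q : Fin N → V}
    (h0 : ∀ k, q k ≠ 0) (hne : ∀ j k, j ≠ k → ∀ s, q k ≠ T s (q j)) {ρ : ℝ} (hρ : 0 < ρ) :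
    ∃ β > 0, ∃ L > 0, ∀ a ∈ Pos N L, ∀ b ∈ Pos N L,
      ‖∑ k, T (a k) (q k) - ∑ k, T (b k) (q k)‖ ≤ β → ‖a - b‖ ≤ ρ := by
  by_contra hcon
  push Not at hcon
  have hseq : ∀ n : ℕ, ∃ a b : Fin N → ℝ, a ∈ Pos N (n + 1) ∧ b ∈ Pos N (n + 1) ∧
      ‖∑ k, T (a k) (q k) - ∑ k, T (b k) (q k)‖ ≤ 1 / ((n : ℝ) + 1) ∧ ρ < ‖a - b‖ := by
    intro n
    obtain ⟨a, ha, b, hb, h1, h2⟩ := hcon (1 / ((n : ℝ) + 1)) (by positivity) (n + 1)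
      (by positivity)
    exact ⟨a, b, ha, hb, h1, h2⟩
  choose a b ha hb hab hd using hseq
  have hk : ∀ n, ∃ k, ρ < |a n k - b n k| := by
    intro n
    by_contra hc
    push Not at hc
    exact (hd n).not_ge ((pi_norm_le_iff_of_nonneg hρ.le).2 fun k => by simpa using hc k)
  set 𝒰 : Ultrafilter ℕ := hyperfilter ℕ with h𝒰
  have hle : (𝒰 : Filter ℕ) ≤ atTop := by
    rw [h𝒰, ← Nat.cofinite_eq_atTop]
    exact hyperfilter_le_cofinite
  -- Finitely many indices: the ultrafilter selects one k whose two positions stay more than ρ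
  -- apart.
  have hkU : ∃ k, ∀ᶠ n in (𝒰 : Filter ℕ), ρ < |a n k - b n k| :=
    Ultrafilter.eventually_exists_iff.1 (Eventually.of_forall hk)
  obtain ⟨k, hk⟩ := hkU
  have hspread : ∀ c : ℕ → Fin N → ℝ, (∀ n : ℕ, c n ∈ Pos N (n + 1)) → ∀ i j, i ≠ j →
      Tendsto (fun n => c n i - c n j) 𝒰 (cocompact ℝ) := by
    intro c hc i j hij
    refine Tendsto.mono_left ?_ hle
    rw [← Metric.cobounded_eq_cocompact, ← tendsto_norm_atTop_iff_cobounded]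
    refine tendsto_atTop_mono (fun n => ?_) tendsto_natCast_atTop_atTop
    have := Pos.lt_abs_sub (by positivity) (hc n) hij
    rw [Real.norm_eq_abs]
    linarith
  -- Seen from the moving point `a n k`, the first chain converges weakly to `q k`, all other terms
  -- being sent to infinity. The second chain then has the same weak limit.
  have hA : ∀ φ : V, Tendsto (fun n => inner ℝ (∑ j, T (a n j) (q j)) (T (a n k) φ)) 𝒰
      (𝓝 (inner ℝ (q k) φ)) := by
    intro φ
    have : Tendsto (fun n => ∑ j, inner ℝ (T (a n j - a n k) (q j)) φ) 𝒰
        (𝓝 (∑ j, if j = k then inner ℝ (q k) φ else 0)) := by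
      refine tendsto_finsetSum _ fun j _ => ?_
      by_cases hj : j = k
      · subst hj
        simp [hT.zero]
      · rw [if_neg hj]
        exact (hT.tendsto_inner (q j) φ).comp (hspread a ha j k hj)
    simp only [Finset.sum_ite_eq', Finset.mem_univ, if_true] at this
    refine this.congr fun n => ?_
    rw [sum_inner]
    exact Finset.sum_congr rfl fun j _ => (hT.inner_comm _ _ _ _).symm
  have hdiff : ∀ φ : V, Tendsto (fun n => inner ℝ (∑ j, T (a n j) (q j)) (T (a n k) φ)
      - inner ℝ (∑ j, T (b n j) (q j)) (T (a n k) φ)) 𝒰 (𝓝 0) := by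
    intro φ
    refine Tendsto.mono_left ?_ hle
    refine squeeze_zero_norm (a := fun n : ℕ => 1 / ((n : ℝ) + 1) * ‖φ‖) (fun n => ?_) ?_
    · rw [← inner_sub_left]
      refine (norm_inner_le_norm _ _).trans ?_
      rw [LinearIsometry.norm_map]
      gcongr
      exact hab n
    · simpa using tendsto_one_div_add_atTop_nhds_zero_nat.mul_const ‖φ‖
  have hB : ∀ φ : V, Tendsto (fun n => ∑ j, inner ℝ (T (b n j - a n k) (q j)) φ) 𝒰
      (𝓝 (inner ℝ (q k) φ)) := by
    intro φ
    have := (hA φ).sub (hdiff φ)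
    rw [sub_zero] at this
    refine this.congr fun n => ?_
    rw [sub_sub_cancel, sum_inner]
    exact Finset.sum_congr rfl fun j _ => hT.inner_comm _ _ _ _
  -- If some b_j stays at a bounded distance from a_k, it is the only one, and the weak limit is T_s
  -- (q j); then `q k` = T_s (q j) forces j = k and s = 0, against the gap ρ. If all b_j escape, the
  -- weak limit is 0, against `q k` ≠ 0.
  by_cases hlim : ∃ j s, Tendsto (fun n => b n j - a n k) 𝒰 (𝓝 s)
  · obtain ⟨j, s, hs⟩ := hlim
    have hoff : ∀ i, i ≠ j → Tendsto (fun n => b n i - a n k) 𝒰 (cocompact ℝ) := by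
      intro i hij
      have h1 := (hspread b hb i j hij)
      rw [← Metric.cobounded_eq_cocompact, ← tendsto_norm_atTop_iff_cobounded] at h1 ⊢
      have h2 : Tendsto (fun n => ‖b n i - b n j‖ - ‖b n j - a n k‖) 𝒰 atTop := by
        simpa only [sub_eq_add_neg] using h1.atTop_add hs.norm.neg
      refine tendsto_atTop_mono (fun n => ?_) h2
      have := norm_sub_norm_le (b n i - b n j) (-(b n j - a n k))
      rw [norm_neg] at this
      refine this.trans (le_of_eq ?_)
      congr 1
      ring
    have hq : q k = T s (q j) := by
      refine ext_inner_right ℝ fun φ => ?_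
      refine tendsto_nhds_unique (hB φ) ?_
      have : Tendsto (fun n => ∑ i, inner ℝ (T (b n i - a n k) (q i)) φ) 𝒰
          (𝓝 (∑ i, if i = j then inner ℝ (T s (q j)) φ else 0)) := by
        refine tendsto_finsetSum _ fun i _ => ?_
        by_cases hi : i = j
        · subst hi
          rw [if_pos rfl]
          have hc : Continuous fun s => inner ℝ (T s (q i)) φ :=
            (hT.continuous.comp (continuous_id.prodMk continuous_const)).inner continuous_const
          exact (hc.tendsto s).comp hs
        · rw [if_neg hi]
          exact (hT.tendsto_inner (q i) φ).comp (hoff i hi)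
      simpa only [Finset.sum_ite_eq', Finset.mem_univ, if_true] using this
    by_cases hjk : j = k
    · subst hjk
      have hs0 : s = 0 := by
        by_contra hs0
        exact h0 j (hT.eq_zero_of_periodic hs0 hq.symm)
      rw [hs0] at hs
      have h1 : ∀ᶠ n in (𝒰 : Filter ℕ), ‖b n j - a n j‖ < ρ := by
        have := hs.norm
        rw [norm_zero] at this
        exact this.eventually_lt_const hρ
      obtain ⟨n, hn1, hn2⟩ := (h1.and hk).exists
      rw [Real.norm_eq_abs, abs_sub_comm] at hn1
      linarith
    · exact hne j k hjk s hq
  · push Not at hlim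
    have : Tendsto (fun n => ∑ j, inner ℝ (T (b n j - a n k) (q j)) (q k)) 𝒰
        (𝓝 (∑ _j : Fin N, 0)) := by
      refine tendsto_finsetSum _ fun j _ => ?_
      have hj := (exists_limit_or_cocompact 𝒰 (fun n => b n j - a n k)).resolve_left
        (fun ⟨s, hs⟩ => hlim j s hs)
      exact (hT.tendsto_inner (q j) (q k)).comp hj
    have h1 := tendsto_nhds_unique this (hB (q k))
    simp only [Finset.sum_const_zero] at h1
    exact h0 k (inner_self_eq_zero.1 h1.symm)

end IsTranslationGroup

end Group

/-! ### Orbits of profiles and the derivative of the orthogonality conditions -/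

section Modulation

variable {V : Type*} [NormedAddCommGroup V] [InnerProductSpace ℝ V] {T : ℝ → V →ₗᵢ[ℝ] V}

/-- The family of translates of a curve of profiles. -/
def orbit (T : ℝ → V →ₗᵢ[ℝ] V) (u : ℝ → V) (p : ℝ × ℝ) : V := T p.2 (u p.1)

namespace IsTranslationGroup

theorem norm_orbit (u : ℝ → V) (p : ℝ × ℝ) : ‖orbit T u p‖ = ‖u p.1‖ :=
  LinearIsometry.norm_map _ _

/-- Equivariance reduces the orbit near (c, a) to the orbit near (c, 0). All the uniformity in the
positions comes from this. -/
theorem orbit_eq (hT : IsTranslationGroup T) (u : ℝ → V) (a : ℝ) :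
    orbit T u = fun p => T a (orbit T u (p - (0, a))) := by
  funext p
  simp [orbit, hT.comp]

theorem contDiffAt_orbit (hT : IsTranslationGroup T) {u : ℝ → V} {p : ℝ × ℝ} {a : ℝ}
    (h : ContDiffAt ℝ 1 (orbit T u) (p - (0, a))) : ContDiffAt ℝ 1 (orbit T u) p := by
  rw [hT.orbit_eq u a]
  exact (T a).toContinuousLinearMap.contDiff.contDiffAt.comp p
    (h.comp p (contDiffAt_id.sub contDiffAt_const))

theorem fderiv_orbit (hT : IsTranslationGroup T) {u : ℝ → V} {p : ℝ × ℝ} (a : ℝ)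
    (h : DifferentiableAt ℝ (orbit T u) (p - (0, a))) :
    fderiv ℝ (orbit T u) p
      = (T a).toContinuousLinearMap.comp (fderiv ℝ (orbit T u) (p - (0, a))) := by
  conv_lhs => rw [hT.orbit_eq u a]
  have h1 : HasFDerivAt (fun p : ℝ × ℝ => orbit T u (p - (0, a)))
      (fderiv ℝ (orbit T u) (p - (0, a))) p := by
    have := h.hasFDerivAt.comp p ((hasFDerivAt_id p).sub_const (0, a))
    simpa using! this
  exact ((T a).toContinuousLinearMap.hasFDerivAt.comp p h1).fderiv

/-- The radius comes from continuity at the single point (c, 0). Translating by an isometry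
transports the estimates to every (c, a) without loss. -/
theorem orbit_uniform (hT : IsTranslationGroup T) {u : ℝ → V} {c : ℝ}
    (h : ContDiffAt ℝ 1 (orbit T u) (c, 0)) {δ : ℝ} (hδ : 0 < δ) :
    ∃ ρ > 0, ∀ a, ∀ p ∈ Metric.closedBall (c, a) ρ, ContDiffAt ℝ 1 (orbit T u) p ∧
      ‖orbit T u p - orbit T u (c, a)‖ ≤ δ ∧
      ‖fderiv ℝ (orbit T u) p - fderiv ℝ (orbit T u) (c, a)‖ ≤ δ := by
  have h1 := h.eventually (by simp)
  have h2 : ∀ᶠ p in 𝓝 ((c, 0) : ℝ × ℝ), ‖orbit T u p - orbit T u (c, 0)‖ < δ := by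
    have := (h.continuousAt.sub (continuousAt_const (y := orbit T u (c, 0)))).norm
    exact this.eventually_lt_const (by simpa using hδ)
  have h3 : ∀ᶠ p in 𝓝 ((c, 0) : ℝ × ℝ),
      ‖fderiv ℝ (orbit T u) p - fderiv ℝ (orbit T u) (c, 0)‖ < δ := by
    have hc : ContinuousAt (fderiv ℝ (orbit T u)) (c, 0) :=
      (h.fderiv_right (m := 0) (by simp)).continuousAt
    have := (hc.sub (continuousAt_const (y := fderiv ℝ (orbit T u) (c, 0)))).norm
    exact this.eventually_lt_const (by simpa using hδ)
  obtain ⟨ρ, hρ, H⟩ := Metric.nhds_basis_closedBall.eventually_iff.1 (h1.and (h2.and h3))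
  refine ⟨ρ, hρ, fun a p hp => ?_⟩
  have hp' : p - (0, a) ∈ Metric.closedBall ((c, 0) : ℝ × ℝ) ρ := by
    rw [mem_closedBall_iff_norm] at hp ⊢
    convert hp using 2
    ext <;> simp
  have e0 : ((c, a) : ℝ × ℝ) - (0, a) = (c, 0) := by ext <;> simp
  obtain ⟨k1, k2, k3⟩ := H hp'
  have k0 : DifferentiableAt ℝ (orbit T u) (((c, a) : ℝ × ℝ) - (0, a)) := by
    rw [e0]; exact h.differentiableAt (by simp)
  refine ⟨hT.contDiffAt_orbit k1, ?_, ?_⟩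
  · rw [hT.orbit_eq u a]
    simp only [e0]
    rw [← map_sub, LinearIsometry.norm_map]
    exact k2.le
  · rw [hT.fderiv_orbit a (k1.differentiableAt (by simp)), hT.fderiv_orbit a k0, e0,
      ← ContinuousLinearMap.comp_sub]
    refine ((T a).norm_toContinuousLinearMap_comp).le.trans k3.le

theorem fderiv_orbit_apply (hT : IsTranslationGroup T) {u : ℝ → V} {c : ℝ}
    (h : ContDiffAt ℝ 1 (orbit T u) (c, 0)) (a : ℝ) (ζ : ℝ × ℝ) :
    fderiv ℝ (orbit T u) (c, a) ζ = T a (fderiv ℝ (orbit T u) (c, 0) ζ) := by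
  have e0 : ((c, a) : ℝ × ℝ) - (0, a) = (c, 0) := by ext <;> simp
  rw [hT.fderiv_orbit a (by rw [e0]; exact h.differentiableAt (by simp)), e0]
  rfl

/-- Far apart translates decorrelate. -/
theorem exists_decorrelation (hT : IsTranslationGroup T) {u w : ℝ → V} {c c' : ℝ}
    (h : ContDiffAt ℝ 1 (orbit T u) (c, 0)) {δ : ℝ} (hδ : 0 < δ) :
    ∃ L > 0, ∀ a b : ℝ, L < |a - b| → ∀ ζ : ℝ × ℝ,
      |inner ℝ (fderiv ℝ (orbit T u) (c, a) ζ) (orbit T w (c', b))| ≤ δ * ‖ζ‖ := by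
  set v₁ := fderiv ℝ (orbit T u) (c, 0) (1, 0)
  set v₂ := fderiv ℝ (orbit T u) (c, 0) (0, 1)
  have hev : ∀ v : V, ∀ᶠ a in cocompact ℝ, |inner ℝ (T a v) (w c')| < δ / 2 := by
    intro v
    have := (hT.tendsto_inner v (w c')).norm
    rw [norm_zero] at this
    exact this.eventually_lt_const (half_pos hδ)
  have := (hev v₁).and (hev v₂)
  rw [← Metric.cobounded_eq_cocompact, ← comap_norm_atTop, eventually_comap] at this
  obtain ⟨L, hL⟩ := eventually_atTop.1 this
  refine ⟨max L 1, by positivity, fun a b hab ζ => ?_⟩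
  obtain ⟨k1, k2⟩ := hL |a - b| ((le_max_left _ _).trans hab.le) (a - b) rfl
  have hζ : fderiv ℝ (orbit T u) (c, 0) ζ = ζ.1 • v₁ + ζ.2 • v₂ := by
    rw [← map_smul, ← map_smul, ← map_add]
    congr 1
    ext <;> simp
  rw [hT.fderiv_orbit_apply h, orbit, hT.inner_comm, hζ, map_add, map_smul, map_smul,
    inner_add_left, real_inner_smul_left, real_inner_smul_left]
  refine (abs_add_le _ _).trans ?_
  rw [abs_mul, abs_mul]
  have e1 : |ζ.1| ≤ ‖ζ‖ := norm_fst_le ζ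
  have e2 : |ζ.2| ≤ ‖ζ‖ := norm_snd_le ζ
  calc _ ≤ ‖ζ‖ * (δ / 2) + ‖ζ‖ * (δ / 2) := by gcongr
    _ = δ * ‖ζ‖ := by ring

end IsTranslationGroup

/-- Speeds and positions. -/
abbrev Params (N : ℕ) : Type := (Fin N → ℝ) × (Fin N → ℝ)

/-- The speed and the position of the `k`-th soliton. -/
def Params.coord {N : ℕ} (k : Fin N) : Params N →L[ℝ] ℝ × ℝ :=
  ((ContinuousLinearMap.proj k).comp (ContinuousLinearMap.fst ℝ _ _)).prod
    ((ContinuousLinearMap.proj k).comp (ContinuousLinearMap.snd ℝ _ _))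

theorem Params.norm_coord_le {N : ℕ} (k : Fin N) (z : Params N) : ‖Params.coord k z‖ ≤ ‖z‖ :=
  max_le ((norm_le_pi_norm z.1 k).trans (norm_fst_le z))
    ((norm_le_pi_norm z.2 k).trans (norm_snd_le z))

theorem Params.coord_mem_closedBall {N : ℕ} (k : Fin N) {z z' : Params N} {ρ : ℝ}
    (h : z ∈ Metric.closedBall z' ρ) :
    Params.coord k z ∈ Metric.closedBall (Params.coord k z') ρ := by
  rw [mem_closedBall_iff_norm] at h ⊢
  rw [← map_sub]
  exact (Params.norm_coord_le k _).trans h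

theorem Params.eq_zero_of_coord {N : ℕ} {z : Params N} (h : ∀ k, Params.coord k z = 0) :
    z = 0 := by
  ext k
  · exact congrArg Prod.fst (h k)
  · exact congrArg Prod.snd (h k)

/-- The chain of translated profiles. -/
def chainSum {N : ℕ} (T : ℝ → V →ₗᵢ[ℝ] V) (q : ℝ → V) (z : Params N) : V :=
  ∑ k, orbit T q (Params.coord k z)

/-- The family of functions whose zeros are the orthogonality conditions. -/
def orthoMap {N : ℕ} (T : ℝ → V →ₗᵢ[ℝ] V) (q w : ℝ → V) (p : V × Params N) : Fin N → ℝ :=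
  fun k => inner ℝ (p.1 - chainSum T q p.2) (orbit T w (Params.coord k p.2))

/-- The derivative of `orthoMap` in the parameters. -/
def orthoDeriv {N : ℕ} (T : ℝ → V →ₗᵢ[ℝ] V) (q w : ℝ → V) (p : V × Params N) :
    Params N →L[ℝ] (Fin N → ℝ) :=
  ContinuousLinearMap.pi fun k =>
    (innerSL ℝ (p.1 - chainSum T q p.2)).comp
        ((fderiv ℝ (orbit T w) (Params.coord k p.2)).comp (Params.coord k))
      - (innerSL ℝ (orbit T w (Params.coord k p.2))).comp
        (∑ j, (fderiv ℝ (orbit T q) (Params.coord j p.2)).comp (Params.coord j))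

theorem orthoDeriv_apply {N : ℕ} (q w : ℝ → V) (p : V × Params N) (ζ : Params N) (k : Fin N) :
    orthoDeriv T q w p ζ k
      = inner ℝ (p.1 - chainSum T q p.2)
          (fderiv ℝ (orbit T w) (Params.coord k p.2) (Params.coord k ζ))
        - inner ℝ (∑ j, fderiv ℝ (orbit T q) (Params.coord j p.2) (Params.coord j ζ))
          (orbit T w (Params.coord k p.2)) := by
  simp only [orthoDeriv, ContinuousLinearMap.coe_pi', sub_apply,
    ContinuousLinearMap.comp_apply, innerSL_apply_apply, sum_apply]
  rw [real_inner_comm (orbit T w (Params.coord k p.2))]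

/-- The diagonal part of the derivative, evaluated on the unperturbed chain. -/
def orthoDiag {N : ℕ} (T : ℝ → V →ₗᵢ[ℝ] V) (q w : ℝ → V) (c : Fin N → ℝ) :
    Params N →L[ℝ] (Fin N → ℝ) :=
  ContinuousLinearMap.pi fun k =>
    -(innerSL ℝ (w (c k))).comp ((fderiv ℝ (orbit T q) (c k, 0)).comp (Params.coord k))

theorem orthoDiag_apply {N : ℕ} (q w : ℝ → V) (c : Fin N → ℝ) (ζ : Params N) (k : Fin N) :
    orthoDiag T q w c ζ k
      = -inner ℝ (fderiv ℝ (orbit T q) (c k, 0) (Params.coord k ζ)) (w (c k)) := by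
  simp only [orthoDiag, ContinuousLinearMap.coe_pi', neg_apply,
    ContinuousLinearMap.comp_apply, innerSL_apply_apply]
  rw [real_inner_comm]

theorem contDiffAt_chainSum {N : ℕ} {q : ℝ → V} {z : Params N}
    (hq : ∀ k, ContDiffAt ℝ 1 (orbit T q) (Params.coord k z)) :
    ContDiffAt ℝ 1 (chainSum T q) z :=
  ContDiffAt.sum fun k _ => (hq k).comp z (Params.coord k).contDiff.contDiffAt

theorem contDiffAt_orthoMap {N : ℕ} {q w : ℝ → V} {p : V × Params N}
    (hq : ∀ k, ContDiffAt ℝ 1 (orbit T q) (Params.coord k p.2))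
    (hw : ∀ k, ContDiffAt ℝ 1 (orbit T w) (Params.coord k p.2)) :
    ContDiffAt ℝ 1 (orthoMap T q w) p := by
  refine contDiffAt_pi.2 fun k => ContDiffAt.inner ℝ ?_ ?_
  · exact contDiffAt_fst.sub ((contDiffAt_chainSum hq).comp p contDiffAt_snd)
  · exact (hw k).comp p ((Params.coord k).contDiff.contDiffAt.comp p contDiffAt_snd)

theorem hasFDerivAt_orthoMap {N : ℕ} {q w : ℝ → V} {v : V} {z : Params N}
    (hq : ∀ k, ContDiffAt ℝ 1 (orbit T q) (Params.coord k z))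
    (hw : ∀ k, ContDiffAt ℝ 1 (orbit T w) (Params.coord k z)) :
    HasFDerivAt (fun z => orthoMap T q w (v, z)) (orthoDeriv T q w (v, z)) z := by
  refine hasFDerivAt_pi.2 fun k => ?_
  have h1 : HasFDerivAt (fun z => v - chainSum T q z)
      (-∑ j, (fderiv ℝ (orbit T q) (Params.coord j z)).comp (Params.coord j)) z := by
    refine HasFDerivAt.const_sub ?_ v
    refine HasFDerivAt.fun_sum fun j _ => ?_
    exact ((hq j).differentiableAt (by simp)).hasFDerivAt.comp z (Params.coord j).hasFDerivAt
  have h2 : HasFDerivAt (fun z => orbit T w (Params.coord k z))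
      ((fderiv ℝ (orbit T w) (Params.coord k z)).comp (Params.coord k)) z :=
    ((hw k).differentiableAt (by simp)).hasFDerivAt.comp z (Params.coord k).hasFDerivAt
  refine (h1.inner ℝ h2).congr_fderiv ?_
  ext ζ
  all_goals
    simp only [ContinuousLinearMap.comp_apply, ContinuousLinearMap.prod_apply,
      fderivInnerCLM_apply, sub_apply, innerSL_apply_apply,
      neg_apply, inner_neg_left]
    rw [real_inner_comm (orbit T w (Params.coord k z))]
    rfl

/-- Pointwise comparison of the derivative with its diagonal part. -/
theorem abs_orthoDeriv_sub_le {N : ℕ} {k : Fin N} {x x' : Fin N → V} {y y' e v : V}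
    {δ B t : ℝ} (hδ : 0 ≤ δ) (hδone : δ ≤ 1) (hB : 0 ≤ B) (ht : 0 ≤ t)
    (he : ‖e‖ ≤ δ) (hv : ‖v‖ ≤ (B + 1) * t) (hx : ∀ j, ‖x j - x' j‖ ≤ δ * t)
    (hx' : ∀ j, ‖x' j‖ ≤ B * t) (hy : ‖y - y'‖ ≤ δ) (hy' : ‖y'‖ ≤ B)
    (hoff : ∀ j, j ≠ k → |inner ℝ (x' j) y'| ≤ δ * t) :
    |inner ℝ e v - inner ℝ (∑ j, x j) y + inner ℝ (x' k) y'|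
      ≤ δ * ((B + 1) * (3 * N + 1)) * t := by
  have hyB : ‖y‖ ≤ B + 1 := by
    have := norm_add_le (y - y') y'
    rw [sub_add_cancel] at this
    linarith
  -- The diagonal term of the unperturbed chain cancels. What remains is, for each j, an error in x,
  -- an error in y and an off-diagonal interaction, besides the term containing e.
  have e1 : inner ℝ e v - inner ℝ (∑ j, x j) y + inner ℝ (x' k) y'
      = inner ℝ e v - ∑ j, (inner ℝ (x j - x' j) y + inner ℝ (x' j) (y - y')
        + if j = k then 0 else inner ℝ (x' j) y') := by
    have : ∀ j, (if j = k then 0 else inner ℝ (x' j) y')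
        = inner ℝ (x' j) y' - if j = k then inner ℝ (x' k) y' else 0 := by
      intro j
      by_cases hj : j = k
      · simp [hj]
      · simp [hj]
    simp only [this, inner_sub_left, inner_sub_right, Finset.sum_add_distrib,
      Finset.sum_sub_distrib, Finset.sum_ite_eq', Finset.mem_univ, if_true, sum_inner]
    ring
  rw [e1]
  have hterm : ∀ j, |inner ℝ (x j - x' j) y + inner ℝ (x' j) (y - y')
        + if j = k then 0 else inner ℝ (x' j) y'| ≤ δ * ((B + 1) * 3) * t := by
    intro j
    have h1 : |inner ℝ (x j - x' j) y| ≤ δ * t * (B + 1) :=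
      (abs_real_inner_le_norm _ _).trans
        (mul_le_mul (hx j) hyB (norm_nonneg _) (by positivity))
    have h2 : |inner ℝ (x' j) (y - y')| ≤ B * t * δ :=
      (abs_real_inner_le_norm _ _).trans
        (mul_le_mul (hx' j) hy (norm_nonneg _) (by positivity))
    have h3 : |if j = k then 0 else inner ℝ (x' j) y'| ≤ δ * t := by
      by_cases hj : j = k
      · simp only [hj, if_true, abs_zero]; positivity
      · simpa only [hj, if_false] using hoff j hj
    calc _ ≤ |inner ℝ (x j - x' j) y| + |inner ℝ (x' j) (y - y')|
          + |if j = k then 0 else inner ℝ (x' j) y'| :=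
          (abs_add_le _ _).trans (by gcongr; exact abs_add_le _ _)
      _ ≤ δ * t * (B + 1) + B * t * δ + δ * t := by gcongr
      _ ≤ δ * ((B + 1) * 3) * t := by nlinarith [mul_nonneg (mul_nonneg hδ ht) hB, mul_nonneg hδ ht]
  have hfirst : |inner ℝ e v| ≤ δ * ((B + 1) * t) :=
    (abs_real_inner_le_norm _ _).trans (mul_le_mul he hv (norm_nonneg _) hδ)
  calc _ ≤ |inner ℝ e v| + |∑ j, (inner ℝ (x j - x' j) y + inner ℝ (x' j) (y - y')
        + if j = k then 0 else inner ℝ (x' j) y')| := abs_sub _ _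
    _ ≤ δ * ((B + 1) * t) + ∑ _j : Fin N, δ * ((B + 1) * 3) * t := by
        gcongr
        exact (Finset.abs_sum_le_sum_abs _ _).trans (Finset.sum_le_sum fun j _ => hterm j)
    _ = δ * ((B + 1) * (3 * N + 1)) * t := by
        rw [Finset.sum_const, Finset.card_univ, Fintype.card_fin, nsmul_eq_mul]
        ring

end Modulation

/-! ### Uniform invertibility and the modulation map -/

section Modulation

variable {V : Type*} [NormedAddCommGroup V] [InnerProductSpace ℝ V] {T : ℝ → V →ₗᵢ[ℝ] V}

namespace IsTranslationGroup

/-- Three sources of error, each bounded by δ: the distance from v to the chain, the variation of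
the orbits between z and (c, a), and the interaction of distinct solitons. The diagonal part is
position free because translations preserve inner products. -/
theorem norm_orthoDeriv_sub_le (hT : IsTranslationGroup T) {N : ℕ} {c a : Fin N → ℝ}
    {q w : ℝ → V} {v : V} {z : Params N} {δ B : ℝ}
    (hq : ∀ k, ContDiffAt ℝ 1 (orbit T q) (c k, 0))
    (hw : ∀ k, ContDiffAt ℝ 1 (orbit T w) (c k, 0))
    (hδ : 0 ≤ δ) (hδone : δ ≤ 1) (hB : 0 ≤ B)
    (hBq : ∀ k, ‖fderiv ℝ (orbit T q) (c k, 0)‖ ≤ B)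
    (hBw : ∀ k, ‖fderiv ℝ (orbit T w) (c k, 0)‖ ≤ B) (hBw' : ∀ k, ‖w (c k)‖ ≤ B)
    (he : ‖v - chainSum T q z‖ ≤ δ)
    (h1 : ∀ k, ‖fderiv ℝ (orbit T q) (Params.coord k z)
      - fderiv ℝ (orbit T q) (c k, a k)‖ ≤ δ)
    (h2 : ∀ k, ‖fderiv ℝ (orbit T w) (Params.coord k z)
      - fderiv ℝ (orbit T w) (c k, a k)‖ ≤ δ)
    (h3 : ∀ k, ‖orbit T w (Params.coord k z) - orbit T w (c k, a k)‖ ≤ δ)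
    (hoff : ∀ j k, j ≠ k → ∀ ζ : ℝ × ℝ,
      |inner ℝ (fderiv ℝ (orbit T q) (c j, a j) ζ) (orbit T w (c k, a k))| ≤ δ * ‖ζ‖) :
    ‖orthoDeriv T q w (v, z) - orthoDiag T q w c‖ ≤ δ * ((B + 1) * (3 * N + 1)) := by
  refine ContinuousLinearMap.opNorm_le_bound _ (by positivity) fun ζ => ?_
  refine (pi_norm_le_iff_of_nonneg (by positivity)).2 fun k => ?_
  have hcoord : ∀ j, ‖Params.coord j ζ‖ ≤ ‖ζ‖ := fun j => Params.norm_coord_le j ζ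
  have hdiag : inner ℝ (fderiv ℝ (orbit T q) (c k, 0) (Params.coord k ζ)) (w (c k))
      = inner ℝ (fderiv ℝ (orbit T q) (c k, a k) (Params.coord k ζ))
        (orbit T w (c k, a k)) := by
    rw [hT.fderiv_orbit_apply (hq k) (a k), orbit, LinearIsometry.inner_map_map]
  rw [sub_apply, Pi.sub_apply, orthoDeriv_apply, orthoDiag_apply, hdiag, sub_neg_eq_add,
    Real.norm_eq_abs]
  have hnw : ‖fderiv ℝ (orbit T w) (c k, a k) (Params.coord k ζ)‖ ≤ B * ‖ζ‖ := by
    rw [hT.fderiv_orbit_apply (hw k), LinearIsometry.norm_map]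
    exact (ContinuousLinearMap.le_opNorm _ _).trans
      (mul_le_mul (hBw k) (hcoord k) (norm_nonneg _) hB)
  refine abs_orthoDeriv_sub_le (k := k)
    (x := fun j => fderiv ℝ (orbit T q) (Params.coord j z) (Params.coord j ζ))
    (x' := fun j => fderiv ℝ (orbit T q) (c j, a j) (Params.coord j ζ))
    (y' := orbit T w (c k, a k)) hδ hδone hB (norm_nonneg ζ) he ?_ ?_ ?_ (h3 k) ?_ ?_
  · have e : fderiv ℝ (orbit T w) (Params.coord k z) (Params.coord k ζ)
        = (fderiv ℝ (orbit T w) (Params.coord k z)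
            - fderiv ℝ (orbit T w) (c k, a k)) (Params.coord k ζ)
          + fderiv ℝ (orbit T w) (c k, a k) (Params.coord k ζ) := by
      rw [sub_apply, sub_add_cancel]
    change ‖fderiv ℝ (orbit T w) (Params.coord k z) (Params.coord k ζ)‖ ≤ _
    rw [e]
    refine (norm_add_le _ _).trans ?_
    have := (ContinuousLinearMap.le_opNorm (fderiv ℝ (orbit T w) (Params.coord k z)
            - fderiv ℝ (orbit T w) (c k, a k)) (Params.coord k ζ)).trans
      (mul_le_mul ((h2 k).trans hδone) (hcoord k) (norm_nonneg _) zero_le_one)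
    linarith
  · intro j
    rw [← sub_apply]
    exact (ContinuousLinearMap.le_opNorm _ _).trans
      (mul_le_mul (h1 j) (hcoord j) (norm_nonneg _) hδ)
  · intro j
    rw [hT.fderiv_orbit_apply (hq j), LinearIsometry.norm_map]
    exact (ContinuousLinearMap.le_opNorm _ _).trans
      (mul_le_mul (hBq j) (hcoord j) (norm_nonneg _) hB)
  · rw [norm_orbit]; exact hBw' k
  · intro j hj
    exact (hoff j k hj _).trans (by gcongr; exact hcoord j)

/-- Uniform choices of radii and distances over finitely many indices. -/
theorem exists_pos_forall_of_finite {ι : Type*} [Finite ι] {p : ι → ℝ → Prop}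
    (hp : ∀ i r s, s ≤ r → p i r → p i s) (h : ∀ i, ∃ r > 0, p i r) : ∃ r > 0, ∀ i, p i r := by
  choose r hr hpr using h
  rcases isEmpty_or_nonempty ι with hι | hι
  · exact ⟨1, one_pos, fun i => isEmptyElim i⟩
  · obtain ⟨i₀, hi₀⟩ := Finite.exists_min r
    exact ⟨r i₀, hr i₀, fun i => hp i _ _ (hi₀ i) (hpr i)⟩

theorem exists_pos_forall_of_finite' {ι : Type*} [Finite ι] {p : ι → ℝ → Prop}
    (hp : ∀ i r s, r ≤ s → p i r → p i s) (h : ∀ i, ∃ r > 0, p i r) : ∃ r > 0, ∀ i, p i r := by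
  choose r hr hpr using h
  rcases isEmpty_or_nonempty ι with hι | hι
  · exact ⟨1, one_pos, fun i => isEmptyElim i⟩
  · obtain ⟨i₀, hi₀⟩ := Finite.exists_max r
    exact ⟨r i₀, hr i₀, fun i => hp i _ _ (hi₀ i) (hpr i)⟩

theorem exists_decorrelation_forall (hT : IsTranslationGroup T) {N : ℕ} {c : Fin N → ℝ}
    {q w : ℝ → V} (hq : ∀ k, ContDiffAt ℝ 1 (orbit T q) (c k, 0)) {δ : ℝ} (hδ : 0 < δ) :
    ∃ L > 0, ∀ a ∈ Pos N L, ∀ j k, j ≠ k → ∀ ζ : ℝ × ℝ,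
      |inner ℝ (fderiv ℝ (orbit T q) (c j, a j) ζ) (orbit T w (c k, a k))| ≤ δ * ‖ζ‖ := by
  obtain ⟨L, hL, H⟩ := exists_pos_forall_of_finite' (ι := Fin N × Fin N)
    (p := fun i L => ∀ a b : ℝ, L < |a - b| → ∀ ζ : ℝ × ℝ,
      |inner ℝ (fderiv ℝ (orbit T q) (c i.1, a) ζ) (orbit T w (c i.2, b))| ≤ δ * ‖ζ‖)
    (fun i r s hrs h a b hab => h a b (hrs.trans_lt hab))
    (fun i => hT.exists_decorrelation (hq i.1) hδ)
  exact ⟨L, hL, fun a ha j k hjk => H (j, k) _ _ (Pos.lt_abs_sub hL.le ha hjk)⟩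

theorem orbit_uniform_forall (hT : IsTranslationGroup T) {N : ℕ} {c : Fin N → ℝ} {u : ℝ → V}
    (h : ∀ k, ContDiffAt ℝ 1 (orbit T u) (c k, 0)) {δ : ℝ} (hδ : 0 < δ) :
    ∃ ρ > 0, ∀ (k : Fin N) (a : ℝ), ∀ p ∈ Metric.closedBall (c k, a) ρ,
      ContDiffAt ℝ 1 (orbit T u) p ∧
      ‖orbit T u p - orbit T u (c k, a)‖ ≤ δ ∧
      ‖fderiv ℝ (orbit T u) p - fderiv ℝ (orbit T u) (c k, a)‖ ≤ δ :=
  exists_pos_forall_of_finite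
    (fun _ _ _ hsr H a p hp => H a p (Metric.closedBall_subset_closedBall hsr hp))
    (fun k => hT.orbit_uniform (h k) hδ)

theorem norm_chainSum_sub_le {N : ℕ} {q : ℝ → V} {z z' : Params N} {δ : ℝ}
    (h : ∀ k, ‖orbit T q (Params.coord k z) - orbit T q (Params.coord k z')‖ ≤ δ) :
    ‖chainSum T q z - chainSum T q z'‖ ≤ N * δ := by
  rw [chainSum, chainSum, ← Finset.sum_sub_distrib]
  refine (norm_sum_le _ _).trans ((Finset.sum_le_sum fun k _ => h k).trans (le_of_eq ?_))
  simp

/-- Near every well-spaced chain the derivative of the orthogonality conditions is uniformly close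
to its diagonal part. -/
theorem exists_uniform_orthoDeriv (hT : IsTranslationGroup T) {N : ℕ} {c : Fin N → ℝ}
    {q w : ℝ → V} (hq : ∀ k, ContDiffAt ℝ 1 (orbit T q) (c k, 0))
    (hw : ∀ k, ContDiffAt ℝ 1 (orbit T w) (c k, 0)) {κ : ℝ} (hκ : 0 < κ) :
    ∃ ρ > 0, ∃ α > 0, ∃ L > 0, ∀ a ∈ Pos N L, ∀ v : V, ‖v - chainSum T q (c, a)‖ ≤ α →
      ∀ z ∈ Metric.closedBall ((c, a) : Params N) ρ,
        (∀ k, ContDiffAt ℝ 1 (orbit T q) (Params.coord k z)) ∧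
        (∀ k, ContDiffAt ℝ 1 (orbit T w) (Params.coord k z)) ∧
        ‖orthoDeriv T q w (v, z) - orthoDiag T q w c‖ ≤ κ := by
  set B : ℝ := ∑ k, (‖fderiv ℝ (orbit T q) (c k, 0)‖ + ‖fderiv ℝ (orbit T w) (c k, 0)‖
    + ‖w (c k)‖) with hBdef
  have hBk : ∀ k, ‖fderiv ℝ (orbit T q) (c k, 0)‖ + ‖fderiv ℝ (orbit T w) (c k, 0)‖
      + ‖w (c k)‖ ≤ B := fun k =>
    Finset.single_le_sum (f := fun k => ‖fderiv ℝ (orbit T q) (c k, 0)‖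
      + ‖fderiv ℝ (orbit T w) (c k, 0)‖ + ‖w (c k)‖) (fun _ _ => by positivity)
      (Finset.mem_univ k)
  have hB : 0 ≤ B := Finset.sum_nonneg fun _ _ => by positivity
  have hMpos : 0 < (B + 1) * (3 * (N : ℝ) + 1) := by positivity
  set δ : ℝ := min 1 (κ / ((B + 1) * (3 * N + 1))) with hδdef
  have hδ : 0 < δ := lt_min one_pos (by positivity)
  have hδone : δ ≤ 1 := min_le_left _ _
  have hδκ : δ * ((B + 1) * (3 * N + 1)) ≤ κ := by
    rw [← le_div_iff₀ hMpos]; exact min_le_right _ _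
  -- The N orbit errors then add up to at most δ/2, which leaves δ/2 for the distance from v to the
  -- chain.
  have hδ' : 0 < δ / (2 * (N + 1)) := by positivity
  have hδ'le : δ / (2 * (N + 1)) ≤ δ := by
    refine div_le_self hδ.le ?_
    have : (0 : ℝ) ≤ N := by positivity
    linarith
  obtain ⟨ρ₁, hρ₁, H₁⟩ := hT.orbit_uniform_forall hq hδ'
  obtain ⟨ρ₂, hρ₂, H₂⟩ := hT.orbit_uniform_forall hw hδ'
  obtain ⟨L, hL, HL⟩ := hT.exists_decorrelation_forall (w := w) hq hδ
  refine ⟨min ρ₁ ρ₂, lt_min hρ₁ hρ₂, δ / 2, half_pos hδ, L, hL, fun a ha v hv z hz => ?_⟩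
  have hz₁ := fun k => H₁ k (a k) _ (Metric.closedBall_subset_closedBall (min_le_left _ _)
    (Params.coord_mem_closedBall k hz))
  have hz₂ := fun k => H₂ k (a k) _ (Metric.closedBall_subset_closedBall (min_le_right _ _)
    (Params.coord_mem_closedBall k hz))
  refine ⟨fun k => (hz₁ k).1, fun k => (hz₂ k).1, ?_⟩
  refine (hT.norm_orthoDeriv_sub_le (a := a) hq hw hδ.le hδone hB ?_ ?_ ?_ ?_ ?_ ?_ ?_
    (HL a ha)).trans hδκ
  · intro k; have := hBk k
    linarith [norm_nonneg (fderiv ℝ (orbit T w) (c k, 0)), norm_nonneg (w (c k))]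
  · intro k; have := hBk k
    linarith [norm_nonneg (fderiv ℝ (orbit T q) (c k, 0)), norm_nonneg (w (c k))]
  · intro k; have := hBk k
    linarith [norm_nonneg (fderiv ℝ (orbit T q) (c k, 0)),
      norm_nonneg (fderiv ℝ (orbit T w) (c k, 0))]
  · have h1 : ‖chainSum T q z - chainSum T q (c, a)‖ ≤ N * (δ / (2 * (N + 1))) :=
      norm_chainSum_sub_le fun k => (hz₁ k).2.1
    have h2 : N * (δ / (2 * (N + 1))) ≤ δ / 2 := by
      rw [← mul_div_assoc, div_le_div_iff₀ (by positivity) two_pos]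
      nlinarith
    calc ‖v - chainSum T q z‖
        = ‖(v - chainSum T q (c, a)) - (chainSum T q z - chainSum T q (c, a))‖ := by
          rw [sub_sub_sub_cancel_right]
      _ ≤ δ / 2 + δ / 2 := (norm_sub_le _ _).trans (add_le_add hv (h1.trans h2))
      _ = δ := by ring
  · exact fun k => (hz₁ k).2.2.trans hδ'le
  · exact fun k => (hz₂ k).2.2.trans hδ'le
  · exact fun k => (hz₂ k).2.1.trans hδ'le

end IsTranslationGroup

/-- The `2N` orthogonality conditions. -/
def orthoPair {N : ℕ} (T : ℝ → V →ₗᵢ[ℝ] V) (q w₁ w₂ : ℝ → V) (p : V × Params N) : Params N :=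
  (orthoMap T q w₁ p, orthoMap T q w₂ p)

namespace IsTranslationGroup

/-- Modulation near well-spaced chains, on a single ball around each chain. -/
theorem exists_local_modulation (hT : IsTranslationGroup T) {N : ℕ} {c : Fin N → ℝ}
    {q w₁ w₂ : ℝ → V} (hq : ∀ k, ContDiffAt ℝ 1 (orbit T q) (c k, 0))
    (hw₁ : ∀ k, ContDiffAt ℝ 1 (orbit T w₁) (c k, 0))
    (hw₂ : ∀ k, ContDiffAt ℝ 1 (orbit T w₂) (c k, 0))
    (hnd : ∀ (k) (ζ : ℝ × ℝ), inner ℝ (fderiv ℝ (orbit T q) (c k, 0) ζ) (w₁ (c k)) = 0 →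
      inner ℝ (fderiv ℝ (orbit T q) (c k, 0) ζ) (w₂ (c k)) = 0 → ζ = 0)
    {ρ₀ : ℝ} (hρ₀ : 0 < ρ₀) :
    ∃ ρ > 0, ρ ≤ ρ₀ ∧ ∃ α₀ > 0, ∃ L > 0, ∃ K > 0, ∀ α ≤ α₀, ∀ a ∈ Pos N L, ∀ v : V,
      ‖v - chainSum T q (c, a)‖ ≤ α →
      (∀ z ∈ Metric.closedBall ((c, a) : Params N) ρ,
        ContDiffAt ℝ 1 (orthoPair T q w₁ w₂) (v, z) ∧
        (fderiv ℝ (orthoPair T q w₁ w₂) (v, z) ∘L .inr ℝ V (Params N)).IsInvertible) ∧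
      (∀ z ∈ Metric.closedBall ((c, a) : Params N) ρ,
        ∀ z' ∈ Metric.closedBall ((c, a) : Params N) ρ,
        orthoPair T q w₁ w₂ (v, z) = 0 → orthoPair T q w₁ w₂ (v, z') = 0 → z = z') ∧
      ∃ z : Params N, ‖z - (c, a)‖ ≤ K * ‖v - chainSum T q (c, a)‖ ∧ ‖z - (c, a)‖ ≤ ρ ∧
        orthoPair T q w₁ w₂ (v, z) = 0 := by
  -- A block diagonal map with one 2 × 2 block per soliton, independent of the positions. The
  -- nondegeneracy hypothesis makes it injective, hence invertible in finite dimension.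
  set D₀ : Params N →L[ℝ] Params N := (orthoDiag T q w₁ c).prod (orthoDiag T q w₂ c) with hD₀
  have hinj : Function.Injective (D₀ : Params N →ₗ[ℝ] Params N) := by
    rw [← LinearMap.ker_eq_bot, LinearMap.ker_eq_bot']
    intro ζ hζ
    have e1 : orthoDiag T q w₁ c ζ = 0 := congrArg Prod.fst hζ
    have e2 : orthoDiag T q w₂ c ζ = 0 := congrArg Prod.snd hζ
    refine Params.eq_zero_of_coord fun k => hnd k _ ?_ ?_
    · have := congrFun e1 k
      rw [orthoDiag_apply] at this
      exact neg_eq_zero.1 this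
    · have := congrFun e2 k
      rw [orthoDiag_apply] at this
      exact neg_eq_zero.1 this
  set D : Params N ≃L[ℝ] Params N :=
    (LinearEquiv.ofInjectiveEndo (D₀ : Params N →ₗ[ℝ] Params N) hinj).toContinuousLinearEquiv
  have hD : (D : Params N →L[ℝ] Params N) = D₀ := by
    ext ζ <;> rfl
  set m : ℝ := ‖(D.symm : Params N →L[ℝ] Params N)‖ + 1 with hm
  have hmpos : 0 < m := by positivity
  have hDm : ‖(D.symm : Params N →L[ℝ] Params N)‖ ≤ m := by rw [hm]; linarith
  have hκ : 0 < 1 / (2 * m) := by positivity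
  obtain ⟨ρ₁, hρ₁, α₁, hα₁, L₁, hL₁, H₁⟩ := hT.exists_uniform_orthoDeriv hq hw₁ hκ
  obtain ⟨ρ₂, hρ₂, α₂, hα₂, L₂, hL₂, H₂⟩ := hT.exists_uniform_orthoDeriv hq hw₂ hκ
  set ρ : ℝ := min ρ₀ (min ρ₁ ρ₂) with hρdef
  have hρ : 0 < ρ := lt_min hρ₀ (lt_min hρ₁ hρ₂)
  have hρle₁ : ρ ≤ ρ₁ := (min_le_right _ _).trans (min_le_left _ _)
  have hρle₂ : ρ ≤ ρ₂ := (min_le_right _ _).trans (min_le_right _ _)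
  set B : ℝ := ∑ k, (‖w₁ (c k)‖ + ‖w₂ (c k)‖) with hBdef
  have hB : 0 ≤ B := Finset.sum_nonneg fun _ _ => by positivity
  have hBk : ∀ k, ‖w₁ (c k)‖ + ‖w₂ (c k)‖ ≤ B := fun k =>
    Finset.single_le_sum (f := fun k => ‖w₁ (c k)‖ + ‖w₂ (c k)‖) (fun _ _ => by positivity)
      (Finset.mem_univ k)
  -- The zero lies within 2m‖G(c, a)‖ of (c, a), and ‖G(c, a)‖ ≤ (B + 1) times the distance from v
  -- to the chain. The threshold ρ/K below keeps the zero in the ball.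
  set K : ℝ := 2 * m * (B + 1) with hK
  have hKpos : 0 < K := by positivity
  refine ⟨ρ, hρ, min_le_left _ _, min (min α₁ α₂) (ρ / K),
    lt_min (lt_min hα₁ hα₂) (by positivity),
    max L₁ L₂, by positivity, K, hKpos, fun α hα a ha v hv => ?_⟩
  have hva : ‖v - chainSum T q (c, a)‖ ≤ min (min α₁ α₂) (ρ / K) := hv.trans hα
  have hz₁ := H₁ a (Pos.mono (le_max_left _ _) ha) v
    (hva.trans ((min_le_left _ _).trans (min_le_left _ _)))
  have hz₂ := H₂ a (Pos.mono (le_max_right _ _) ha) v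
    (hva.trans ((min_le_left _ _).trans (min_le_right _ _)))
  have hvρ : K * ‖v - chainSum T q (c, a)‖ ≤ ρ := by
    have := hva.trans (min_le_right _ _)
    rwa [le_div_iff₀ hKpos, mul_comm] at this
  set G : Params N → Params N := fun z => orthoPair T q w₁ w₂ (v, z)
  set G' : Params N → Params N →L[ℝ] Params N := fun z =>
    (orthoDeriv T q w₁ (v, z)).prod (orthoDeriv T q w₂ (v, z))
  have hG : ∀ z ∈ Metric.closedBall ((c, a) : Params N) ρ, HasFDerivAt G (G' z) z := by
    intro z hz
    obtain ⟨p1, p2, _⟩ := hz₁ z (Metric.closedBall_subset_closedBall hρle₁ hz)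
    obtain ⟨_, p3, _⟩ := hz₂ z (Metric.closedBall_subset_closedBall hρle₂ hz)
    exact (hasFDerivAt_orthoMap p1 p2).prodMk (hasFDerivAt_orthoMap p1 p3)
  have hG' : ∀ z ∈ Metric.closedBall ((c, a) : Params N) ρ, ‖G' z - D‖ ≤ 1 / (2 * m) := by
    intro z hz
    obtain ⟨_, _, p1⟩ := hz₁ z (Metric.closedBall_subset_closedBall hρle₁ hz)
    obtain ⟨_, _, p2⟩ := hz₂ z (Metric.closedBall_subset_closedBall hρle₂ hz)
    rw [hD]
    refine ContinuousLinearMap.opNorm_le_bound _ hκ.le fun ζ => ?_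
    refine max_le ?_ ?_
    · exact (ContinuousLinearMap.le_opNorm (orthoDeriv T q w₁ (v, z) - orthoDiag T q w₁ c)
        ζ).trans (by gcongr)
    · exact (ContinuousLinearMap.le_opNorm (orthoDeriv T q w₂ (v, z) - orthoDiag T q w₂ c)
        ζ).trans (by gcongr)
  have hG0 : ‖G (c, a)‖ ≤ (B + 1) * ‖v - chainSum T q (c, a)‖ := by
    have hcomp : ∀ w : ℝ → V, (∀ k, ‖w (c k)‖ ≤ B + 1) →
        ‖orthoMap T q w (v, (c, a))‖ ≤ (B + 1) * ‖v - chainSum T q (c, a)‖ := by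
      intro w hw
      refine (pi_norm_le_iff_of_nonneg (by positivity)).2 fun k => ?_
      refine (norm_inner_le_norm _ _).trans ?_
      rw [mul_comm, norm_orbit]
      exact mul_le_mul_of_nonneg_right (hw k) (norm_nonneg _)
    refine max_le (hcomp w₁ fun k => ?_) (hcomp w₂ fun k => ?_)
    · have := hBk k; linarith [norm_nonneg (w₂ (c k))]
    · have := hBk k; linarith [norm_nonneg (w₁ (c k))]
  have hG0' : 2 * m * ‖G (c, a)‖ ≤ K * ‖v - chainSum T q (c, a)‖ := by
    rw [hK, mul_assoc (2 * m)]
    gcongr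
  refine ⟨fun z hz => ?_, fun z hz z' hz' h h' => ?_, ?_⟩
  · obtain ⟨p1, p2, _⟩ := hz₁ z (Metric.closedBall_subset_closedBall hρle₁ hz)
    obtain ⟨_, p3, _⟩ := hz₂ z (Metric.closedBall_subset_closedBall hρle₂ hz)
    have hcd : ContDiffAt ℝ 1 (orthoPair T q w₁ w₂) (v, z) :=
      (contDiffAt_orthoMap p1 p2).prodMk (contDiffAt_orthoMap p1 p3)
    refine ⟨hcd, ?_⟩
    have hcomp : fderiv ℝ (orthoPair T q w₁ w₂) (v, z) ∘L .inr ℝ V (Params N) = G' z := by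
      have h1 : HasFDerivAt G (fderiv ℝ (orthoPair T q w₁ w₂) (v, z) ∘L .inr ℝ V (Params N)) z :=
        (hcd.differentiableAt (by simp)).hasFDerivAt.comp z (hasFDerivAt_prodMk_right v z)
      exact h1.unique (hG z hz)
    rw [hcomp]
    -- A kernel vector would satisfy ‖ζ‖ ≤ m‖D ζ‖ ≤ ‖ζ‖/2.
    have hinj' : Function.Injective (G' z : Params N →ₗ[ℝ] Params N) := by
      rw [← LinearMap.ker_eq_bot, LinearMap.ker_eq_bot']
      intro ζ hζ
      have hζ' : G' z ζ = 0 := hζ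
      have e1 : ‖ζ‖ ≤ m * ‖D ζ‖ := by
        have := (D.symm : Params N →L[ℝ] Params N).le_opNorm (D ζ)
        simp only [ContinuousLinearEquiv.coe_coe,
          ContinuousLinearEquiv.symm_apply_apply] at this
        exact this.trans (by gcongr)
      have e2 : ‖D ζ‖ ≤ 1 / (2 * m) * ‖ζ‖ := by
        have := (G' z - D).le_opNorm ζ
        rw [sub_apply, hζ', zero_sub, norm_neg] at this
        exact this.trans (by gcongr; exact hG' z hz)
      have e3 : m * (1 / (2 * m) * ‖ζ‖) = ‖ζ‖ / 2 := by field_simp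
      have e4 := mul_le_mul_of_nonneg_left e2 hmpos.le
      have : ‖ζ‖ ≤ 0 := by linarith
      exact norm_le_zero_iff.1 this
    exact ⟨(LinearEquiv.ofInjectiveEndo (G' z : Params N →ₗ[ℝ] Params N)
      hinj').toContinuousLinearEquiv, by ext ζ <;> rfl⟩
  · have := norm_sub_le_of_fderiv_close hmpos hDm hG hG' hz hz'
    change ‖z - z'‖ ≤ 2 * m * ‖orthoPair T q w₁ w₂ (v, z) - orthoPair T q w₁ w₂ (v, z')‖ at this
    rw [h, h', sub_zero, norm_zero, mul_zero] at this
    exact sub_eq_zero.1 (norm_le_zero_iff.1 this)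
  · obtain ⟨z, hz, hz0⟩ := exists_zero_of_fderiv_close hmpos hρ.le hDm hG hG' (hG0'.trans hvρ)
    have h1 := norm_sub_le_of_fderiv_close hmpos hDm hG hG' hz
      (Metric.mem_closedBall_self hρ.le)
    rw [hz0, zero_sub, norm_neg] at h1
    exact ⟨z, h1.trans hG0', mem_closedBall_iff_norm.1 hz, hz0⟩

/-- Modulation: near every well-spaced chain, speeds and positions can be chosen in a unique and
continuously differentiable way such that the orthogonality conditions hold. -/
theorem exists_modulation [CompleteSpace V] (hT : IsTranslationGroup T) {N : ℕ} {c : Fin N → ℝ}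
    {q w₁ w₂ : ℝ → V} (hq : ∀ k, ContDiffAt ℝ 1 (orbit T q) (c k, 0))
    (hw₁ : ∀ k, ContDiffAt ℝ 1 (orbit T w₁) (c k, 0))
    (hw₂ : ∀ k, ContDiffAt ℝ 1 (orbit T w₂) (c k, 0))
    (hnd : ∀ (k) (ζ : ℝ × ℝ), inner ℝ (fderiv ℝ (orbit T q) (c k, 0) ζ) (w₁ (c k)) = 0 →
      inner ℝ (fderiv ℝ (orbit T q) (c k, 0) ζ) (w₂ (c k)) = 0 → ζ = 0)
    (h0 : ∀ k, q (c k) ≠ 0) (hne : ∀ j k, j ≠ k → ∀ s, q (c k) ≠ T s (q (c j)))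
    {ρ₀ : ℝ} (hρ₀ : 0 < ρ₀) :
    ∃ α > 0, ∃ L > 0, ∃ K > 0, ∃ Z : V → Params N, ∀ v : V, ∀ a ∈ Pos N L,
      (‖v - chainSum T q (c, a)‖ ≤ α → orthoPair T q w₁ w₂ (v, Z v) = 0 ∧
        ‖Z v - (c, a)‖ ≤ K * ‖v - chainSum T q (c, a)‖ ∧ ‖Z v - (c, a)‖ ≤ ρ₀) ∧
      (‖v - chainSum T q (c, a)‖ < α → ContDiffAt ℝ 1 Z v) := by
  obtain ⟨ρ, hρ, hρle, α₀, hα₀, L₁, hL₁, K, hK, H⟩ :=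
    hT.exists_local_modulation hq hw₁ hw₂ hnd hρ₀
  obtain ⟨β, hβ, L₂, hL₂, Hsep⟩ := hT.norm_sub_le_of_chain_close (q := fun k => q (c k))
    h0 hne (half_pos hρ)
  -- Two chains within β/2 of v are within β of each other, so their positions differ by at most
  -- ρ/2. The bound ρ/(4K) puts the zero within ρ/4 of its own chain, hence still in the ball of
  -- radius ρ around the other one.
  set α : ℝ := min α₀ (min (β / 2) (ρ / (4 * K))) with hαdef
  have hα : 0 < α := lt_min hα₀ (lt_min (by positivity) (by positivity))
  have hαβ : α ≤ β / 2 := (min_le_right _ _).trans (min_le_left _ _)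
  have hαK : K * α ≤ ρ / 4 := by
    have : α ≤ ρ / (4 * K) := (min_le_right _ _).trans (min_le_right _ _)
    rw [le_div_iff₀ (by positivity)] at this
    linarith
  set L : ℝ := max L₁ L₂
  have H' := H α (min_le_left _ _)
  have hpos₁ : ∀ {a : Fin N → ℝ}, a ∈ Pos N L → a ∈ Pos N L₁ :=
    fun ha => Pos.mono (le_max_left _ _) ha
  have hclose : ∀ v : V, ∀ a ∈ Pos N L, ∀ b ∈ Pos N L, ‖v - chainSum T q (c, a)‖ ≤ α →
      ‖v - chainSum T q (c, b)‖ ≤ α → ‖a - b‖ ≤ ρ / 2 := by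
    intro v a ha b hb h1 h2
    refine Hsep a (Pos.mono (le_max_right _ _) ha) b (Pos.mono (le_max_right _ _) hb) ?_
    change ‖chainSum T q (c, a) - chainSum T q (c, b)‖ ≤ β
    calc _ = ‖(v - chainSum T q (c, b)) - (v - chainSum T q (c, a))‖ := by
          rw [sub_sub_sub_cancel_left]
      _ ≤ α + α := (norm_sub_le _ _).trans (add_le_add h2 h1)
      _ ≤ β := by linarith
  -- One zero serves all nearby chains at once: built from the chain a, it lies in the uniqueness
  -- ball of any other chain b, and so inherits the estimate relative to b.
  have hex : ∀ v : V, ∃ z : Params N, ∀ a ∈ Pos N L, ‖v - chainSum T q (c, a)‖ ≤ α →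
      orthoPair T q w₁ w₂ (v, z) = 0 ∧ ‖z - (c, a)‖ ≤ K * ‖v - chainSum T q (c, a)‖ := by
    intro v
    by_cases hv : ∃ a ∈ Pos N L, ‖v - chainSum T q (c, a)‖ ≤ α
    · obtain ⟨a, ha, hva⟩ := hv
      obtain ⟨_, _, z, hz1, hz2, hz3⟩ := H' a (hpos₁ ha) v hva
      refine ⟨z, fun b hb hvb => ⟨hz3, ?_⟩⟩
      obtain ⟨_, huniq, z', hz1', hz2', hz3'⟩ := H' b (hpos₁ hb) v hvb
      have hzb : z ∈ Metric.closedBall ((c, b) : Params N) ρ := by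
        rw [mem_closedBall_iff_norm]
        have e : ‖((c, a) : Params N) - (c, b)‖ ≤ ρ / 2 := by
          rw [Prod.mk_sub_mk, sub_self, Prod.norm_mk, norm_zero]
          exact max_le (by positivity) (hclose v a ha b hb hva hvb)
        have e2 : ‖z - (c, a)‖ ≤ ρ / 4 :=
          hz1.trans ((mul_le_mul_of_nonneg_left hva hK.le).trans hαK)
        calc ‖z - (c, b)‖ = ‖(z - (c, a)) + ((c, a) - (c, b))‖ := by rw [sub_add_sub_cancel]
          _ ≤ ρ / 4 + ρ / 2 := (norm_add_le _ _).trans (add_le_add e2 e)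
          _ ≤ ρ := by linarith
      rw [huniq z hzb z' (mem_closedBall_iff_norm.2 hz2') hz3 hz3']
      exact hz1'
    -- Away from all well-spaced chains the value is arbitrary, since every requirement there is
    -- vacuous.
    · exact ⟨0, fun a ha hva => absurd ⟨a, ha, hva⟩ hv⟩
  choose Z hZ using hex
  have hZρ : ∀ v : V, ∀ a ∈ Pos N L, ‖v - chainSum T q (c, a)‖ ≤ α → ‖Z v - (c, a)‖ ≤ ρ / 4 :=
    fun v a ha hva => (hZ v a ha hva).2.trans
      ((mul_le_mul_of_nonneg_left hva hK.le).trans hαK)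
  refine ⟨α, hα, L, by positivity, K, hK, Z, fun v a ha => ⟨fun hva => ⟨(hZ v a ha hva).1,
    (hZ v a ha hva).2, (hZρ v a ha hva).trans (by linarith)⟩, fun hva => ?_⟩⟩
  have hZv := hZρ v a ha hva.le
  obtain ⟨hreg, _, _⟩ := H' a (hpos₁ ha) v hva.le
  obtain ⟨hcd, hinv⟩ := hreg (Z v) (mem_closedBall_iff_norm.2 (hZv.trans (by linarith)))
  have hψ := hcd.contDiffAt_implicitFunction one_ne_zero hinv
  -- Z was obtained by choice; it is C¹ because, near v, local uniqueness identifies it with the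
  -- implicit function through `Z v`.
  refine hψ.congr_of_eventuallyEq ?_
  have hev1 : ∀ᶠ v' in 𝓝 v, ‖v' - chainSum T q (c, a)‖ < α := by
    have : ContinuousAt (fun v' => ‖v' - chainSum T q (c, a)‖) v := by fun_prop
    exact this.eventually_lt_const hva
  have hev2 : ∀ᶠ v' in 𝓝 v,
      ‖hcd.implicitFunction one_ne_zero hinv v' - (c, a)‖ < ρ := by
    have h1 : ContinuousAt (fun v' => ‖hcd.implicitFunction one_ne_zero hinv v'
        - ((c, a) : Params N)‖) v := (hψ.continuousAt.sub continuousAt_const).norm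
    refine h1.eventually_lt_const ?_
    have := hcd.implicitFunction_apply_self one_ne_zero hinv
    simp only at this ⊢
    rw [this]
    linarith
  filter_upwards [hev1, hev2, hcd.eventually_apply_implicitFunction one_ne_zero hinv]
    with v' h1 h2 h3
  obtain ⟨_, huniq, _⟩ := H' a (hpos₁ ha) v' h1.le
  refine huniq _ (mem_closedBall_iff_norm.2 ((hZρ v' a ha h1.le).trans (by linarith))) _
    (mem_closedBall_iff_norm.2 h2.le) (hZ v' a ha h1.le).1 ?_
  rw [h3]
  exact (hZ v a ha hva.le).1

end IsTranslationGroup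

end Modulation

/-! ### Coordinates of the Sobolev spaces -/

/-- The `j`-th weak derivative as a continuous linear map. -/
def H.derL {k : ℕ} (j : Fin (k + 1)) : H k →L[ℝ] L2 :=
  (PiLp.proj 2 (fun _ : Fin (k + 1) => L2) j).comp (sobolevSubmodule k).subtypeL

theorem H.norm_sq_eq {k : ℕ} (u : H k) : ‖u‖ ^ 2 = ∑ j, ‖u.der j‖ ^ 2 := by
  rw [Submodule.coe_norm, PiLp.norm_sq_eq_of_L2]
  rfl

theorem H.ext_der {k : ℕ} {u w : H k} (h : ∀ j, u.der j = w.der j) : u = w :=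
  Subtype.ext (PiLp.ext h)

/-- Weak derivatives are unique, so the first entry of the tuple determines all the others. -/
theorem H.eq_of_der_zero {k : ℕ} {u w : H k} (h : u.der 0 = w.der 0) : u = w := by
  refine H.ext_der fun j => ?_
  induction j using Fin.induction with
  | zero => exact h
  | succ j ih =>
    refine HasWeakDeriv.unique (u := u.der j.castSucc) (u.2 j) ?_
    rw [ih]
    exact w.2 j

/-- `L² × L²` with its Hilbert norm. -/
abbrev L2Pair : Type := WithLp 2 (L2 × L2)

/-- The pair of functions underlying an element of `X^k(ℝ)`. -/
def X.pair {k : ℕ} : X k →L[ℝ] L2Pair :=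
  (WithLp.prodContinuousLinearEquiv 2 ℝ L2 L2).symm.toContinuousLinearMap.comp
    (((H.derL 0).comp (WithLp.fstL 2 ℝ _ _)).prod ((H.derL 0).comp (WithLp.sndL 2 ℝ _ _)))

theorem X.pair_apply {k : ℕ} (P : X k) : X.pair P = WithLp.toLp 2 (P.fst.der 0, P.snd.der 0) :=
  rfl

/-- The pair of first derivatives of an element of `X^{k+1}(ℝ)`. -/
def X.pairDx {k : ℕ} : X (k + 1) →L[ℝ] L2Pair :=
  (WithLp.prodContinuousLinearEquiv 2 ℝ L2 L2).symm.toContinuousLinearMap.comp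
    (((H.derL 1).comp (WithLp.fstL 2 ℝ _ _)).prod ((H.derL 1).comp (WithLp.sndL 2 ℝ _ _)))

theorem X.pairDx_apply {k : ℕ} (P : X (k + 1)) :
    X.pairDx P = WithLp.toLp 2 (P.fst.der 1, P.snd.der 1) :=
  rfl

/-- The pair of second derivatives of an element of `X^{k+2}(ℝ)`. -/
def X.pairDxx {k : ℕ} : X (k + 2) →L[ℝ] L2Pair :=
  (WithLp.prodContinuousLinearEquiv 2 ℝ L2 L2).symm.toContinuousLinearMap.comp
    (((H.derL 2).comp (WithLp.fstL 2 ℝ _ _)).prod ((H.derL 2).comp (WithLp.sndL 2 ℝ _ _)))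

theorem L2Pair.norm_sq_eq (p : L2Pair) : ‖p‖ ^ 2 = ‖p.fst‖ ^ 2 + ‖p.snd‖ ^ 2 :=
  WithLp.prod_norm_sq_eq_of_L2 p

theorem L2Pair.inner_eq (p r : L2Pair) :
    inner ℝ p r = inner ℝ p.fst r.fst + inner ℝ p.snd r.snd :=
  WithLp.prod_inner_apply p r

theorem X.norm_sq_eq {k : ℕ} (P : X k) : ‖P‖ ^ 2 = ‖P.fst‖ ^ 2 + ‖P.snd‖ ^ 2 :=
  WithLp.prod_norm_sq_eq_of_L2 P

/-- Closeness to a chain in X implies closeness in L² × L², where the modulation takes place. -/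
theorem X.norm_pair_le {k : ℕ} (P : X k) : ‖X.pair P‖ ≤ ‖P‖ := by
  refine (sq_le_sq₀ (norm_nonneg _) (norm_nonneg _)).1 ?_
  rw [L2Pair.norm_sq_eq, X.norm_sq_eq, H.norm_sq_eq, H.norm_sq_eq, X.pair_apply]
  gcongr
  · exact Finset.single_le_sum (f := fun j => ‖P.fst.der j‖ ^ 2) (fun _ _ => by positivity)
      (Finset.mem_univ 0)
  · exact Finset.single_le_sum (f := fun j => ‖P.snd.der j‖ ^ 2) (fun _ _ => by positivity)
      (Finset.mem_univ 0)

theorem X.norm_le_sum (P : X 0) : ‖P‖ ≤ ‖P.fst.der 0‖ + ‖P.fst.der 1‖ + ‖P.snd.der 0‖ := by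
  refine (sq_le_sq₀ (norm_nonneg _) (by positivity)).1 ?_
  rw [X.norm_sq_eq, H.norm_sq_eq, H.norm_sq_eq]
  simp only [Nat.reduceAdd, Fin.sum_univ_two, Finset.univ_unique, Fin.default_eq_zero,
    Finset.sum_singleton]
  nlinarith [norm_nonneg (P.fst.der 0), norm_nonneg (P.fst.der 1), norm_nonneg (P.snd.der 0),
    mul_nonneg (norm_nonneg (P.fst.der 0)) (norm_nonneg (P.fst.der 1)),
    mul_nonneg (norm_nonneg (P.fst.der 0)) (norm_nonneg (P.snd.der 0)),
    mul_nonneg (norm_nonneg (P.fst.der 1)) (norm_nonneg (P.snd.der 0))]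

/-- Translations of `L² × L²`. -/
def L2Pair.shift (a : ℝ) : L2Pair →ₗᵢ[ℝ] L2Pair where
  toFun p := WithLp.toLp 2 (L2.shift a p.fst, L2.shift a p.snd)
  map_add' p r := by
    simp only [WithLp.add_fst, WithLp.add_snd, map_add]
    rfl
  map_smul' t p := by
    simp only [WithLp.smul_fst, WithLp.smul_snd, map_smul]
    rfl
  norm_map' p := by
    refine (sq_eq_sq₀ (norm_nonneg _) (norm_nonneg _)).1 ?_
    rw [L2Pair.norm_sq_eq, L2Pair.norm_sq_eq]
    simp

theorem L2Pair.shift_apply (a : ℝ) (p : L2Pair) :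
    L2Pair.shift a p = WithLp.toLp 2 (L2.shift a p.fst, L2.shift a p.snd) := rfl

theorem L2Pair.isTranslationGroup : IsTranslationGroup L2Pair.shift where
  comp a b u := by
    rw [L2Pair.shift_apply, L2Pair.shift_apply, L2Pair.shift_apply, ← L2.shift_shift,
      ← L2.shift_shift]
    rfl
  zero u := by
    simp only [L2Pair.shift_apply, L2.shift_zero]
    rfl
  continuous := by
    refine (WithLp.prod_continuous_toLp 2 L2 L2).comp (Continuous.prodMk ?_ ?_)
    · exact L2.continuous_shift.comp
        (continuous_fst.prodMk ((WithLp.fstL 2 ℝ L2 L2).continuous.comp continuous_snd))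
    · exact L2.continuous_shift.comp
        (continuous_fst.prodMk ((WithLp.sndL 2 ℝ L2 L2).continuous.comp continuous_snd))
  tendsto_inner u w := by
    simp only [L2Pair.inner_eq, L2Pair.shift_apply]
    simpa using (L2.tendsto_inner_shift u.fst w.fst).add (L2.tendsto_inner_shift u.snd w.snd)

/-- Exchange of the two components. -/
def L2Pair.swap : L2Pair →L[ℝ] L2Pair :=
  (WithLp.prodContinuousLinearEquiv 2 ℝ L2 L2).symm.toContinuousLinearMap.comp
    ((WithLp.sndL 2 ℝ L2 L2).prod (WithLp.fstL 2 ℝ L2 L2))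

theorem L2Pair.swap_apply (p : L2Pair) : L2Pair.swap p = WithLp.toLp 2 (p.snd, p.fst) := rfl

theorem L2Pair.inner_swap_comm (p r : L2Pair) :
    inner ℝ (L2Pair.swap p) r = inner ℝ (L2Pair.swap r) p := by
  rw [L2Pair.inner_eq, L2Pair.inner_eq, add_comm]
  exact congrArg₂ (· + ·) (real_inner_comm _ _) (real_inner_comm _ _)

theorem L2Pair.swap_shift (a : ℝ) (p : L2Pair) :
    L2Pair.swap (L2Pair.shift a p) = L2Pair.shift a (L2Pair.swap p) := rfl

theorem L2Pair.hasDerivAt_shift {p r : L2Pair} (h₁ : HasWeakDeriv p.fst r.fst)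
    (h₂ : HasWeakDeriv p.snd r.snd) (a : ℝ) :
    HasDerivAt (fun a => L2Pair.shift a p) (-L2Pair.shift a r) a :=
  (WithLp.prodContinuousLinearEquiv 2 ℝ L2 L2).symm.hasFDerivAt.comp_hasDerivAt a
    ((L2.hasDerivAt_shift h₁ a).prodMk (L2.hasDerivAt_shift h₂ a))

/-! ### Joint regularity of orbits in speed and position -/

section OrbitRegularity

variable {V : Type*} [NormedAddCommGroup V] [InnerProductSpace ℝ V] {T : ℝ → V →ₗᵢ[ℝ] V}

/-- Both partial derivatives exist and are jointly continuous, by strong continuity of the group.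
Differentiating in the position costs one x-derivative; the condition against ∂_x Q therefore uses
two, which is why the branch takes its values in X². -/
theorem IsTranslationGroup.orbit_regular (hT : IsTranslationGroup T) {q g : ℝ → V} {I : Set ℝ}
    (hI : IsOpen I) (hq : ContDiffOn ℝ 1 q I) (hg : ContinuousOn g I)
    (hd : ∀ c ∈ I, ∀ a, HasDerivAt (fun a => T a (q c)) (-T a (g c)) a) {c : ℝ} (hc : c ∈ I) :
    ContDiffAt ℝ 1 (orbit T q) (c, 0) ∧
      ∀ ζ : ℝ × ℝ, fderiv ℝ (orbit T q) (c, 0) ζ = ζ.1 • deriv q c - ζ.2 • g c := by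
  set f₁ : ℝ → ℝ → ℝ →L[ℝ] V := fun c a =>
    ContinuousLinearMap.toSpanSingleton ℝ (T a (deriv q c))
  set f₂ : ℝ → ℝ → ℝ →L[ℝ] V := fun c a =>
    ContinuousLinearMap.toSpanSingleton ℝ (-T a (g c))
  have hdq : ContinuousOn (deriv q) I := (hq.continuousOn_deriv_of_isOpen hI (by simp))
  have hcont : ∀ w : ℝ → V, ContinuousOn w I →
      ContinuousOn (fun p : ℝ × ℝ => T p.2 (w p.1)) (I ×ˢ univ) := by
    intro w hw
    exact hT.continuous.comp_continuousOn
      (continuousOn_snd.prodMk (hw.comp continuousOn_fst fun p hp => hp.1))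
  have hopen : IsOpen (I ×ˢ (univ : Set ℝ)) := hI.prod isOpen_univ
  have hf₁ : ContinuousOn (↿f₁) (I ×ˢ univ) :=
    (ContinuousLinearMap.toSpanSingletonCLE (𝕜 := ℝ) (E := V)).continuous.comp_continuousOn
      (hcont _ hdq)
  have hf₂ : ContinuousOn (↿f₂) (I ×ˢ univ) :=
    (ContinuousLinearMap.toSpanSingletonCLE (𝕜 := ℝ) (E := V)).continuous.comp_continuousOn
      (hcont _ hg).neg
  have hs : ∀ p ∈ I ×ˢ (univ : Set ℝ),
      HasStrictFDerivAt (orbit T q) ((↿f₁ p).coprod (↿f₂ p)) p := by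
    intro p hp
    refine hasStrictFDerivAt_uncurry_coprod (f := fun c a => T a (q c)) ?_ ?_
      (hf₁.continuousAt (hopen.mem_nhds hp)) (hf₂.continuousAt (hopen.mem_nhds hp))
    · filter_upwards [hopen.mem_nhds hp] with v hv
      have hqv : HasDerivAt q (deriv q v.1) v.1 :=
        ((hq.differentiableOn (by simp)).differentiableAt (hI.mem_nhds hv.1)).hasDerivAt
      exact ((T v.2).toContinuousLinearMap.hasFDerivAt.comp_hasDerivAt v.1 hqv).hasFDerivAt
    · filter_upwards [hopen.mem_nhds hp] with v hv
      exact (hd v.1 hv.1 v.2).hasFDerivAt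
  have hmem : ((c, 0) : ℝ × ℝ) ∈ I ×ˢ (univ : Set ℝ) := ⟨hc, mem_univ _⟩
  refine ⟨?_, fun ζ => ?_⟩
  · refine contDiffAt_one_iff.2 ⟨fun p => (↿f₁ p).coprod (↿f₂ p), _, hopen.mem_nhds hmem,
      ?_, fun p hp => (hs p hp).hasFDerivAt⟩
    have h1 := hf₁.clm_comp (continuousOn_const (c := ContinuousLinearMap.fst ℝ ℝ ℝ))
    have h2 := hf₂.clm_comp (continuousOn_const (c := ContinuousLinearMap.snd ℝ ℝ ℝ))
    exact (h1.add h2).congr fun p _ => ContinuousLinearMap.ext fun ζ => rfl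
  · rw [(hs _ hmem).hasFDerivAt.fderiv]
    change ζ.1 • T 0 (deriv q c) + ζ.2 • (-T 0 (g c)) = _
    rw [hT.zero, hT.zero, smul_neg, sub_eq_add_neg]

end OrbitRegularity

/-! ### Momentum -/

theorem momentum_eq (P : X 0) : momentum P = (1 / 2) * inner ℝ (P.fst.der 0) (P.snd.der 0) := by
  rw [momentum, inner_eq_integral]
  rfl

/-- Symmetrising the bilinear form shows p as the quadratic form of the self-adjoint exchange of
components, so its gradient is half the exchanged pair. -/
theorem momentum_eq_pair (P : X 0) :
    momentum P = (1 / 4) * inner ℝ (L2Pair.swap (X.pair P)) (X.pair P) := by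
  rw [momentum_eq, L2Pair.inner_eq, X.pair_apply, L2Pair.swap_apply]
  change _ = 1 / 4 * (inner ℝ (P.snd.der 0) (P.fst.der 0) + inner ℝ (P.fst.der 0) (P.snd.der 0))
  rw [real_inner_comm (P.fst.der 0)]
  ring

theorem hasFDerivAt_momentum (P : X 0) :
    HasFDerivAt momentum ((1 / 2 : ℝ) • (innerSL ℝ (L2Pair.swap (X.pair P))).comp X.pair) P := by
  have h1 : HasFDerivAt (fun P : X 0 => L2Pair.swap (X.pair P)) (L2Pair.swap.comp X.pair) P :=
    (L2Pair.swap.comp X.pair).hasFDerivAt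
  have h2 : HasFDerivAt (fun P : X 0 => X.pair P) (X.pair (k := 0)) P := X.pair.hasFDerivAt
  have h3 := (h1.inner ℝ h2).const_mul (1 / 4 : ℝ)
  have e : (momentum : X 0 → ℝ)
      = fun P => (1 / 4) * inner ℝ (L2Pair.swap (X.pair P)) (X.pair P) :=
    funext momentum_eq_pair
  rw [e]
  refine h3.congr_fderiv (ContinuousLinearMap.ext fun ε => ?_)
  change (1 / 4 : ℝ) * (inner ℝ (L2Pair.swap (X.pair P)) (X.pair ε)
    + inner ℝ (L2Pair.swap (X.pair ε)) (X.pair P))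
    = (1 / 2) * inner ℝ (L2Pair.swap (X.pair P)) (X.pair ε)
  rw [L2Pair.inner_swap_comm (X.pair ε)]
  ring

theorem fderiv_momentum_apply (P ε : X 0) :
    fderiv ℝ momentum P ε = (1 / 2) * inner ℝ (L2Pair.swap (X.pair P)) (X.pair ε) := by
  rw [(hasFDerivAt_momentum P).fderiv]
  rfl

theorem innerDx_eq (ε : X 0) (S : X 2) :
    innerDx ε S = inner ℝ (X.pair ε) (X.pairDx S) := by
  rw [L2Pair.inner_eq, X.pair_apply, X.pairDx_apply]
  rfl

theorem pair_chain {N : ℕ} (Q : ℝ → X 2) (c a : Fin N → ℝ) :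
    X.pair (chain Q c a) = chainSum L2Pair.shift (fun c => X.pair (Q c)) (c, a) := by
  rw [chain, map_sum]
  rfl

/-! ### Travelling waves of different speeds -/

/-- The relation cη/2 = v(1 - η) determines c wherever η ≠ 0. A common profile for two speeds would
have η = 0, hence v = 0, and would be constant. -/
theorem eq_of_ae_eq_solvesTW {f : ℝ → ℝ} {c c' : ℝ} (hcc : c ≠ c') {P P' : X 0} {s : ℝ}
    (hP : IsTravellingWave f c P) (hP' : IsTravellingWave f c' P') :
    X.pair P ≠ L2Pair.shift s (X.pair P') := by
  intro h
  obtain ⟨_, η, v, h1, h2, hTW, x, y, hxy⟩ := hP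
  obtain ⟨_, η', v', h1', h2', hTW', _⟩ := hP'
  have e1 : P.fst.der 0 = L2.shift s (P'.fst.der 0) := congrArg WithLp.fst h
  have e2 : P.snd.der 0 = L2.shift s (P'.snd.der 0) := congrArg WithLp.snd h
  have hη0 : η =ᵐ[volume] fun _ => 0 := by
    filter_upwards [h1, h2, ae_comp_sub h1' s, ae_comp_sub h2' s,
      L2.coeFn_shift s (P'.fst.der 0), L2.coeFn_shift s (P'.snd.der 0)] with x k1 k2 k3 k4 k5 k6
    have m1 : η x = η' (x - s) := by
      rw [← k1, X.eta, e1, k5, ← k3, X.eta]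
    have m2 : v x = v' (x - s) := by
      rw [← k2, X.vel, e2, k6, ← k4, X.vel]
    have m3 := hTW.2.2.2.1 x
    have m4 := hTW'.2.2.2.1 (x - s)
    rw [← m1, ← m2, ← m3] at m4
    have : (c' - c) * η x = 0 := by linarith
    exact (mul_eq_zero.1 this).resolve_left (sub_ne_zero.2 hcc.symm)
  have hη : η = fun _ => 0 := (hTW.1.continuous.ae_eq_iff_eq volume continuous_const).1 hη0
  have hv : ∀ x, v x = 0 := by
    intro x
    have := hTW.2.2.2.1 x
    rw [hη] at this
    simpa using this.symm
  exact hxy (by rw [hη, hv, hv])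

theorem IsTravellingWave.pair_ne_zero {f : ℝ → ℝ} {c : ℝ} {P : X 0}
    (hP : IsTravellingWave f c P) : X.pair P ≠ 0 := by
  intro h
  obtain ⟨_, η, v, h1, h2, hTW, x, y, hxy⟩ := hP
  have e1 : P.fst.der 0 = 0 := congrArg WithLp.fst h
  have e2 : P.snd.der 0 = 0 := congrArg WithLp.snd h
  have hz := Lp.coeFn_zero ℝ 2 (volume : Measure ℝ)
  rw [X.eta, e1] at h1
  rw [X.vel, e2] at h2
  have hη : η = fun _ => 0 :=
    (hTW.1.continuous.ae_eq_iff_eq volume continuous_const).1 (h1.symm.trans hz)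
  have hv : v = fun _ => 0 :=
    (hTW.2.1.continuous.ae_eq_iff_eq volume continuous_const).1 (h2.symm.trans hz)
  exact hxy (by rw [hη, hv])

/-! ### The orbit of a transonic branch -/

section Branch

variable {f : ℝ → ℝ} {c₀ : ℝ} {Q : ℝ → X 2}

theorem hasDerivAt_shift_pair (P : X 2) (a : ℝ) :
    HasDerivAt (fun a => L2Pair.shift a (X.pair P)) (-L2Pair.shift a (X.pairDx P)) a :=
  L2Pair.hasDerivAt_shift (p := X.pair P) (r := X.pairDx P) (P.fst.2 0) (P.snd.2 0) a

theorem hasDerivAt_shift_pairDx (P : X 2) (a : ℝ) :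
    HasDerivAt (fun a => L2Pair.shift a (X.pairDx P)) (-L2Pair.shift a (X.pairDxx P)) a :=
  L2Pair.hasDerivAt_shift (p := X.pairDx P) (r := X.pairDxx P) (P.fst.2 1) (P.snd.2 1) a

/-- Infinitesimal translation invariance of the momentum, i.e. ∫ (ηv)' = 0. -/
theorem inner_swap_pair_pairDx (P : X 2) :
    inner ℝ (L2Pair.swap (X.pair P)) (X.pairDx P) = 0 := by
  have h1 := hasDerivAt_shift_pair P 0
  have h2 : HasDerivAt (fun a => L2Pair.swap (L2Pair.shift a (X.pair P)))
      (L2Pair.swap (-L2Pair.shift 0 (X.pairDx P))) 0 :=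
    L2Pair.swap.hasFDerivAt.comp_hasDerivAt 0 h1
  have h3 := h2.inner ℝ h1
  simp only [L2Pair.swap_shift, LinearIsometry.inner_map_map] at h3
  have h4 := h3.unique (hasDerivAt_const 0 (inner ℝ (L2Pair.swap (X.pair P)) (X.pair P)))
  simp only [L2Pair.isTranslationGroup.zero, map_neg, inner_neg_left, inner_neg_right] at h4
  rw [L2Pair.inner_swap_comm (X.pairDx P)] at h4
  linarith

/-- A vanishing derivative makes the orbit constant, hence periodic, and a periodic element of the
group is 0. -/
theorem IsTransonicBranch.pairDx_ne_zero (h : IsTransonicBranch f c₀ Q) {c : ℝ}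
    (hc : c ∈ Ioo c₀ (soundSpeed f)) : X.pairDx (Q c) ≠ 0 := by
  intro h0
  have hd : ∀ a, HasDerivAt (fun a => L2Pair.shift a (X.pair (Q c))) 0 a := by
    intro a
    have := hasDerivAt_shift_pair (Q c) a
    rwa [h0, map_zero, neg_zero] at this
  have hconst := is_const_of_deriv_eq_zero (fun a => (hd a).differentiableAt)
    (fun a => (hd a).deriv) 1 0
  rw [L2Pair.isTranslationGroup.zero] at hconst
  exact (h.isTravellingWave c hc).pair_ne_zero
    (L2Pair.isTranslationGroup.eq_zero_of_periodic one_ne_zero hconst)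

/-- The gradient of the momentum along the branch. -/
def gradMomentum (Q : ℝ → X 2) (c : ℝ) : L2Pair := (1 / 2 : ℝ) • L2Pair.swap (X.pair (Q c))

theorem IsTransonicBranch.contDiffOn_comp (h : IsTransonicBranch f c₀ Q) (A : X 2 →L[ℝ] L2Pair) :
    ContDiffOn ℝ 1 (fun c => A (Q c)) (Ioo c₀ (soundSpeed f)) :=
  A.contDiff.comp_contDiffOn (h.contDiffOn.of_le (by norm_num))

theorem IsTransonicBranch.orbit_pair (h : IsTransonicBranch f c₀ Q) {c : ℝ}
    (hc : c ∈ Ioo c₀ (soundSpeed f)) :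
    ContDiffAt ℝ 1 (orbit L2Pair.shift fun c => X.pair (Q c)) (c, 0) ∧
      ∀ ζ : ℝ × ℝ, fderiv ℝ (orbit L2Pair.shift fun c => X.pair (Q c)) (c, 0) ζ
        = ζ.1 • deriv (fun c => X.pair (Q c)) c - ζ.2 • X.pairDx (Q c) :=
  L2Pair.isTranslationGroup.orbit_regular isOpen_Ioo (h.contDiffOn_comp X.pair)
    (h.contDiffOn_comp X.pairDx).continuousOn (fun c _ a => hasDerivAt_shift_pair (Q c) a) hc

theorem IsTransonicBranch.orbit_pairDx (h : IsTransonicBranch f c₀ Q) {c : ℝ}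
    (hc : c ∈ Ioo c₀ (soundSpeed f)) :
    ContDiffAt ℝ 1 (orbit L2Pair.shift fun c => X.pairDx (Q c)) (c, 0) :=
  (L2Pair.isTranslationGroup.orbit_regular isOpen_Ioo (h.contDiffOn_comp X.pairDx)
    (h.contDiffOn_comp X.pairDxx).continuousOn
    (fun c _ a => hasDerivAt_shift_pairDx (Q c) a) hc).1

theorem IsTransonicBranch.orbit_gradMomentum (h : IsTransonicBranch f c₀ Q) {c : ℝ}
    (hc : c ∈ Ioo c₀ (soundSpeed f)) :
    ContDiffAt ℝ 1 (orbit L2Pair.shift (gradMomentum Q)) (c, 0) := by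
  have e : orbit L2Pair.shift (gradMomentum Q)
      = fun p => (1 / 2 : ℝ) • L2Pair.swap (orbit L2Pair.shift (fun c => X.pair (Q c)) p) := by
    funext p
    simp only [orbit, gradMomentum, map_smul, L2Pair.swap_shift]
  rw [e]
  exact ((L2Pair.swap.contDiff.contDiffAt).comp _ (h.orbit_pair hc).1).const_smul _

/-- By the chain rule the left side is dp(Q_c)/dc. -/
theorem IsTransonicBranch.inner_deriv_gradMomentum (h : IsTransonicBranch f c₀ Q) {c : ℝ}
    (hc : c ∈ Ioo c₀ (soundSpeed f)) :
    inner ℝ (deriv (fun c => X.pair (Q c)) c) (gradMomentum Q c) < 0 := by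
  have hneg := h.deriv_momentum_neg c hc
  have hd : HasDerivAt (fun c => X.pair (Q c)) (deriv (fun c => X.pair (Q c)) c) c :=
    (((h.contDiffOn_comp X.pair).differentiableOn (by simp)).differentiableAt
      (isOpen_Ioo.mem_nhds hc)).hasDerivAt
  have hd' : HasDerivAt (fun c => L2Pair.swap (X.pair (Q c)))
      (L2Pair.swap (deriv (fun c => X.pair (Q c)) c)) c :=
    L2Pair.swap.hasFDerivAt.comp_hasDerivAt c hd
  have hm := (hd'.inner ℝ hd).const_mul (1 / 4 : ℝ)
  have e : (fun s => momentum (Q s).toX0)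
      = fun c => (1 / 4 : ℝ) * inner ℝ (L2Pair.swap (X.pair (Q c))) (X.pair (Q c)) :=
    funext fun s => momentum_eq_pair _
  rw [e, hm.deriv, L2Pair.inner_swap_comm (deriv _ c)] at hneg
  rw [gradMomentum, real_inner_smul_right, real_inner_comm]
  linarith

/-- The system is triangular: ∂_x Q does not contribute to the product with ∇p, so dp/dc ≠ 0 kills
the speed component, and then ‖∂_x Q‖² ≠ 0 kills the position component. -/
theorem IsTransonicBranch.nondegenerate (h : IsTransonicBranch f c₀ Q) {c : ℝ}
    (hc : c ∈ Ioo c₀ (soundSpeed f)) (ζ : ℝ × ℝ)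
    (h1 : inner ℝ (fderiv ℝ (orbit L2Pair.shift fun c => X.pair (Q c)) (c, 0) ζ)
      (X.pairDx (Q c)) = 0)
    (h2 : inner ℝ (fderiv ℝ (orbit L2Pair.shift fun c => X.pair (Q c)) (c, 0) ζ)
      (gradMomentum Q c) = 0) : ζ = 0 := by
  rw [(h.orbit_pair hc).2, inner_sub_left, real_inner_smul_left, real_inner_smul_left] at h1 h2
  have h3 : inner ℝ (X.pairDx (Q c)) (gradMomentum Q c) = 0 := by
    rw [gradMomentum, real_inner_smul_right, real_inner_comm, inner_swap_pair_pairDx, mul_zero]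
  rw [h3, mul_zero, sub_zero] at h2
  have hζ1 : ζ.1 = 0 :=
    (mul_eq_zero.1 h2).resolve_right (h.inner_deriv_gradMomentum hc).ne
  rw [hζ1, zero_mul, zero_sub, neg_eq_zero] at h1
  have hζ2 : ζ.2 = 0 :=
    (mul_eq_zero.1 h1).resolve_right fun h0 => h.pairDx_ne_zero hc (inner_self_eq_zero.1 h0)
  exact Prod.ext hζ1 hζ2

theorem L2.norm_shift_sub_le {u g : L2} (h : HasWeakDeriv u g) (a b : ℝ) :
    ‖L2.shift a u - L2.shift b u‖ ≤ ‖g‖ * |a - b| := by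
  have := Convex.norm_image_sub_le_of_norm_hasDerivWithin_le (s := univ) (x := b) (y := a)
    (f := fun a => L2.shift a u) (C := ‖g‖)
    (fun a _ => (L2.hasDerivAt_shift h a).hasDerivWithinAt) (fun a _ => by simp) convex_univ
    (mem_univ _) (mem_univ _)
  simpa using this

theorem norm_translate_toX0_le (P : X 2) (a : ℝ) : ‖(P.translate a).toX0‖ ≤ 3 * ‖P‖ := by
  have h1 : ∀ j, ‖P.fst.der j‖ ≤ ‖P‖ := by
    intro j
    refine (sq_le_sq₀ (norm_nonneg _) (norm_nonneg _)).1 ?_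
    rw [X.norm_sq_eq, H.norm_sq_eq]
    have := Finset.single_le_sum (f := fun j => ‖P.fst.der j‖ ^ 2) (fun _ _ => by positivity)
      (Finset.mem_univ j)
    nlinarith [sq_nonneg ‖P.snd‖]
  have h2 : ∀ j, ‖P.snd.der j‖ ≤ ‖P‖ := by
    intro j
    refine (sq_le_sq₀ (norm_nonneg _) (norm_nonneg _)).1 ?_
    rw [X.norm_sq_eq P, H.norm_sq_eq P.snd]
    have := Finset.single_le_sum (f := fun j => ‖P.snd.der j‖ ^ 2) (fun _ _ => by positivity)
      (Finset.mem_univ j)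
    nlinarith [sq_nonneg ‖P.fst‖]
  refine (X.norm_le_sum _).trans ?_
  change ‖L2.shift a (P.fst.der 0)‖ + ‖L2.shift a (P.fst.der 1)‖ + ‖L2.shift a (P.snd.der 0)‖ ≤ _
  simp only [LinearIsometry.norm_map]
  linarith [h1 0, h1 1, h2 0]

theorem X.translate_sub {k : ℕ} (a : ℝ) (P P' : X k) :
    (P - P').translate a = P.translate a - P'.translate a := by
  have : ∀ {k : ℕ} (u w : H k), H.translate a (u - w) = H.translate a u - H.translate a w :=
    fun u w => H.ext_der fun j => map_sub (L2.shift a) (u.der j) (w.der j)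
  exact congrArg₂ (fun x y => WithLp.toLp 2 (x, y)) (this P.fst P'.fst) (this P.snd P'.snd)

theorem X.toX0_sub {k : ℕ} (P P' : X k) : (P - P').toX0 = P.toX0 - P'.toX0 := rfl

theorem norm_translate_sub_le (P : X 2) : ∃ K ≥ 0, ∀ a b : ℝ,
    ‖(P.translate a).toX0 - (P.translate b).toX0‖ ≤ K * |a - b| := by
  refine ⟨‖P.fst.der 1‖ + ‖P.fst.der 2‖ + ‖P.snd.der 1‖, by positivity, fun a b => ?_⟩
  refine (X.norm_le_sum _).trans ?_
  change ‖L2.shift a (P.fst.der 0) - L2.shift b (P.fst.der 0)‖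
    + ‖L2.shift a (P.fst.der 1) - L2.shift b (P.fst.der 1)‖
    + ‖L2.shift a (P.snd.der 0) - L2.shift b (P.snd.der 0)‖ ≤ _
  rw [add_mul, add_mul]
  exact add_le_add (add_le_add (L2.norm_shift_sub_le (P.fst.2 0) a b)
    (L2.norm_shift_sub_le (P.fst.2 1) a b)) (L2.norm_shift_sub_le (P.snd.2 0) a b)

/-- Lipschitz in the speed because Q is C¹ into X², and in the position because X² controls one
derivative more than X⁰. This brings the parameter estimates, found in L², back to the norm of X. -/
theorem IsTransonicBranch.lipschitz_orbit (h : IsTransonicBranch f c₀ Q) {c : ℝ}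
    (hc : c ∈ Ioo c₀ (soundSpeed f)) : ∃ K ≥ 0, ∃ ρ > 0, ∀ c', |c' - c| ≤ ρ → ∀ a b : ℝ,
      ‖((Q c').translate b).toX0 - ((Q c).translate a).toX0‖ ≤ K * (|c' - c| + |b - a|) := by
  have hQ : ContDiffAt ℝ 1 Q c :=
    ((h.contDiffOn.of_le (by norm_num)).contDiffAt (isOpen_Ioo.mem_nhds hc))
  obtain ⟨K₁, t, ht, hK₁⟩ := hQ.exists_lipschitzOnWith
  obtain ⟨ρ, hρ, hρt⟩ := Metric.nhds_basis_closedBall.mem_iff.1 ht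
  obtain ⟨K₂, hK₂, H₂⟩ := norm_translate_sub_le (Q c)
  refine ⟨3 * K₁ + K₂, by positivity, ρ, hρ, fun c' hc' a b => ?_⟩
  have h1 : ‖Q c' - Q c‖ ≤ K₁ * |c' - c| := by
    have := hK₁.norm_sub_le (hρt (by rwa [Metric.mem_closedBall, Real.dist_eq]))
      (hρt (Metric.mem_closedBall_self hρ.le))
    simpa using this
  have e : ((Q c').translate b).toX0 - ((Q c).translate a).toX0
      = ((Q c' - Q c).translate b).toX0
        + (((Q c).translate b).toX0 - ((Q c).translate a).toX0) := by
    rw [X.translate_sub, X.toX0_sub]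
    abel
  rw [e]
  refine (norm_add_le _ _).trans ((add_le_add (norm_translate_toX0_le _ _) (H₂ b a)).trans ?_)
  have := mul_nonneg K₁.2 (abs_nonneg (b - a))
  have := mul_nonneg hK₂ (abs_nonneg (c' - c))
  change (0 : ℝ) ≤ (K₁ : ℝ) * _ at *
  nlinarith

theorem IsTransonicBranch.lipschitz_chain (h : IsTransonicBranch f c₀ Q) {N : ℕ}
    {c : Fin N → ℝ} (hc : c ∈ Adm N f c₀) : ∃ K ≥ 0, ∃ ρ > 0, ∀ (z : Params N) (a : Fin N → ℝ),
      ‖z - (c, a)‖ ≤ ρ → ‖chain Q z.1 z.2 - chain Q c a‖ ≤ K * ‖z - (c, a)‖ := by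
  have hk := fun k => h.lipschitz_orbit (hc.1 k)
  choose K hK hρ using hk
  obtain ⟨ρ, hρ0, H⟩ := IsTranslationGroup.exists_pos_forall_of_finite
    (fun k r s hsr H c' hc' a b => H c' (hc'.trans hsr) a b) hρ
  refine ⟨2 * ∑ k, K k, mul_nonneg zero_le_two (Finset.sum_nonneg fun k _ => hK k), ρ, hρ0,
    fun z a hz => ?_⟩
  rw [chain, chain, ← Finset.sum_sub_distrib, Finset.mul_sum, Finset.sum_mul]
  refine (norm_sum_le _ _).trans (Finset.sum_le_sum fun k _ => ?_)
  have e := (Params.norm_coord_le k (z - (c, a)))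
  have e1 : |z.1 k - c k| ≤ ‖z - (c, a)‖ := (norm_fst_le _).trans e
  have e2 : |z.2 k - a k| ≤ ‖z - (c, a)‖ := (norm_snd_le _).trans e
  refine (H k (z.1 k) (e1.trans hz) (a k) (z.2 k)).trans ?_
  have := mul_le_mul_of_nonneg_left (add_le_add e1 e2) (hK k)
  linarith

theorem isOpen_adm (N : ℕ) (f : ℝ → ℝ) (c₀ : ℝ) : IsOpen (Adm N f c₀) := by
  have e : Adm N f c₀ = (⋂ k, {c | c k ∈ Ioo c₀ (soundSpeed f)})
      ∩ ⋂ i : Fin N, ⋂ j : Fin N, ⋂ _ : i < j, {c | c i < c j} := by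
    ext c
    simp only [Adm, mem_ofPred_eq, mem_inter_iff, mem_iInter]
    rfl
  rw [e]
  refine IsOpen.inter (isOpen_iInter_of_finite fun k => isOpen_Ioo.preimage (continuous_apply k))
    (isOpen_iInter_of_finite fun i => isOpen_iInter_of_finite fun j =>
      isOpen_iInter_of_finite fun _ => ?_)
  exact isOpen_lt (continuous_apply i) (continuous_apply j)

/-- Modulation around chains of solitons of a transonic branch. -/
theorem IsTransonicBranch.exists_modulation (h : IsTransonicBranch f c₀ Q) (N : ℕ)
    (cStar : Fin N → ℝ) (hc : cStar ∈ Adm N f c₀) :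
    ∃ α₁ L₁ K₁ : ℝ, 0 < α₁ ∧ 0 < L₁ ∧ 0 < K₁ ∧
    ∃ C A : X 0 → Fin N → ℝ,
      ContDiffOn ℝ 1 (fun P => (C P, A P)) (tube Q cStar α₁ L₁) ∧
      ∀ P ∈ tube Q cStar α₁ L₁,
        C P ∈ Adm N f c₀ ∧
        (∀ k : Fin N,
          innerDx (P - chain Q (C P) (A P)) ((Q (C P k)).translate (A P k)) = 0 ∧
          fderiv ℝ momentum ((Q (C P k)).translate (A P k)).toX0
            (P - chain Q (C P) (A P)) = 0) ∧
        ∀ α L : ℝ, α ≤ α₁ → L₁ ≤ L → ∀ aStar ∈ Pos N L,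
          ‖P - chain Q cStar aStar‖ ≤ α →
          ‖P - chain Q (C P) (A P)‖ + ‖C P - cStar‖ + ‖A P - aStar‖ ≤ K₁ * α := by
  obtain ⟨K', hK', ρ₁, hρ₁, hLip⟩ := h.lipschitz_chain hc
  obtain ⟨ρ₂, hρ₂, hAdm⟩ := Metric.nhds_basis_closedBall.mem_iff.1 ((isOpen_adm N f c₀).mem_nhds hc)
  obtain ⟨α₁, hα₁, L₁, hL₁, K, hK, Z, HZ⟩ := L2Pair.isTranslationGroup.exists_modulation
    (q := fun c => X.pair (Q c)) (w₁ := fun c => X.pairDx (Q c)) (w₂ := gradMomentum Q)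
    (fun k => (h.orbit_pair (hc.1 k)).1) (fun k => h.orbit_pairDx (hc.1 k))
    (fun k => h.orbit_gradMomentum (hc.1 k)) (fun k => h.nondegenerate (hc.1 k))
    (fun k => (h.isTravellingWave _ (hc.1 k)).pair_ne_zero)
    (fun j k hjk s => eq_of_ae_eq_solvesTW (fun e => hjk (hc.2.injective e).symm)
      (h.isTravellingWave _ (hc.1 k)) (h.isTravellingWave _ (hc.1 j)))
    -- This radius keeps the modulated parameters both where the chain is Lipschitz and inside the
    -- open set of admissible speeds.
    (lt_min hρ₁ hρ₂)
  have hle : ∀ (P : X 0) (a : Fin N → ℝ), ‖X.pair P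
      - chainSum L2Pair.shift (fun c => X.pair (Q c)) (cStar, a)‖ ≤ ‖P - chain Q cStar a‖ := by
    intro P a
    rw [← pair_chain, ← map_sub]
    exact X.norm_pair_le _
  have htube : ∀ P ∈ tube Q cStar α₁ L₁, ∃ a ∈ Pos N L₁, ‖P - chain Q cStar a‖ < α₁ := by
    intro P hP
    have : Nonempty (Pos N L₁) := (Pos.nonempty N L₁).to_subtype
    obtain ⟨a, ha⟩ := exists_lt_of_ciInf_lt (f := fun a : Pos N L₁ => ‖P - chain Q cStar a‖) hP
    exact ⟨a, a.2, ha⟩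
  -- ‖ε‖ ≤ α + K'Kα by the triangle inequality through R at (c*, a*), and speeds and positions each
  -- contribute Kα.
  refine ⟨α₁, L₁, 1 + K' * K + 2 * K, hα₁, hL₁, by positivity, fun P => (Z (X.pair P)).1,
    fun P => (Z (X.pair P)).2, ?_, fun P hP => ?_⟩
  · intro P hP
    obtain ⟨a, ha, hPa⟩ := htube P hP
    have := (HZ (X.pair P) a ha).2 ((hle P a).trans_lt hPa)
    have hpair : ContDiffAt ℝ 1 (fun P : X 0 => X.pair P) P :=
      (X.pair (k := 0)).contDiff.contDiffAt
    exact (ContDiffAt.comp P this hpair).contDiffWithinAt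
  · obtain ⟨a, ha, hPa⟩ := htube P hP
    obtain ⟨k1, k2, k3⟩ := (HZ (X.pair P) a ha).1 ((hle P a).trans hPa.le)
    have k4 : orthoMap L2Pair.shift (fun c => X.pair (Q c)) (fun c => X.pairDx (Q c))
      (X.pair P, Z (X.pair P)) = 0 := congrArg Prod.fst k1
    have k5 : orthoMap L2Pair.shift (fun c => X.pair (Q c)) (gradMomentum Q)
      (X.pair P, Z (X.pair P)) = 0 := congrArg Prod.snd k1
    refine ⟨hAdm ?_, fun k => ⟨?_, ?_⟩, ?_⟩
    · rw [mem_closedBall_iff_norm]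
      exact (norm_fst_le _).trans (k3.trans (min_le_right _ _))
    · rw [innerDx_eq, map_sub, pair_chain]
      exact congrFun k4 k
    · rw [fderiv_momentum_apply, map_sub, pair_chain, ← real_inner_smul_left, real_inner_comm]
      have := congrFun k5 k
      simp only [orthoMap, orbit, gradMomentum, map_smul, Pi.zero_apply, ← L2Pair.swap_shift] at this
      exact this
    · intro α L hα hL b hb hPb
      obtain ⟨_, m2, m3⟩ := (HZ (X.pair P) b (Pos.mono hL hb)).1 ((hle P b).trans (hPb.trans hα))
      have m2' : ‖Z (X.pair P) - (cStar, b)‖ ≤ K * α :=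
        m2.trans (mul_le_mul_of_nonneg_left ((hle P b).trans hPb) hK.le)
      have m4 := hLip (Z (X.pair P)) b (m3.trans (min_le_left _ _))
      have m5 : ‖P - chain Q (Z (X.pair P)).1 (Z (X.pair P)).2‖ ≤ α + K' * (K * α) := by
        calc _ = ‖(P - chain Q cStar b) - (chain Q (Z (X.pair P)).1 (Z (X.pair P)).2
              - chain Q cStar b)‖ := by rw [sub_sub_sub_cancel_right]
          _ ≤ _ := (norm_sub_le _ _).trans
            (add_le_add hPb (m4.trans (mul_le_mul_of_nonneg_left m2' hK')))
      have m6 : ‖(Z (X.pair P)).1 - cStar‖ ≤ K * α := (norm_fst_le _).trans m2'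
      have m7 : ‖(Z (X.pair P)).2 - b‖ ≤ K * α := (norm_snd_le _).trans m2'
      linarith

end Branch

/-! ### Potential wells -/

/-- The function `V₀` of the first integral `(η')² = V₀(η) - c² η²` of the travelling wave
equation, with its derivatives. -/
structure Well where
  /-- The speed of sound. -/
  s : ℝ
  /-- The function of the first integral. -/
  V₀ : ℝ → ℝ
  /-- The first derivative. -/
  V₁ : ℝ → ℝ
  /-- The second derivative. -/
  V₂ : ℝ → ℝ
  /-- The third derivative. -/
  V₃ : ℝ → ℝ
  /-- The fourth derivative. -/
  V₄ : ℝ → ℝ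
  s_pos : 0 < s
  hasDerivAt₀ : ∀ η < 1, HasDerivAt V₀ (V₁ η) η
  hasDerivAt₁ : ∀ η < 1, HasDerivAt V₁ (V₂ η) η
  hasDerivAt₂ : ∀ η < 1, HasDerivAt V₂ (V₃ η) η
  hasDerivAt₃ : ∀ η < 1, HasDerivAt V₃ (V₄ η) η
  continuousOn₄ : ContinuousOn V₄ (Iio 1)
  V₀_zero : V₀ 0 = 0
  V₁_zero : V₁ 0 = 0
  V₂_zero : V₂ 0 = 2 * s ^ 2
  lower : ∀ η ≤ 1, s ^ 2 * (1 - η) * η ^ 2 ≤ V₀ η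

theorem abs_le_of_abs_deriv_le {ψ ψ' : ℝ → ℝ} {δ ε : ℝ} {n : ℕ} (h0 : ψ 0 = 0)
    (hd : ∀ η, |η| < δ → HasDerivAt ψ (ψ' η) η) (hb : ∀ η, |η| < δ → |ψ' η| ≤ ε * |η| ^ n)
    (hε : 0 ≤ ε) : ∀ η, |η| < δ → |ψ η| ≤ ε * |η| ^ (n + 1) := by
  intro η hη
  have hseg : ∀ x ∈ uIcc 0 η, |x| ≤ |η| := by
    intro x hx
    rw [mem_uIcc] at hx
    rcases hx with hx | hx
    · rw [abs_of_nonneg hx.1, abs_of_nonneg (hx.1.trans hx.2)]; exact hx.2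
    · rw [abs_of_nonpos hx.2, abs_of_nonpos (hx.1.trans hx.2)]; linarith [hx.1]
  have := Convex.norm_image_sub_le_of_norm_hasDerivWithin_le (s := uIcc 0 η) (x := 0) (y := η)
    (f := ψ) (f' := ψ') (C := ε * |η| ^ n)
    (fun x hx => (hd x ((hseg x hx).trans_lt hη)).hasDerivWithinAt)
    (fun x hx => (hb x ((hseg x hx).trans_lt hη)).trans
      (mul_le_mul_of_nonneg_left (pow_le_pow_left₀ (abs_nonneg x) (hseg x hx) n) hε))
    (convex_uIcc 0 η) left_mem_uIcc right_mem_uIcc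
  rw [h0, sub_zero, sub_zero, Real.norm_eq_abs, Real.norm_eq_abs] at this
  rw [pow_succ, ← mul_assoc]
  exact this

namespace Well

variable (W : Well)

/-- The cubic coefficient of `s² η² - V₀(η)`. -/
def γ : ℝ := -W.V₃ 0 / 6

/-- Continuity of V₃ at 0 gives the first estimate; each of the others follows by integrating the
previous one from 0, where the remainder vanishes. -/
theorem taylor {ε : ℝ} (hε : 0 < ε) : ∃ δ, 0 < δ ∧ δ < 1 / 2 ∧ ∀ η, |η| < δ →
    |-W.V₃ η - 6 * W.γ| ≤ ε ∧ |2 * W.s ^ 2 - W.V₂ η - 6 * W.γ * η| ≤ ε * |η| ∧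
    |2 * W.s ^ 2 * η - W.V₁ η - 3 * W.γ * η ^ 2| ≤ ε * |η| ^ 2 ∧
    |W.s ^ 2 * η ^ 2 - W.V₀ η - W.γ * η ^ 3| ≤ ε * |η| ^ 3 := by
  have hc : ContinuousAt (fun η => |-W.V₃ η - 6 * W.γ|) 0 := by
    have := (W.hasDerivAt₃ 0 one_pos).continuousAt
    fun_prop
  have hev : ∀ᶠ η in 𝓝 (0 : ℝ), |-W.V₃ η - 6 * W.γ| < ε := by
    refine hc.eventually_lt_const ?_
    have : -W.V₃ 0 - 6 * W.γ = 0 := by rw [γ]; ring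
    simp only [this, abs_zero]; exact hε
  obtain ⟨δ', hδ', H⟩ := Metric.nhds_basis_ball.eventually_iff.1 hev
  refine ⟨min δ' (1 / 3), lt_min hδ' (by norm_num), (min_le_right _ _).trans_lt (by norm_num), ?_⟩
  set δ := min δ' (1 / 3) with hδdef
  have hlt : ∀ η, |η| < δ → η < 1 := fun η hη =>
    (le_abs_self η).trans_lt (hη.trans_le ((min_le_right _ _).trans (by norm_num)))
  have h3 : ∀ η, |η| < δ → |-W.V₃ η - 6 * W.γ| ≤ ε * |η| ^ 0 := by
    intro η hη
    rw [pow_zero, mul_one]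
    exact (H (by simpa using hη.trans_le (min_le_left _ _))).le
  have h2 := abs_le_of_abs_deriv_le (ψ := fun η => 2 * W.s ^ 2 - W.V₂ η - 6 * W.γ * η)
    (by simp [W.V₂_zero]) (fun η hη => by
      have := ((W.hasDerivAt₂ η (hlt η hη)).const_sub (2 * W.s ^ 2)).sub
        ((hasDerivAt_id η).const_mul (6 * W.γ))
      refine this.congr_deriv ?_
      simp) h3 hε.le
  have h1 := abs_le_of_abs_deriv_le
    (ψ := fun η => 2 * W.s ^ 2 * η - W.V₁ η - 3 * W.γ * η ^ 2)
    (by simp [W.V₁_zero]) (fun η hη => by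
      have := (((hasDerivAt_id η).const_mul (2 * W.s ^ 2)).sub (W.hasDerivAt₁ η (hlt η hη))).sub
        ((hasDerivAt_pow 2 η).const_mul (3 * W.γ))
      refine this.congr_deriv ?_
      simp; ring) h2 hε.le
  have h0 := abs_le_of_abs_deriv_le
    (ψ := fun η => W.s ^ 2 * η ^ 2 - W.V₀ η - W.γ * η ^ 3)
    (by simp [W.V₀_zero]) (fun η hη => by
      have := (((hasDerivAt_pow 2 η).const_mul (W.s ^ 2)).sub (W.hasDerivAt₀ η (hlt η hη))).sub
        ((hasDerivAt_pow 3 η).const_mul W.γ)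
      refine this.congr_deriv ?_
      simp; ring) h1 hε.le
  intro η hη
  refine ⟨?_, ?_, ?_, ?_⟩
  · simpa using h3 η hη
  · simpa using h2 η hη
  · simpa using h1 η hη
  · simpa using h0 η hη

/-- (H1) gives s²η² - V₀(η) ≤ s²η³. At small negative η this is below -s²|η|³, while the Taylor
expansion with γ ≤ 0 would keep it above -s²|η|³/2. -/
theorem γ_pos : 0 < W.γ := by
  by_contra hγ
  push Not at hγ
  have hs : 0 < W.s ^ 2 := pow_pos W.s_pos 2
  obtain ⟨δ, hδ, hδ2, H⟩ := W.taylor (ε := W.s ^ 2 / 2) (by positivity)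
  obtain ⟨_, _, _, h0⟩ := H (-(δ / 2)) (by rw [abs_neg, abs_of_pos (by positivity)]; linarith)
  have h1 := W.lower (-(δ / 2)) (by linarith)
  rw [abs_neg, abs_of_pos (half_pos hδ)] at h0
  have h2 := (abs_le.1 h0).1
  have h3 : 0 < (δ / 2) ^ 3 := by positivity
  nlinarith [mul_nonneg (neg_nonneg.2 hγ) h3.le, mul_pos hs h3]

end Well

/-! ### Inverse functions on intervals -/

theorem mul_sub_le_of_deriv_ge {φ φ' : ℝ → ℝ} {S : Set ℝ} (hS : Convex ℝ S) {k : ℝ}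
    (hd : ∀ y ∈ S, HasDerivAt φ (φ' y) y) (hk : ∀ y ∈ S, k ≤ φ' y) {x y : ℝ} (hx : x ∈ S)
    (hy : y ∈ S) (hxy : x ≤ y) : k * (y - x) ≤ φ y - φ x :=
  hS.mul_sub_le_image_sub_of_le_deriv
    (fun z hz => (hd z hz).continuousAt.continuousWithinAt)
    (fun z hz => (hd z (interior_subset hz)).differentiableAt.differentiableWithinAt)
    (fun z hz => by rw [(hd z (interior_subset hz)).deriv]; exact hk z (interior_subset hz))
    x hx y hy hxy

theorem mul_abs_sub_le_of_deriv_ge {φ φ' : ℝ → ℝ} {S : Set ℝ} (hS : Convex ℝ S) {k : ℝ}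
    (hd : ∀ y ∈ S, HasDerivAt φ (φ' y) y) (hk : ∀ y ∈ S, k ≤ φ' y) {x y : ℝ}
    (hx : x ∈ S) (hy : y ∈ S) : k * |y - x| ≤ |φ y - φ x| := by
  rcases le_total x y with h | h
  · rw [abs_of_nonneg (sub_nonneg.2 h)]
    exact (mul_sub_le_of_deriv_ge hS hd hk hx hy h).trans (le_abs_self _)
  · rw [abs_sub_comm, abs_of_nonneg (sub_nonneg.2 h), abs_sub_comm]
    exact (mul_sub_le_of_deriv_ge hS hd hk hy hx h).trans (le_abs_self _)

/-- The lower bound on the slope makes the inverse Lipschitz, hence continuous, which is all that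
the local inverse rule still needs. -/
theorem hasDerivAt_inverse {φ φ' ψ : ℝ → ℝ} {S I : Set ℝ} (hS : Convex ℝ S) (hI : IsOpen I)
    {k : ℝ} (hk0 : 0 < k) (hd : ∀ y ∈ S, HasDerivAt φ (φ' y) y) (hk : ∀ y ∈ S, k ≤ φ' y)
    (hψ : ∀ t ∈ I, ψ t ∈ S) (hinv : ∀ t ∈ I, φ (ψ t) = t) {t : ℝ} (ht : t ∈ I) :
    HasDerivAt ψ (φ' (ψ t))⁻¹ t := by
  have hlip : ∀ t' ∈ I, |ψ t' - ψ t| ≤ k⁻¹ * |t' - t| := by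
    intro t' ht'
    have := mul_abs_sub_le_of_deriv_ge hS hd hk (hψ t ht) (hψ t' ht')
    rw [hinv t ht, hinv t' ht'] at this
    rw [inv_mul_eq_div, le_div_iff₀ hk0, mul_comm]
    exact this
  have hcont : ContinuousAt ψ t := by
    rw [ContinuousAt, tendsto_iff_norm_sub_tendsto_zero]
    refine squeeze_zero' (g := fun t' => k⁻¹ * |t' - t|)
      (Eventually.of_forall fun _ => norm_nonneg _) ?_ ?_
    · filter_upwards [hI.mem_nhds ht] with t' ht' using hlip t' ht'
    · have : Continuous fun t' => k⁻¹ * |t' - t| := by fun_prop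
      simpa using this.tendsto t
  refine HasDerivAt.of_local_left_inverse hcont (hd _ (hψ t ht))
    (hk0.trans_le (hk _ (hψ t ht))).ne' ?_
  filter_upwards [hI.mem_nhds ht] with t' ht' using hinv t' ht'

/-! ### The logarithmic profile -/

/-- The inverse `Y` of `y ↦ log g(e^y)`, where `g(η) = s² - V₀(η)/η²`, together with its
derivatives. -/
structure LogProfile (W : Well) where
  /-- Bound for the amplitudes. -/
  δ : ℝ
  /-- Upper end of the domain. -/
  t₀ : ℝ
  /-- The logarithm of the amplitude. -/
  Y : ℝ → ℝ
  /-- The first derivative. -/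
  Y₁ : ℝ → ℝ
  /-- The second derivative. -/
  Y₂ : ℝ → ℝ
  /-- The third derivative. -/
  Y₃ : ℝ → ℝ
  δ_pos : 0 < δ
  δ_lt : δ < 1 / 2
  hasDerivAt₀ : ∀ t < t₀, HasDerivAt Y (Y₁ t) t
  hasDerivAt₁ : ∀ t < t₀, HasDerivAt Y₁ (Y₂ t) t
  hasDerivAt₂ : ∀ t < t₀, HasDerivAt Y₂ (Y₃ t) t
  continuousOn₃ : ContinuousOn Y₃ (Iio t₀)
  le_Y₁ : ∀ t < t₀, 10 / 11 ≤ Y₁ t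
  Y₁_le : ∀ t < t₀, Y₁ t ≤ 10 / 9
  abs_Y₂_le : ∀ t < t₀, |Y₂ t| ≤ 1 / 2
  abs_Y₃_le : ∀ t < t₀, |Y₃ t| ≤ 100
  exp_Y_lt : ∀ t < t₀, Real.exp (Y t) < δ
  eq_V₀ : ∀ t < t₀, W.s ^ 2 * Real.exp (Y t) ^ 2 - W.V₀ (Real.exp (Y t))
    = Real.exp (Y t) ^ 2 * Real.exp t
  eq_V₁ : ∀ t < t₀, (2 * W.s ^ 2 * Real.exp (Y t) - W.V₁ (Real.exp (Y t))
    - 2 * Real.exp t * Real.exp (Y t)) * Y₁ t = Real.exp t * Real.exp (Y t)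
  strictMonoOn : StrictMonoOn (fun η => W.s ^ 2 - W.V₀ η / η ^ 2) (Ioo 0 δ)

/-- For the pure cubic γη³ the three ratios are 3, 6 and 6; a relative error of 1/100 gives these
windows. -/
theorem ratio_bounds {γ u₀ u₁ u₂ u₃ : ℝ} (hγ : 0 < γ) (h0 : |u₀ - γ| ≤ γ / 100)
    (h1 : |u₁ - 3 * γ| ≤ γ / 100) (h2 : |u₂ - 6 * γ| ≤ γ / 100) (h3 : |u₃ - 6 * γ| ≤ γ / 100) :
    0 < u₀ ∧ (296 / 100 ≤ u₁ / u₀ ∧ u₁ / u₀ ≤ 305 / 100) ∧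
      (593 / 100 ≤ u₂ / u₀ ∧ u₂ / u₀ ≤ 608 / 100) ∧ (593 / 100 ≤ u₃ / u₀ ∧ u₃ / u₀ ≤ 608 / 100) := by
  rw [abs_le] at h0 h1 h2 h3
  have hu : 0 < u₀ := by linarith [h0.1]
  refine ⟨hu, ⟨?_, ?_⟩, ⟨?_, ?_⟩, ⟨?_, ?_⟩⟩ <;>
    first | rw [le_div_iff₀ hu] | rw [div_le_iff₀ hu]
  all_goals linarith [h0.1, h0.2, h1.1, h1.2, h2.1, h2.2, h3.1, h3.2]

/-- At the model values (3, 6, 6) the four quantities are 1, 1, 0 and 0. -/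
theorem logProfile_bounds {r₁ r₂ r₃ : ℝ} (h1 : 296 / 100 ≤ r₁) (h1' : r₁ ≤ 305 / 100)
    (h2 : 593 / 100 ≤ r₂) (h2' : r₂ ≤ 608 / 100) (h3 : 593 / 100 ≤ r₃) (h3' : r₃ ≤ 608 / 100) :
    9 / 10 ≤ r₁ - 2 ∧ r₁ - 2 ≤ 11 / 10 ∧ |r₁ + r₂ - r₁ ^ 2| ≤ 35 / 100 ∧
      |2 * r₂ + r₃ - r₁ * r₂| ≤ 2 := by
  refine ⟨by linarith, by linarith, ?_, ?_⟩ <;> rw [abs_le] <;> constructor <;>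
    nlinarith [mul_nonneg (sub_nonneg.2 h1) (sub_nonneg.2 h1'),
      mul_nonneg (sub_nonneg.2 h1) (sub_nonneg.2 h2),
      mul_nonneg (sub_nonneg.2 h1') (sub_nonneg.2 h2'),
      mul_nonneg (sub_nonneg.2 h1') (sub_nonneg.2 h2),
      mul_nonneg (sub_nonneg.2 h1) (sub_nonneg.2 h2')]

/-- Near 0, s²η² - V₀(η) behaves like γη³ with three derivatives, so G(y) = log g(e^y) is a
perturbation of y + log γ with slope close to 1 on a whole half-line. Its inverse Y exists there
with uniform bounds on three derivatives. -/
theorem exists_logProfile (W : Well) : Nonempty (LogProfile W) := by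
  have hγ := W.γ_pos
  obtain ⟨δ, hδ, hδ2, H⟩ := W.taylor (ε := W.γ / 100) (by positivity)
  set S : Set ℝ := Iio (Real.log δ) with hS
  have hexp : ∀ y ∈ S, 0 < Real.exp y ∧ Real.exp y < δ := fun y hy =>
    ⟨Real.exp_pos y, by rwa [← Real.lt_log_iff_exp_lt hδ]⟩
  set U₀ : ℝ → ℝ := fun η => W.s ^ 2 * η ^ 2 - W.V₀ η with hU₀
  set U₁ : ℝ → ℝ := fun η => 2 * W.s ^ 2 * η - W.V₁ η with hU₁
  set U₂ : ℝ → ℝ := fun η => 2 * W.s ^ 2 - W.V₂ η with hU₂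
  set U₃ : ℝ → ℝ := fun η => -W.V₃ η with hU₃
  have hdU₀ : ∀ η < 1, HasDerivAt U₀ (U₁ η) η := fun η hη => by
    refine (((hasDerivAt_pow 2 η).const_mul (W.s ^ 2)).sub (W.hasDerivAt₀ η hη)).congr_deriv ?_
    simp [hU₁]; ring
  have hdU₁ : ∀ η < 1, HasDerivAt U₁ (U₂ η) η := fun η hη => by
    refine (((hasDerivAt_id η).const_mul (2 * W.s ^ 2)).sub (W.hasDerivAt₁ η hη)).congr_deriv ?_
    simp [hU₂]
  have hdU₂ : ∀ η < 1, HasDerivAt U₂ (U₃ η) η := fun η hη =>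
    (W.hasDerivAt₂ η hη).const_sub (2 * W.s ^ 2)
  -- r_j = η^j U^{(j)}(η)/U(η) at η = e^y. These scale invariant ratios have a closed
  -- differentiation rule in y: p₂ and p₃ below are r₁' and r₁''.
  set r₁ : ℝ → ℝ := fun y => Real.exp y * U₁ (Real.exp y) / U₀ (Real.exp y) with hr₁
  set r₂ : ℝ → ℝ := fun y => Real.exp y ^ 2 * U₂ (Real.exp y) / U₀ (Real.exp y) with hr₂
  set r₃ : ℝ → ℝ := fun y => Real.exp y ^ 3 * U₃ (Real.exp y) / U₀ (Real.exp y) with hr₃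
  have hr : ∀ y ∈ S, 0 < U₀ (Real.exp y) ∧ (296 / 100 ≤ r₁ y ∧ r₁ y ≤ 305 / 100) ∧
      (593 / 100 ≤ r₂ y ∧ r₂ y ≤ 608 / 100) ∧ (593 / 100 ≤ r₃ y ∧ r₃ y ≤ 608 / 100) := by
    intro y hy
    obtain ⟨hpos, hlt⟩ := hexp y hy
    obtain ⟨k3, k2, k1, k0⟩ := H (Real.exp y) (by rwa [abs_of_pos hpos])
    set η := Real.exp y
    rw [abs_of_pos hpos] at k0 k1 k2
    have hne := hpos.ne'
    have m0 : |U₀ η / η ^ 3 - W.γ| ≤ W.γ / 100 := by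
      have : U₀ η / η ^ 3 - W.γ = (W.s ^ 2 * η ^ 2 - W.V₀ η - W.γ * η ^ 3) / η ^ 3 := by
        rw [hU₀]; field_simp
      rw [this, abs_div, abs_of_pos (pow_pos hpos 3), div_le_iff₀ (pow_pos hpos 3)]
      exact k0
    have m1 : |U₁ η / η ^ 2 - 3 * W.γ| ≤ W.γ / 100 := by
      have : U₁ η / η ^ 2 - 3 * W.γ
          = (2 * W.s ^ 2 * η - W.V₁ η - 3 * W.γ * η ^ 2) / η ^ 2 := by
        rw [hU₁]; field_simp
      rw [this, abs_div, abs_of_pos (pow_pos hpos 2), div_le_iff₀ (pow_pos hpos 2)]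
      exact k1
    have m2 : |U₂ η / η - 6 * W.γ| ≤ W.γ / 100 := by
      have : U₂ η / η - 6 * W.γ = (2 * W.s ^ 2 - W.V₂ η - 6 * W.γ * η) / η := by
        rw [hU₂]; field_simp
      rw [this, abs_div, abs_of_pos hpos, div_le_iff₀ hpos]
      exact k2
    obtain ⟨p0, p1, p2, p3⟩ := ratio_bounds hγ m0 m1 m2 k3
    have hU : 0 < U₀ η := by
      have := mul_pos p0 (pow_pos hpos 3)
      rwa [div_mul_cancel₀ _ (pow_pos hpos 3).ne'] at this
    have e1 : r₁ y = U₁ η / η ^ 2 / (U₀ η / η ^ 3) := by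
      change η * U₁ η / U₀ η = _
      field_simp
    have e2 : r₂ y = U₂ η / η / (U₀ η / η ^ 3) := by
      change η ^ 2 * U₂ η / U₀ η = _
      field_simp
    have e3 : r₃ y = U₃ η / (U₀ η / η ^ 3) := by
      change η ^ 3 * U₃ η / U₀ η = _
      field_simp
    rw [e1, e2, e3]
    exact ⟨hU, p1, p2, p3⟩
  set p₂ : ℝ → ℝ := fun y => r₁ y + r₂ y - r₁ y ^ 2 with hp₂
  set p₃ : ℝ → ℝ := fun y => p₂ y + (2 * r₂ y + r₃ y - r₁ y * r₂ y) - 2 * r₁ y * p₂ y with hp₃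
  have hb := fun y hy => logProfile_bounds (hr y hy).2.1.1 (hr y hy).2.1.2 (hr y hy).2.2.1.1
    (hr y hy).2.2.1.2 (hr y hy).2.2.2.1 (hr y hy).2.2.2.2
  set G : ℝ → ℝ := fun y => Real.log (U₀ (Real.exp y)) - 2 * y with hG
  have hlt1 : ∀ y ∈ S, Real.exp y < 1 := fun y hy => (hexp y hy).2.trans (hδ2.trans (by norm_num))
  have hE₀ : ∀ y ∈ S, HasDerivAt (fun y => U₀ (Real.exp y)) (U₁ (Real.exp y) * Real.exp y) y :=
    fun y hy => (hdU₀ _ (hlt1 y hy)).comp y (Real.hasDerivAt_exp y)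
  have hE₁ : ∀ y ∈ S, HasDerivAt (fun y => U₁ (Real.exp y)) (U₂ (Real.exp y) * Real.exp y) y :=
    fun y hy => (hdU₁ _ (hlt1 y hy)).comp y (Real.hasDerivAt_exp y)
  have hE₂ : ∀ y ∈ S, HasDerivAt (fun y => U₂ (Real.exp y)) (U₃ (Real.exp y) * Real.exp y) y :=
    fun y hy => (hdU₂ _ (hlt1 y hy)).comp y (Real.hasDerivAt_exp y)
  have hdG : ∀ y ∈ S, HasDerivAt G (r₁ y - 2) y := by
    intro y hy
    refine (((hE₀ y hy).log (hr y hy).1.ne').sub ((hasDerivAt_id y).const_mul 2)).congr_deriv ?_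
    simp [hr₁, mul_comm]
  have hdr₁ : ∀ y ∈ S, HasDerivAt r₁ (p₂ y) y := by
    intro y hy
    have hne := (hr y hy).1.ne'
    refine (((Real.hasDerivAt_exp y).mul (hE₁ y hy)).div (hE₀ y hy) hne).congr_deriv ?_
    simp only [hp₂, hr₁, hr₂, Pi.mul_apply]
    field_simp
  have hdr₂ : ∀ y ∈ S, HasDerivAt r₂ (2 * r₂ y + r₃ y - r₁ y * r₂ y) y := by
    intro y hy
    have hne := (hr y hy).1.ne'
    refine ((((Real.hasDerivAt_exp y).pow 2).mul (hE₂ y hy)).div (hE₀ y hy) hne).congr_deriv ?_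
    simp only [hr₁, hr₂, hr₃]
    field_simp
    simp
    ring
  have hdp₂ : ∀ y ∈ S, HasDerivAt p₂ (p₃ y) y := by
    intro y hy
    refine (((hdr₁ y hy).add (hdr₂ y hy)).sub ((hdr₁ y hy).pow 2)).congr_deriv ?_
    simp only [hp₃]
    simp
  have hconv : Convex ℝ S := convex_Iio _
  have hk : ∀ y ∈ S, 9 / 10 ≤ r₁ y - 2 := fun y hy => (hb y hy).1
  -- A point strictly inside the domain: only levels below G(ystar) are inverted, so the
  -- intermediate value argument stays on closed intervals where G is continuous.
  set ystar : ℝ := Real.log (δ / 2)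
  have hystar : ystar ∈ S := Real.log_lt_log (by positivity) (by linarith)
  have hsurj : ∀ t < G ystar, ∃ y ∈ S, G y = t := by
    intro t ht
    -- Slope at least 9/10 forces G(y₁) ≤ t.
    set y₁ : ℝ := ystar - (G ystar - t) / (9 / 10) with hy₁
    have hle : y₁ ≤ ystar := by rw [hy₁]; linarith [div_pos (sub_pos.2 ht) (by norm_num : (0:ℝ) < 9 / 10)]
    have hy₁S : y₁ ∈ S := lt_of_le_of_lt hle hystar
    have h1 := mul_sub_le_of_deriv_ge hconv hdG hk hy₁S hystar hle
    have h2 : 9 / 10 * (ystar - y₁) = G ystar - t := by rw [hy₁]; ring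
    have hcont : ContinuousOn G (Icc y₁ ystar) := fun y hy =>
      (hdG y (lt_of_le_of_lt hy.2 hystar)).continuousAt.continuousWithinAt
    obtain ⟨y, hy, hyt⟩ := intermediate_value_Icc hle hcont ⟨by linarith, ht.le⟩
    exact ⟨y, lt_of_le_of_lt hy.2 hystar, hyt⟩
  choose! Y hYS hYG using hsurj
  have hdY : ∀ t < G ystar, HasDerivAt Y (r₁ (Y t) - 2)⁻¹ t := fun t ht =>
    hasDerivAt_inverse hconv (isOpen_Iio (a := G ystar)) (by norm_num : (0 : ℝ) < 9 / 10) hdG hk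
      hYS hYG ht
  have hpos : ∀ y ∈ S, 0 < r₁ y - 2 := fun y hy => by linarith [hk y hy]
  have hU : ∀ t < G ystar, U₀ (Real.exp (Y t)) = Real.exp (Y t) ^ 2 * Real.exp t := by
    intro t ht
    have h1 := hYG t ht
    have h2 : Real.log (U₀ (Real.exp (Y t))) = 2 * Y t + t := by
      rw [hG] at h1
      simp only at h1
      linarith
    rw [← Real.exp_log (hr _ (hYS t ht)).1, h2, Real.exp_add, two_mul, Real.exp_add, pow_two]
  refine ⟨{ δ := δ, t₀ := G ystar, Y := Y
            Y₁ := fun t => (r₁ (Y t) - 2)⁻¹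
            Y₂ := fun t => -p₂ (Y t) * (r₁ (Y t) - 2)⁻¹ ^ 3
            Y₃ := fun t => -p₃ (Y t) * (r₁ (Y t) - 2)⁻¹ ^ 4
              + 3 * p₂ (Y t) ^ 2 * (r₁ (Y t) - 2)⁻¹ ^ 5
            δ_pos := hδ, δ_lt := hδ2, hasDerivAt₀ := hdY
            hasDerivAt₁ := ?hasDerivAt₁
            hasDerivAt₂ := ?hasDerivAt₂
            continuousOn₃ := ?continuousOn₃
            le_Y₁ := ?le_Y₁
            Y₁_le := ?Y₁_le
            abs_Y₂_le := ?abs_Y₂_le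
            abs_Y₃_le := ?abs_Y₃_le
            exp_Y_lt := ?exp_Y_lt
            eq_V₀ := ?eq_V₀
            eq_V₁ := ?eq_V₁
            strictMonoOn := ?strictMonoOn }⟩
  case hasDerivAt₁ =>
    intro t ht
    have hne := (hpos _ (hYS t ht)).ne'
    refine ((((hdr₁ _ (hYS t ht)).comp t (hdY t ht)).sub_const 2).inv hne).congr_deriv ?_
    simp only [Function.comp_apply]
    field_simp
  case hasDerivAt₂ =>
    intro t ht
    have hne := (hpos _ (hYS t ht)).ne'
    have e1 := (hdp₂ _ (hYS t ht)).comp t (hdY t ht)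
    have e2 := (((hdr₁ _ (hYS t ht)).comp t (hdY t ht)).sub_const 2).inv hne
    refine (e1.neg.mul (e2.pow 3)).congr_deriv ?_
    simp only [Function.comp_apply, Pi.neg_apply, Pi.pow_apply, Pi.inv_apply]
    generalize r₁ (Y t) - 2 = d at hne
    push_cast
    field_simp
  case continuousOn₃ =>
    have hYc : ContinuousOn Y (Iio (G ystar)) := fun t ht =>
      (hdY t ht).continuousAt.continuousWithinAt
    have c1 : ContinuousOn r₁ S := fun y hy => (hdr₁ y hy).continuousAt.continuousWithinAt
    have c2 : ContinuousOn p₂ S := fun y hy => (hdp₂ y hy).continuousAt.continuousWithinAt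
    have c2' : ContinuousOn r₂ S := fun y hy => (hdr₂ y hy).continuousAt.continuousWithinAt
    have c3 : ContinuousOn r₃ S := by
      have hexpc : ContinuousOn Real.exp S := Real.continuous_exp.continuousOn
      have a1 : ContinuousOn (fun y => U₃ (Real.exp y)) S := fun y hy => by
        have := (W.hasDerivAt₃ _ (hlt1 y hy)).continuousAt.neg
        exact (ContinuousAt.comp (g := U₃) this Real.continuous_exp.continuousAt).continuousWithinAt
      have a2 : ContinuousOn (fun y => U₀ (Real.exp y)) S := fun y hy =>
        (hE₀ y hy).continuousAt.continuousWithinAt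
      exact ((hexpc.pow 3).mul a1).div a2 fun y hy => (hr y hy).1.ne'
    have c4 : ContinuousOn p₃ S := (c2.add (((c2'.const_smul (2 : ℝ)).add c3).sub (c1.mul c2'))).sub
      ((c1.const_smul (2 : ℝ)).mul c2)
    have d1 := c1.comp hYc hYS
    have d2 := c2.comp hYc hYS
    have d4 := c4.comp hYc hYS
    have dinv : ContinuousOn (fun t => (r₁ (Y t) - 2)⁻¹) (Iio (G ystar)) :=
      (d1.sub continuousOn_const).inv₀ fun t ht => (hpos _ (hYS t ht)).ne'
    exact (d4.neg.mul (dinv.pow 4)).add ((continuousOn_const.mul (d2.pow 2)).mul (dinv.pow 5))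
  case le_Y₁ =>
    intro t ht
    rw [le_inv_comm₀ (by norm_num) (hpos _ (hYS t ht))]
    linarith [(hb _ (hYS t ht)).2.1]
  case Y₁_le =>
    intro t ht
    rw [inv_le_comm₀ (hpos _ (hYS t ht)) (by norm_num)]
    linarith [(hb _ (hYS t ht)).1]
  case abs_Y₂_le =>
    intro t ht
    have h1 : (r₁ (Y t) - 2)⁻¹ ≤ 10 / 9 := by
      rw [inv_le_comm₀ (hpos _ (hYS t ht)) (by norm_num)]
      linarith [(hb _ (hYS t ht)).1]
    have h0 : 0 < (r₁ (Y t) - 2)⁻¹ := inv_pos.2 (hpos _ (hYS t ht))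
    rw [abs_mul, abs_neg, abs_of_pos (pow_pos h0 3)]
    calc _ ≤ 35 / 100 * (10 / 9 : ℝ) ^ 3 := by
          gcongr
          exact (hb _ (hYS t ht)).2.2.1
      _ ≤ 1 / 2 := by norm_num
  case abs_Y₃_le =>
    intro t ht
    have h1 : (r₁ (Y t) - 2)⁻¹ ≤ 10 / 9 := by
      rw [inv_le_comm₀ (hpos _ (hYS t ht)) (by norm_num)]
      linarith [(hb _ (hYS t ht)).1]
    have h0 : 0 < (r₁ (Y t) - 2)⁻¹ := inv_pos.2 (hpos _ (hYS t ht))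
    have h2 := (hb _ (hYS t ht)).2.2.1
    have h3 := (hb _ (hYS t ht)).2.2.2
    have hr1 := (hr _ (hYS t ht)).2.1
    have h4 : |p₃ (Y t)| ≤ 5 := by
      have : |2 * r₁ (Y t) * p₂ (Y t)| ≤ 2 * (305 / 100) * (35 / 100) := by
        rw [abs_mul, abs_of_nonneg (by linarith : (0 : ℝ) ≤ 2 * r₁ (Y t))]
        gcongr
        exact hr1.2
      calc |p₃ (Y t)| ≤ |p₂ (Y t)| + |2 * r₂ (Y t) + r₃ (Y t) - r₁ (Y t) * r₂ (Y t)|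
            + |2 * r₁ (Y t) * p₂ (Y t)| := (abs_sub _ _).trans (by gcongr; exact abs_add_le _ _)
        _ ≤ 35 / 100 + 2 + 2 * (305 / 100) * (35 / 100) := by gcongr
        _ ≤ 5 := by norm_num
    refine (abs_add_le _ _).trans ?_
    rw [abs_mul, abs_neg, abs_of_pos (pow_pos h0 4), abs_mul, abs_mul, abs_pow,
      abs_of_pos (pow_pos h0 5), abs_of_pos (by norm_num : (0 : ℝ) < 3)]
    calc _ ≤ 5 * (10 / 9 : ℝ) ^ 4 + 3 * (35 / 100 : ℝ) ^ 2 * (10 / 9 : ℝ) ^ 5 := by gcongr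
      _ ≤ 100 := by norm_num
  case exp_Y_lt => exact fun t ht => (hexp _ (hYS t ht)).2
  case eq_V₀ => exact hU
  case eq_V₁ =>
    intro t ht
    have hne := (hpos _ (hYS t ht)).ne'
    have hUpos := (hr _ (hYS t ht)).1
    have hU' := hU t ht
    have hη := (hexp _ (hYS t ht)).1
    rw [← div_eq_mul_inv, div_eq_iff hne]
    have e1 : r₁ (Y t) * U₀ (Real.exp (Y t)) = Real.exp (Y t) * U₁ (Real.exp (Y t)) :=
      div_mul_cancel₀ _ hUpos.ne'
    rw [hU'] at e1
    have e2 : U₁ (Real.exp (Y t)) = r₁ (Y t) * (Real.exp (Y t) * Real.exp t) := by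
      have : Real.exp (Y t) * U₁ (Real.exp (Y t))
          = Real.exp (Y t) * (r₁ (Y t) * (Real.exp (Y t) * Real.exp t)) := by
        rw [← e1]; ring
      exact mul_left_cancel₀ hη.ne' this
    change (U₁ (Real.exp (Y t)) - _) = _
    rw [e2]
    ring
  case strictMonoOn =>
    have hmono : StrictMonoOn G S := by
      intro y hy y' hy' hyy
      have := mul_sub_le_of_deriv_ge hconv hdG hk hy hy' hyy.le
      linarith
    have e : ∀ η ∈ Ioo 0 δ, W.s ^ 2 - W.V₀ η / η ^ 2 = Real.exp (G (Real.log η)) := by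
      intro η hη
      have hlog : Real.log η ∈ S := Real.log_lt_log hη.1 hη.2
      have hUpos := (hr _ hlog).1
      rw [Real.exp_log hη.1] at hUpos
      have : G (Real.log η) = Real.log (U₀ η) - 2 * Real.log η := by
        rw [hG]; simp only; rw [Real.exp_log hη.1]
      rw [this, Real.exp_sub, Real.exp_log hUpos, two_mul, Real.exp_add, Real.exp_log hη.1, ← pow_two,
        hU₀]
      have := hη.1.ne'
      field_simp
    intro η hη η' hη' hlt
    simp only
    rw [e η hη, e η' hη']
    exact Real.exp_lt_exp.2 (hmono (Real.log_lt_log hη.1 hη.2) (Real.log_lt_log hη'.1 hη'.2)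
      (Real.log_lt_log hη.1 hlt))

/-! ### The potential well of the nonlinearity -/

section WellOf

variable {f : ℝ → ℝ}

theorem sq_soundSpeed (hf1' : deriv f 1 < 0) : soundSpeed f ^ 2 = -2 * deriv f 1 :=
  Real.sq_sqrt (by linarith)

theorem soundSpeed_pos (hf1' : deriv f 1 < 0) : 0 < soundSpeed f :=
  Real.sqrt_pos.2 (by linarith)

theorem hasDerivAt_potential (hf : ContinuousOn f (Ici 0)) {r : ℝ} (hr : 0 < r) :
    HasDerivAt (potential f) (-f r) r := by
  have hsub : uIcc r 1 ⊆ Ici 0 := fun x hx => (le_min hr.le zero_le_one).trans hx.1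
  refine intervalIntegral.integral_hasDerivAt_left
    ((hf.mono hsub).intervalIntegrable) ?_ (hf.continuousAt (Ici_mem_nhds hr))
  exact (hf.mono Ioi_subset_Ici_self).stronglyMeasurableAtFilter isOpen_Ioi r hr

theorem hasDerivAt_comp_one_sub {g : ℝ → ℝ} {g' η : ℝ} (h : HasDerivAt g g' (1 - η)) :
    HasDerivAt (fun η => g (1 - η)) (-g') η := by
  simpa using h.comp_const_sub 1 η

theorem hasDerivAt_deriv_of_contDiffOn {g : ℝ → ℝ} {n : ℕ} (hg : ContDiffOn ℝ (n + 1) g (Ioi 0)) :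
    ContDiffOn ℝ n (deriv g) (Ioi 0) ∧ ∀ r, 0 < r → HasDerivAt g (deriv g r) r := by
  refine ⟨hg.deriv_of_isOpen isOpen_Ioi le_rfl, fun r hr => ?_⟩
  exact ((hg.differentiableOn (by norm_cast)).differentiableAt (Ioi_mem_nhds hr)).hasDerivAt

/-- The well `V₀(η) = 4 (1 - η) F(1 - η)`. -/
def wellOf (hf : ContDiffOn ℝ 3 f (Ici 0)) (hf1 : f 1 = 0) (hf1' : deriv f 1 < 0)
    (H1 : ∀ ρ : ℝ, 0 ≤ ρ → soundSpeed f ^ 2 / 4 * (1 - ρ) ^ 2 ≤ potential f ρ) : Well :=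
  have hF : ∀ η < 1, HasDerivAt (fun η => potential f (1 - η)) (f (1 - η)) η := fun η hη => by
    simpa using hasDerivAt_comp_one_sub (hasDerivAt_potential hf.continuousOn (sub_pos.2 hη))
  have h0 := hasDerivAt_deriv_of_contDiffOn (n := 2) (hf.mono Ioi_subset_Ici_self)
  have h1 := hasDerivAt_deriv_of_contDiffOn (n := 1) h0.1
  have h2 := hasDerivAt_deriv_of_contDiffOn (n := 0) h1.1
  have hd0 : ∀ η < 1, HasDerivAt (fun η => f (1 - η)) (-deriv f (1 - η)) η := fun η hη =>
    hasDerivAt_comp_one_sub (h0.2 _ (sub_pos.2 hη))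
  have hd1 : ∀ η < 1, HasDerivAt (fun η => deriv f (1 - η)) (-deriv (deriv f) (1 - η)) η :=
    fun η hη => hasDerivAt_comp_one_sub (h1.2 _ (sub_pos.2 hη))
  have hd2 : ∀ η < 1, HasDerivAt (fun η => deriv (deriv f) (1 - η))
      (-deriv (deriv (deriv f)) (1 - η)) η :=
    fun η hη => hasDerivAt_comp_one_sub (h2.2 _ (sub_pos.2 hη))
  have hρ : ∀ η, HasDerivAt (fun η : ℝ => 4 * (1 - η)) (-4) η := fun η => by
    simpa using ((hasDerivAt_id η).const_sub 1).const_mul 4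
  { s := soundSpeed f
    V₀ := fun η => 4 * (1 - η) * potential f (1 - η)
    V₁ := fun η => -4 * potential f (1 - η) + 4 * (1 - η) * f (1 - η)
    V₂ := fun η => -8 * f (1 - η) - 4 * (1 - η) * deriv f (1 - η)
    V₃ := fun η => 12 * deriv f (1 - η) + 4 * (1 - η) * deriv (deriv f) (1 - η)
    V₄ := fun η => -16 * deriv (deriv f) (1 - η) - 4 * (1 - η) * deriv (deriv (deriv f)) (1 - η)
    s_pos := soundSpeed_pos hf1'
    hasDerivAt₀ := fun η hη => by
      refine ((hρ η).mul (hF η hη)).congr_deriv ?_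
      ring
    hasDerivAt₁ := fun η hη => by
      refine (((hF η hη).const_mul (-4)).add ((hρ η).mul (hd0 η hη))).congr_deriv ?_
      ring
    hasDerivAt₂ := fun η hη => by
      refine (((hd0 η hη).const_mul (-8)).sub ((hρ η).mul (hd1 η hη))).congr_deriv ?_
      ring
    hasDerivAt₃ := fun η hη => by
      refine (((hd1 η hη).const_mul 12).add ((hρ η).mul (hd2 η hη))).congr_deriv ?_
      ring
    continuousOn₄ := by
      have c2 : ContinuousOn (fun η => deriv (deriv f) (1 - η)) (Iio 1) := fun η hη =>
        (hd2 η hη).continuousAt.continuousWithinAt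
      have c3 : ContinuousOn (fun η => deriv (deriv (deriv f)) (1 - η)) (Iio 1) :=
        h2.1.continuousOn.comp (by fun_prop) fun η hη => sub_pos.2 (mem_Iio.1 hη)
      fun_prop
    V₀_zero := by simp [potential]
    V₁_zero := by simp [potential, hf1]
    V₂_zero := by
      rw [sq_soundSpeed hf1']
      simp [hf1]
      ring
    lower := fun η hη => by
      have := mul_le_mul_of_nonneg_left (H1 (1 - η) (by linarith))
        (by linarith : 0 ≤ 4 * (1 - η))
      nlinarith [this] }

end WellOf

/-! ### Elementary functions -/

/-- The function `ℓ(τ) = -2 log cosh τ = log sech² τ`. -/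
def logSech (τ : ℝ) : ℝ := -2 * Real.log (Real.cosh τ)

theorem abs_tanh_le (τ : ℝ) : |Real.tanh τ| ≤ 1 := (Real.abs_tanh_lt_one τ).le

theorem hasDerivAt_tanh' (τ : ℝ) : HasDerivAt Real.tanh (1 - Real.tanh τ ^ 2) τ := by
  have := Real.cosh_pos τ
  have h : Real.tanh = fun x => Real.sinh x / Real.cosh x := funext Real.tanh_eq_sinh_div_cosh
  rw [h]
  refine ((Real.hasDerivAt_sinh τ).div (Real.hasDerivAt_cosh τ) this.ne').congr_deriv ?_
  field_simp

theorem hasDerivAt_logSech (τ : ℝ) : HasDerivAt logSech (-2 * Real.tanh τ) τ := by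
  refine (((Real.hasDerivAt_cosh τ).log (Real.cosh_pos τ).ne').const_mul (-2)).congr_deriv ?_
  rw [Real.tanh_eq_sinh_div_cosh]

theorem continuous_logSech : Continuous logSech :=
  continuous_iff_continuousAt.2 fun τ => (hasDerivAt_logSech τ).continuousAt

theorem continuous_tanh' : Continuous Real.tanh :=
  continuous_iff_continuousAt.2 fun τ => (hasDerivAt_tanh' τ).continuousAt

theorem logSech_nonpos (τ : ℝ) : logSech τ ≤ 0 := by
  have := Real.log_nonneg (Real.one_le_cosh τ)
  rw [logSech]; linarith

@[simp] theorem logSech_zero : logSech 0 = 0 := by simp [logSech]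

theorem exp_logSech (τ : ℝ) : Real.exp (logSech τ) = 1 - Real.tanh τ ^ 2 := by
  have h := Real.cosh_pos τ
  have h2 := Real.cosh_sq τ
  rw [logSech, neg_mul, Real.exp_neg, two_mul, Real.exp_add, Real.exp_log h,
    Real.tanh_eq_sinh_div_cosh]
  field_simp
  linarith

/-- From cosh τ ≥ e^{|τ|}/2. This linear bound is the source of the exponential decay of the
profiles. -/
theorem logSech_le (τ : ℝ) : logSech τ ≤ 2 * Real.log 2 - 2 * |τ| := by
  have h : Real.exp |τ| / 2 ≤ Real.cosh τ := by
    rw [← Real.cosh_abs, Real.cosh_eq]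
    linarith [Real.exp_pos (-|τ|)]
  have := Real.log_le_log (by positivity) h
  rw [Real.log_div (Real.exp_pos _).ne' two_ne_zero, Real.log_exp] at this
  rw [logSech]; linarith

theorem abs_logSech_le (τ : ℝ) : |logSech τ| ≤ 2 * |τ| := by
  have h : Real.cosh τ ≤ Real.exp |τ| := by
    rw [← Real.cosh_abs, Real.cosh_eq]
    have : Real.exp (-|τ|) ≤ Real.exp |τ| := Real.exp_le_exp.2 (by linarith [abs_nonneg τ])
    linarith
  have := Real.log_le_log (Real.cosh_pos τ) h
  rw [Real.log_exp] at this
  rw [abs_of_nonpos (logSech_nonpos τ), logSech]; linarith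

/-! ### Primitives depending on a parameter -/

/-- The primitive `∫_0^θ A(l + ℓ(τ)) dτ`. -/
def primLog (A : ℝ → ℝ) (l θ : ℝ) : ℝ := ∫ τ in 0..θ, A (l + logSech τ)

section PrimLog

variable {A A₁ : ℝ → ℝ} {t₀ : ℝ}

theorem continuous_comp_add_logSech (hA : ContinuousOn A (Iio t₀)) {l : ℝ} (hl : l < t₀) :
    Continuous fun τ => A (l + logSech τ) :=
  hA.comp_continuous (by have := continuous_logSech; fun_prop) fun τ =>
    (by linarith [logSech_nonpos τ] : l + logSech τ < t₀)

theorem hasDerivAt_primLog_right (hA : ContinuousOn A (Iio t₀)) {l : ℝ} (hl : l < t₀) (θ : ℝ) :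
    HasDerivAt (primLog A l) (A (l + logSech θ)) θ :=
  have hc := continuous_comp_add_logSech hA hl
  intervalIntegral.integral_hasDerivAt_right (hc.intervalIntegrable _ _)
    (hc.stronglyMeasurableAtFilter _ _) hc.continuousAt

theorem continuousOn_primLog (hA : ContinuousOn A (Iio t₀)) :
    ContinuousOn (fun p : ℝ × ℝ => primLog A p.1 p.2) (Iio t₀ ×ˢ univ) := by
  intro p hp
  -- Truncating the argument at t₁ < t₀ makes the integrand continuous on the whole plane and
  -- changes nothing for parameters below t₁.
  obtain ⟨t₁, h1, h2⟩ := exists_between (mem_Iio.1 hp.1)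
  have hc : Continuous (Function.uncurry fun l τ => A (min (l + logSech τ) t₁)) := by
    refine hA.comp_continuous ?_ fun q => (min_le_right _ _).trans_lt h2
    have := continuous_logSech
    fun_prop
  have hP := intervalIntegral.continuous_parametric_primitive_of_continuous
    (μ := (volume : Measure ℝ)) (a₀ := 0) hc
  refine ContinuousAt.continuousWithinAt (hP.continuousAt.congr ?_)
  filter_upwards [(isOpen_Iio.preimage continuous_fst).mem_nhds h1] with q hq
  refine intervalIntegral.integral_congr fun τ _ => ?_
  have : q.1 + logSech τ ≤ t₁ := by linarith [logSech_nonpos τ, show q.1 < t₁ from hq]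
  simp only [min_eq_left this]

theorem hasDerivAt_primLog_left (hd : ∀ t < t₀, HasDerivAt A (A₁ t) t)
    (hA₁ : ContinuousOn A₁ (Iio t₀)) {K : ℝ} (hK : ∀ t < t₀, |A₁ t| ≤ K) {l : ℝ} (hl : l < t₀)
    (θ : ℝ) : HasDerivAt (fun l => primLog A l θ) (primLog A₁ l θ) l := by
  have hA : ContinuousOn A (Iio t₀) := fun t ht => (hd t ht).continuousAt.continuousWithinAt
  refine (intervalIntegral.hasDerivAt_integral_of_dominated_loc_of_deriv_le
    (μ := volume) (F := fun l τ => A (l + logSech τ)) (F' := fun l τ => A₁ (l + logSech τ))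
    (bound := fun _ => K) (Iio_mem_nhds hl) ?_ ?_ ?_ ?_ ?_ ?_).2
  · filter_upwards [Iio_mem_nhds hl] with l' hl'
    exact (continuous_comp_add_logSech hA hl').aestronglyMeasurable
  · exact (continuous_comp_add_logSech hA hl).intervalIntegrable _ _
  · exact (continuous_comp_add_logSech hA₁ hl).aestronglyMeasurable
  · exact ae_of_all _ fun τ _ l' hl' => hK _ (by linarith [logSech_nonpos τ, mem_Iio.1 hl'])
  · exact intervalIntegrable_const
  · refine ae_of_all _ fun τ _ l' hl' => ?_
    have := hd (l' + logSech τ) (by linarith [logSech_nonpos τ, mem_Iio.1 hl'])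
    exact this.comp_add_const l' (logSech τ)

theorem abs_primLog_le {K : ℝ} (hK : ∀ t < t₀, |A t| ≤ K) {l : ℝ} (hl : l < t₀) (θ : ℝ) :
    |primLog A l θ| ≤ K * |θ| := by
  have := intervalIntegral.norm_integral_le_of_norm_le_const (a := 0) (b := θ) (C := K)
    (f := fun τ => A (l + logSech τ)) fun τ _ => hK _ (by linarith [logSech_nonpos τ])
  simpa [primLog] using this

theorem hasStrictFDerivAt_primLog (hd : ∀ t < t₀, HasDerivAt A (A₁ t) t)
    (hA₁ : ContinuousOn A₁ (Iio t₀)) {K : ℝ} (hK : ∀ t < t₀, |A₁ t| ≤ K) {l : ℝ} (hl : l < t₀)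
    (θ : ℝ) : HasStrictFDerivAt (fun p : ℝ × ℝ => primLog A p.1 p.2)
      ((ContinuousLinearMap.toSpanSingleton ℝ (primLog A₁ l θ)).coprod
        (ContinuousLinearMap.toSpanSingleton ℝ (A (l + logSech θ)))) (l, θ) := by
  have hA : ContinuousOn A (Iio t₀) := fun t ht => (hd t ht).continuousAt.continuousWithinAt
  have hnhds : Iio t₀ ×ˢ univ ∈ 𝓝 ((l, θ) : ℝ × ℝ) :=
    (isOpen_Iio.prod isOpen_univ).mem_nhds ⟨hl, mem_univ _⟩
  have hts : Continuous fun y : ℝ => ContinuousLinearMap.toSpanSingleton ℝ y :=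
    (ContinuousLinearMap.toSpanSingletonLIE ℝ ℝ).continuous
  refine hasStrictFDerivAt_uncurry_coprod (𝕜 := ℝ) (u := ((l, θ) : ℝ × ℝ)) (f := primLog A)
    (f₁ := fun l θ => ContinuousLinearMap.toSpanSingleton ℝ (primLog A₁ l θ))
    (f₂ := fun l θ => ContinuousLinearMap.toSpanSingleton ℝ (A (l + logSech θ))) ?_ ?_ ?_ ?_
  · filter_upwards [hnhds] with p hp
    exact (hasDerivAt_primLog_left hd hA₁ hK hp.1 p.2).hasFDerivAt
  · filter_upwards [hnhds] with p hp
    exact (hasDerivAt_primLog_right hA hp.1 p.2).hasFDerivAt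
  · exact hts.continuousAt.comp ((continuousOn_primLog hA₁).continuousAt hnhds)
  · refine hts.continuousAt.comp (f := fun p : ℝ × ℝ => A (p.1 + logSech p.2)) ?_
    refine ContinuousAt.comp (g := A) (hA.continuousAt (Iio_mem_nhds ?_)) ?_
    · have := logSech_nonpos θ
      simp only; linarith
    · have := continuous_logSech
      fun_prop

end PrimLog

/-- The uniqueness hypothesis identifies θ near l with the implicit function, so θ is
differentiable; its derivative is then read off by differentiating the constant Φ(l', θ(l')). -/
theorem hasDerivAt_implicit {Φ : ℝ × ℝ → ℝ} {θ : ℝ → ℝ} {a b l : ℝ}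
    (h : HasStrictFDerivAt Φ ((ContinuousLinearMap.toSpanSingleton ℝ a).coprod
      (ContinuousLinearMap.toSpanSingleton ℝ b)) (l, θ l)) (hb : b ≠ 0)
    (hu : ∀ᶠ l' in 𝓝 l, ∀ t, Φ (l', t) = Φ (l, θ l) ↔ t = θ l') :
    HasDerivAt θ (-a / b) l := by
  have hinv : (((ContinuousLinearMap.toSpanSingleton ℝ a).coprod
      (ContinuousLinearMap.toSpanSingleton ℝ b)) ∘L .inr ℝ ℝ ℝ).IsInvertible := by
    refine ⟨ContinuousLinearEquiv.unitsEquivAut ℝ (Units.mk0 b hb), ?_⟩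
    ext
    simp
  have h1 := h.hasStrictFDerivAt_implicitFunctionOfProdDomain hinv
  have h2 := h.eventually_apply_implicitFunctionOfProdDomain hinv
  set ψ := h.implicitFunctionOfProdDomain hinv
  have he : ψ =ᶠ[𝓝 l] θ := by
    filter_upwards [hu, h2] with l' e1 e2 using (e1 _).1 e2
  have hθ : DifferentiableAt ℝ θ l := h1.hasFDerivAt.differentiableAt.congr_of_eventuallyEq he.symm
  have hd := hθ.hasDerivAt
  have hc : HasDerivAt (fun l' => Φ (l', θ l')) (a + deriv θ l * b) l := by
    have := h.hasFDerivAt.comp_hasDerivAt l ((hasDerivAt_id l).prodMk hd)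
    simpa [Function.comp_def] using this
  have h0 : HasDerivAt (fun l' => Φ (l', θ l')) 0 l := by
    refine (hasDerivAt_const l (Φ (l, θ l))).congr_of_eventuallyEq ?_
    filter_upwards [hu] with l' e1 using (e1 _).2 rfl
  have := hc.unique h0
  refine hd.congr_deriv ?_
  rw [eq_div_iff hb]
  linarith

/-! ### The phase -/

namespace LogProfile

variable {W : Well} (D : LogProfile W)

theorem continuousOn_Y₁ : ContinuousOn D.Y₁ (Iio D.t₀) := fun t ht =>
  (D.hasDerivAt₁ t ht).continuousAt.continuousWithinAt

theorem continuousOn_Y₂ : ContinuousOn D.Y₂ (Iio D.t₀) := fun t ht =>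
  (D.hasDerivAt₂ t ht).continuousAt.continuousWithinAt

theorem add_logSech_lt {l : ℝ} (hl : l < D.t₀) (θ : ℝ) : l + logSech θ < D.t₀ := by
  linarith [logSech_nonpos θ]

theorem mul_abs_sub_le_primLog {l : ℝ} (hl : l < D.t₀) (θ θ' : ℝ) :
    10 / 11 * |θ' - θ| ≤ |primLog D.Y₁ l θ' - primLog D.Y₁ l θ| :=
  mul_abs_sub_le_of_deriv_ge convex_univ
    (fun y _ => hasDerivAt_primLog_right D.continuousOn_Y₁ hl y)
    (fun y _ => D.le_Y₁ _ (D.add_logSech_lt hl y)) (mem_univ θ) (mem_univ θ')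

@[simp] theorem _root_.DarkSoliton.primLog_zero (A : ℝ → ℝ) (l : ℝ) : primLog A l 0 = 0 := by
  simp [primLog]

/-- Since Y₁ ≥ 10/11, the primitive has passed -|y| and |y| by the times ∓(11/10)|y|. -/
theorem exists_primLog_eq {l : ℝ} (hl : l < D.t₀) (y : ℝ) : ∃ θ, primLog D.Y₁ l θ = y := by
  have hd := fun θ (_ : θ ∈ univ) => hasDerivAt_primLog_right D.continuousOn_Y₁ hl θ
  have hk := fun θ (_ : θ ∈ univ) => D.le_Y₁ _ (D.add_logSech_lt hl θ)
  have hT : 0 ≤ 11 / 10 * |y| := by positivity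
  have h1 := mul_sub_le_of_deriv_ge convex_univ hd hk (mem_univ 0) (mem_univ (11 / 10 * |y|)) hT
  have h2 := mul_sub_le_of_deriv_ge convex_univ hd hk (mem_univ (-(11 / 10 * |y|))) (mem_univ 0)
    (neg_nonpos.2 hT)
  rw [primLog_zero] at h1 h2
  have hc : ContinuousOn (primLog D.Y₁ l) (Icc (-(11 / 10 * |y|)) (11 / 10 * |y|)) :=
    fun θ _ => (hd θ (mem_univ θ)).continuousAt.continuousWithinAt
  obtain ⟨θ, _, h⟩ := intermediate_value_Icc (by linarith) hc
    (show y ∈ Icc _ _ from ⟨by linarith [neg_abs_le y], by linarith [le_abs_self y]⟩)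
  exact ⟨θ, h⟩

open Classical in
/-- The inverse of the primitive `θ ↦ ∫_0^θ Y₁(l + ℓ)`. -/
def inv (l y : ℝ) : ℝ := if h : l < D.t₀ then (D.exists_primLog_eq h y).choose else 0

theorem primLog_inv {l : ℝ} (hl : l < D.t₀) (y : ℝ) : primLog D.Y₁ l (D.inv l y) = y := by
  rw [inv, dif_pos hl]
  exact (D.exists_primLog_eq hl y).choose_spec

theorem eq_inv_iff {l : ℝ} (hl : l < D.t₀) {θ y : ℝ} :
    primLog D.Y₁ l θ = y ↔ θ = D.inv l y := by
  constructor
  · intro h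
    have := D.mul_abs_sub_le_primLog hl (D.inv l y) θ
    rw [h, D.primLog_inv hl, sub_self, abs_zero] at this
    exact sub_eq_zero.1 (abs_eq_zero.1 (le_antisymm (by linarith) (abs_nonneg _)))
  · rintro rfl
    exact D.primLog_inv hl y

theorem inv_zero {l : ℝ} (hl : l < D.t₀) : D.inv l 0 = 0 :=
  ((D.eq_inv_iff hl).1 (primLog_zero _ _)).symm

theorem abs_inv_le {l : ℝ} (hl : l < D.t₀) (y : ℝ) : |D.inv l y| ≤ 11 / 10 * |y| := by
  have := D.mul_abs_sub_le_primLog hl 0 (D.inv l y)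
  rw [D.primLog_inv hl, primLog_zero, sub_zero, sub_zero] at this
  linarith

theorem le_abs_inv {l : ℝ} (hl : l < D.t₀) (y : ℝ) : 9 / 10 * |y| ≤ |D.inv l y| := by
  have := abs_primLog_le (A := D.Y₁) (K := 10 / 9) (fun t ht => by
    rw [abs_of_pos (by linarith [D.le_Y₁ t ht])]; exact D.Y₁_le t ht) hl (D.inv l y)
  rw [D.primLog_inv hl] at this
  linarith

theorem hasDerivAt_inv {l : ℝ} (hl : l < D.t₀) (y : ℝ) :
    HasDerivAt (D.inv l) (D.Y₁ (l + logSech (D.inv l y)))⁻¹ y :=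
  hasDerivAt_inverse convex_univ isOpen_univ (by norm_num : (0 : ℝ) < 10 / 11)
    (fun θ _ => hasDerivAt_primLog_right D.continuousOn_Y₁ hl θ)
    (fun θ _ => D.le_Y₁ _ (D.add_logSech_lt hl θ)) (fun _ _ => mem_univ _)
    (fun y _ => D.primLog_inv hl y) (mem_univ y)

/-- The phase `θ(l, x)`, solution of `∫_0^θ Y₁(l + ℓ) = e^{l/2} x / 2`. -/
def theta (l x : ℝ) : ℝ := D.inv l (Real.exp (l / 2) * x / 2)

theorem primLog_theta {l : ℝ} (hl : l < D.t₀) (x : ℝ) :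
    primLog D.Y₁ l (D.theta l x) = Real.exp (l / 2) * x / 2 := D.primLog_inv hl _

theorem hasDerivAt_theta_right {l : ℝ} (hl : l < D.t₀) (x : ℝ) :
    HasDerivAt (D.theta l) (Real.exp (l / 2) / 2 / D.Y₁ (l + logSech (D.theta l x))) x := by
  have h1 : HasDerivAt (fun x => Real.exp (l / 2) * x / 2) (Real.exp (l / 2) / 2) x := by
    simpa using ((hasDerivAt_id x).const_mul (Real.exp (l / 2))).div_const 2
  refine ((D.hasDerivAt_inv hl _).comp x h1).congr_deriv ?_
  rw [div_eq_mul_inv _ (D.Y₁ _), mul_comm]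
  rfl

theorem continuous_theta {l : ℝ} (hl : l < D.t₀) : Continuous (D.theta l) :=
  continuous_iff_continuousAt.2 fun x => (D.hasDerivAt_theta_right hl x).continuousAt

theorem theta_zero {l : ℝ} (hl : l < D.t₀) : D.theta l 0 = 0 := by
  rw [theta, mul_zero, zero_div, D.inv_zero hl]

theorem Y₁_pos {l : ℝ} (hl : l < D.t₀) (θ : ℝ) : 0 < D.Y₁ (l + logSech θ) :=
  lt_of_lt_of_le (by norm_num) (D.le_Y₁ _ (D.add_logSech_lt hl θ))

/-- The derivative of the phase with respect to the parameter. -/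
def theta₁ (l x : ℝ) : ℝ :=
  (Real.exp (l / 2) * x / 4 - primLog D.Y₂ l (D.theta l x)) / D.Y₁ (l + logSech (D.theta l x))

/-- The second derivative of the phase with respect to the parameter. -/
def theta₂ (l x : ℝ) : ℝ :=
  ((Real.exp (l / 2) * x / 8 - (primLog D.Y₃ l (D.theta l x)
      + D.Y₂ (l + logSech (D.theta l x)) * D.theta₁ l x))
    - D.theta₁ l x * (D.Y₂ (l + logSech (D.theta l x))
      * (1 + -2 * Real.tanh (D.theta l x) * D.theta₁ l x)))
    / D.Y₁ (l + logSech (D.theta l x))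

theorem hasDerivAt_exp_half (l : ℝ) :
    HasDerivAt (fun l => Real.exp (l / 2)) (Real.exp (l / 2) / 2) l := by
  refine (((hasDerivAt_id l).div_const 2).exp).congr_deriv ?_
  simp; ring

/-- The implicit relation is `primLog D.Y₁ l θ` = e^{l/2} x / 2, whose θ-derivative Y₁ never
vanishes. -/
theorem hasDerivAt_theta {l : ℝ} (hl : l < D.t₀) (x : ℝ) :
    HasDerivAt (fun l => D.theta l x) (D.theta₁ l x) l := by
  have h1 := hasStrictFDerivAt_primLog D.hasDerivAt₁ D.continuousOn_Y₂ D.abs_Y₂_le hl (D.theta l x)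
  have h2 : HasStrictFDerivAt (fun p : ℝ × ℝ => Real.exp (p.1 / 2) * x / 2)
      ((Real.exp (l / 2) * x / 4) • ContinuousLinearMap.fst ℝ ℝ ℝ) (l, D.theta l x) := by
    have h3 : HasStrictDerivAt (fun l => Real.exp (l / 2) * x / 2) (Real.exp (l / 2) * x / 4) l := by
      have := ((((hasStrictDerivAt_id l).div_const 2).exp).mul_const x).div_const 2
      refine this.congr_deriv ?_
      simp; ring
    exact HasStrictDerivAt.comp_hasStrictFDerivAt (f := Prod.fst) ((l, D.theta l x) : ℝ × ℝ) h3
      hasStrictFDerivAt_fst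
  have h := h1.sub h2
  have e : (ContinuousLinearMap.toSpanSingleton ℝ (primLog D.Y₂ l (D.theta l x))).coprod
        (ContinuousLinearMap.toSpanSingleton ℝ (D.Y₁ (l + logSech (D.theta l x))))
        - (Real.exp (l / 2) * x / 4) • ContinuousLinearMap.fst ℝ ℝ ℝ
      = (ContinuousLinearMap.toSpanSingleton ℝ
          (primLog D.Y₂ l (D.theta l x) - Real.exp (l / 2) * x / 4)).coprod
        (ContinuousLinearMap.toSpanSingleton ℝ (D.Y₁ (l + logSech (D.theta l x)))) := by
    ext <;> simp
  rw [e] at h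
  refine (hasDerivAt_implicit (θ := fun l => D.theta l x) h (D.Y₁_pos hl _).ne' ?_).congr_deriv ?_
  · filter_upwards [Iio_mem_nhds hl] with l' hl' t
    simp only [Pi.sub_apply]
    rw [D.primLog_theta hl, sub_self, sub_eq_zero, D.eq_inv_iff hl']
    rfl
  · rw [theta₁, neg_sub]

theorem hasDerivAt_logSech_theta {l : ℝ} (hl : l < D.t₀) (x : ℝ) :
    HasDerivAt (fun l => l + logSech (D.theta l x))
      (1 + -2 * Real.tanh (D.theta l x) * D.theta₁ l x) l :=
  (hasDerivAt_id l).add ((hasDerivAt_logSech _).comp l (D.hasDerivAt_theta hl x))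

theorem hasDerivAt_theta₁ {l : ℝ} (hl : l < D.t₀) (x : ℝ) :
    HasDerivAt (fun l => D.theta₁ l x) (D.theta₂ l x) l := by
  have h1 := hasStrictFDerivAt_primLog D.hasDerivAt₂ D.continuousOn₃ D.abs_Y₃_le hl (D.theta l x)
  have h2 : HasDerivAt (fun l => primLog D.Y₂ l (D.theta l x))
      (primLog D.Y₃ l (D.theta l x) + D.Y₂ (l + logSech (D.theta l x)) * D.theta₁ l x) l := by
    have := h1.hasFDerivAt.comp_hasDerivAt l ((hasDerivAt_id l).prodMk (D.hasDerivAt_theta hl x))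
    simpa [Function.comp_def, mul_comm] using this
  have h3 : HasDerivAt (fun l => Real.exp (l / 2) * x / 4) (Real.exp (l / 2) * x / 8) l := by
    refine (((hasDerivAt_exp_half l).mul_const x).div_const 4).congr_deriv ?_
    ring
  have h4 := (D.hasDerivAt₁ _ (D.add_logSech_lt hl (D.theta l x))).comp l
    (D.hasDerivAt_logSech_theta hl x)
  have hne := (D.Y₁_pos hl (D.theta l x)).ne'
  refine ((h3.sub h2).div h4 hne).congr_deriv ?_
  rw [theta₂, theta₁]
  simp only [Function.comp_apply, Pi.sub_apply]
  field_simp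

theorem continuousOn_theta₂ (x : ℝ) : ContinuousOn (fun l => D.theta₂ l x) (Iio D.t₀) := by
  have c0 : ContinuousOn (fun l => D.theta l x) (Iio D.t₀) := fun l hl =>
    (D.hasDerivAt_theta hl x).continuousAt.continuousWithinAt
  have c1 : ContinuousOn (fun l => D.theta₁ l x) (Iio D.t₀) := fun l hl =>
    (D.hasDerivAt_theta₁ hl x).continuousAt.continuousWithinAt
  have cm : ContinuousOn (fun l => l + logSech (D.theta l x)) (Iio D.t₀) := fun l hl =>
    (D.hasDerivAt_logSech_theta hl x).continuousAt.continuousWithinAt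
  have hm : MapsTo (fun l => l + logSech (D.theta l x)) (Iio D.t₀) (Iio D.t₀) := fun l hl =>
    D.add_logSech_lt hl _
  have c2 := D.continuousOn_Y₁.comp cm hm
  have c3 := D.continuousOn_Y₂.comp cm hm
  have c4 : ContinuousOn (fun l => primLog D.Y₃ l (D.theta l x)) (Iio D.t₀) :=
    (continuousOn_primLog D.continuousOn₃).comp (continuousOn_id.prodMk c0)
      fun l hl => ⟨hl, mem_univ _⟩
  have c5 := continuous_tanh'.comp_continuousOn c0
  have c6 : ContinuousOn (fun l => Real.exp (l / 2)) (Iio D.t₀) := by fun_prop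
  exact ((((c6.mul continuousOn_const).div_const 8).sub (c4.add (c3.mul c1))).sub
    (c1.mul (c3.mul (continuousOn_const.add ((continuousOn_const.mul c5).mul c1))))).div c2
    fun l hl => (D.Y₁_pos hl _).ne'

theorem continuous_Y_theta {A : ℝ → ℝ} (hA : ContinuousOn A (Iio D.t₀)) {l : ℝ} (hl : l < D.t₀) :
    Continuous fun x => A (l + logSech (D.theta l x)) :=
  (continuous_comp_add_logSech hA hl).comp (D.continuous_theta hl)

theorem continuous_primLog_theta {A : ℝ → ℝ} (hA : ContinuousOn A (Iio D.t₀)) {l : ℝ}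
    (hl : l < D.t₀) : Continuous fun x => primLog A l (D.theta l x) :=
  (continuous_iff_continuousAt.2 fun θ => (hasDerivAt_primLog_right hA hl θ).continuousAt).comp
    (D.continuous_theta hl)

theorem continuous_theta₁ {l : ℝ} (hl : l < D.t₀) : Continuous (D.theta₁ l) :=
  (((continuous_const.mul continuous_id).div_const 4).sub
    (D.continuous_primLog_theta D.continuousOn_Y₂ hl)).div
    (D.continuous_Y_theta D.continuousOn_Y₁ hl) fun _ => (D.Y₁_pos hl _).ne'

theorem continuous_theta₂ {l : ℝ} (hl : l < D.t₀) : Continuous (D.theta₂ l) := by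
  have c1 := D.continuous_theta₁ hl
  have c3 := D.continuous_Y_theta D.continuousOn_Y₂ hl
  exact (((((continuous_const.mul continuous_id).div_const 8).sub
    ((D.continuous_primLog_theta D.continuousOn₃ hl).add (c3.mul c1))).sub
    (c1.mul (c3.mul (continuous_const.add ((continuous_const.mul
      (continuous_tanh'.comp (D.continuous_theta hl))).mul c1)))))).div
    (D.continuous_Y_theta D.continuousOn_Y₁ hl) fun _ => (D.Y₁_pos hl _).ne'

theorem abs_theta_le {l : ℝ} (hl : l < D.t₀) (hl0 : l ≤ 0) (x : ℝ) : |D.theta l x| ≤ |x| := by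
  have h := D.abs_inv_le hl (Real.exp (l / 2) * x / 2)
  have h1 : Real.exp (l / 2) ≤ 1 := Real.exp_le_one_iff.2 (by linarith)
  rw [abs_div, abs_mul, abs_of_pos (Real.exp_pos _), abs_two] at h
  have := mul_le_mul_of_nonneg_right h1 (abs_nonneg x)
  have h2 := abs_nonneg x
  rw [theta]
  linarith

theorem le_abs_theta {l : ℝ} (hl : l < D.t₀) (x : ℝ) :
    9 / 20 * Real.exp (l / 2) * |x| ≤ |D.theta l x| := by
  have h := D.le_abs_inv hl (Real.exp (l / 2) * x / 2)
  rw [abs_div, abs_mul, abs_of_pos (Real.exp_pos _), abs_two] at h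
  rw [theta]
  linarith

theorem abs_theta₁_le {l : ℝ} (hl : l < D.t₀) (hl0 : l ≤ 0) (x : ℝ) : |D.theta₁ l x| ≤ |x| := by
  have h1 : Real.exp (l / 2) ≤ 1 := Real.exp_le_one_iff.2 (by linarith)
  have h2 := abs_primLog_le D.abs_Y₂_le hl (D.theta l x)
  have h3 := D.abs_theta_le hl hl0 x
  have h4 := D.le_Y₁ _ (D.add_logSech_lt hl (D.theta l x))
  have h5 := mul_le_mul_of_nonneg_right h1 (abs_nonneg x)
  rw [theta₁, abs_div, abs_of_pos (D.Y₁_pos hl _), div_le_iff₀ (D.Y₁_pos hl _)]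
  have h6 : |Real.exp (l / 2) * x / 4| ≤ |x| / 4 := by
    rw [abs_div, abs_mul, abs_of_pos (Real.exp_pos _), abs_of_pos (by norm_num : (0 : ℝ) < 4)]
    linarith
  have h7 := abs_sub (Real.exp (l / 2) * x / 4) (primLog D.Y₂ l (D.theta l x))
  have h8 := mul_le_mul_of_nonneg_left h4 (abs_nonneg x)
  linarith [abs_nonneg x]

/-- Polynomial growth in x is enough, because the profile contributes an exponential factor; the
constant is crude. -/
theorem abs_theta₂_le {l : ℝ} (hl : l < D.t₀) (hl0 : l ≤ 0) (x : ℝ) :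
    |D.theta₂ l x| ≤ 200 * (1 + |x|) ^ 2 := by
  have h1 : Real.exp (l / 2) ≤ 1 := Real.exp_le_one_iff.2 (by linarith)
  have hlt := D.add_logSech_lt hl (D.theta l x)
  have h2 := abs_primLog_le D.abs_Y₃_le hl (D.theta l x)
  have h3 := D.abs_theta_le hl hl0 x
  have ht := D.abs_theta₁_le hl hl0 x
  have h4 := D.le_Y₁ _ hlt
  have hY := D.abs_Y₂_le _ hlt
  have htanh := abs_tanh_le (D.theta l x)
  have hx := abs_nonneg x
  rw [theta₂, abs_div, abs_of_pos (D.Y₁_pos hl _), div_le_iff₀ (D.Y₁_pos hl _)]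
  have b1 : |Real.exp (l / 2) * x / 8| ≤ |x| := by
    rw [abs_div, abs_mul, abs_of_pos (Real.exp_pos _), abs_of_pos (by norm_num : (0 : ℝ) < 8)]
    linarith [mul_le_mul_of_nonneg_right h1 hx]
  have b2 : |D.Y₂ (l + logSech (D.theta l x)) * D.theta₁ l x| ≤ 1 / 2 * |x| := by
    rw [abs_mul]; gcongr
  have b3 : |1 + -2 * Real.tanh (D.theta l x) * D.theta₁ l x| ≤ 1 + 2 * |x| := by
    refine (abs_add_le _ _).trans ?_
    rw [abs_mul, abs_mul, abs_neg, abs_two, abs_one]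
    have := mul_le_mul htanh ht (abs_nonneg _) zero_le_one
    linarith
  have b4 : |D.theta₁ l x * (D.Y₂ (l + logSech (D.theta l x))
      * (1 + -2 * Real.tanh (D.theta l x) * D.theta₁ l x))| ≤ |x| * (1 / 2 * (1 + 2 * |x|)) := by
    rw [abs_mul, abs_mul]; gcongr
  have b5 := (abs_sub (Real.exp (l / 2) * x / 8 - (primLog D.Y₃ l (D.theta l x)
      + D.Y₂ (l + logSech (D.theta l x)) * D.theta₁ l x)) (D.theta₁ l x
      * (D.Y₂ (l + logSech (D.theta l x))
      * (1 + -2 * Real.tanh (D.theta l x) * D.theta₁ l x))))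
  have b6 := abs_sub (Real.exp (l / 2) * x / 8) (primLog D.Y₃ l (D.theta l x)
      + D.Y₂ (l + logSech (D.theta l x)) * D.theta₁ l x)
  have b7 := abs_add_le (primLog D.Y₃ l (D.theta l x))
    (D.Y₂ (l + logSech (D.theta l x)) * D.theta₁ l x)
  have h8 := mul_le_mul_of_nonneg_left h4 (by positivity : 0 ≤ 200 * (1 + |x|) ^ 2)
  nlinarith

end LogProfile

/-! ### Curves in `L²` -/

open Classical in
/-- The class in `L²(ℝ)` of a square integrable function, and `0` otherwise. -/
def toL2 (g : ℝ → ℝ) : L2 := if h : MemLp g 2 (volume : Measure ℝ) then h.toLp g else 0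

theorem coeFn_toL2 {g : ℝ → ℝ} (h : MemLp g 2 (volume : Measure ℝ)) :
    (toL2 g : ℝ → ℝ) =ᵐ[volume] g := by
  rw [toL2, dif_pos h]
  exact h.coeFn_toLp

theorem toL2_sub {g g' : ℝ → ℝ} (h : MemLp g 2 (volume : Measure ℝ))
    (h' : MemLp g' 2 (volume : Measure ℝ)) : toL2 g - toL2 g' = toL2 (g - g') := by
  rw [toL2, dif_pos h, toL2, dif_pos h', toL2, dif_pos (h.sub h')]
  exact (MemLp.toLp_sub h h').symm

theorem toL2_smul (r : ℝ) {g : ℝ → ℝ} (h : MemLp g 2 (volume : Measure ℝ)) :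
    r • toL2 g = toL2 (r • g) := by
  rw [toL2, dif_pos h, toL2, dif_pos (h.const_smul r)]
  exact (MemLp.toLp_const_smul r h).symm

theorem norm_sq_toL2 {g : ℝ → ℝ} (h : MemLp g 2 (volume : Measure ℝ)) :
    ‖toL2 g‖ ^ 2 = ∫ x, g x ^ 2 := by
  rw [← real_inner_self_eq_norm_sq, inner_eq_integral]
  refine integral_congr_ae ?_
  filter_upwards [coeFn_toL2 h] with x hx
  rw [hx, sq]

/-- Dominated convergence for the squared difference, with dominating function (2w)². -/
theorem tendsto_toL2 {ι : Type*} {l : Filter ι} [l.IsCountablyGenerated] {F : ι → ℝ → ℝ}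
    {g w : ℝ → ℝ} (hF : ∀ᶠ n in l, Continuous (F n)) (hg : Continuous g)
    (hw : MemLp w 2 (volume : Measure ℝ)) (hb : ∀ᶠ n in l, ∀ x, |F n x| ≤ w x)
    (hbg : ∀ x, |g x| ≤ w x) (hlim : ∀ x, Tendsto (fun n => F n x) l (𝓝 (g x))) :
    Tendsto (fun n => toL2 (F n)) l (𝓝 (toL2 g)) := by
  have hgm : MemLp g 2 (volume : Measure ℝ) := hw.mono' hg.aestronglyMeasurable (ae_of_all _ hbg)
  have hint : Integrable (fun x => (2 * w x) ^ 2) := (hw.const_mul 2).integrable_sq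
  have h0 : Tendsto (fun n => ∫ x, (F n x - g x) ^ 2) l (𝓝 (∫ _x : ℝ, (0 : ℝ))) := by
    refine tendsto_integral_filter_of_dominated_convergence (fun x => (2 * w x) ^ 2) ?_ ?_ hint ?_
    · filter_upwards [hF] with n hn
      exact ((hn.sub hg).pow 2).aestronglyMeasurable
    · filter_upwards [hb] with n hn
      refine ae_of_all _ fun x => ?_
      rw [Real.norm_eq_abs, abs_pow, ← sq_abs (2 * w x)]
      refine pow_le_pow_left₀ (abs_nonneg _) ?_ 2
      have h1 := abs_sub (F n x) (g x)
      exact (h1.trans (by linarith [hn x, hbg x])).trans (le_abs_self _)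
    · refine ae_of_all _ fun x => ?_
      have := ((hlim x).sub_const (g x)).pow 2
      simpa using this
  rw [integral_zero] at h0
  rw [tendsto_iff_norm_sub_tendsto_zero]
  have h1 : Tendsto (fun n => Real.sqrt (∫ x, (F n x - g x) ^ 2)) l (𝓝 0) := by
    have := (Real.continuous_sqrt.tendsto 0).comp h0
    rw [Real.sqrt_zero] at this
    exact this
  refine h1.congr' ?_
  filter_upwards [hF, hb] with n hn hbn
  have hm : MemLp (F n) 2 (volume : Measure ℝ) :=
    hw.mono' hn.aestronglyMeasurable (ae_of_all _ hbn)
  rw [toL2_sub hm hgm]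
  have := norm_sq_toL2 (hm.sub hgm)
  simp only [Pi.sub_apply] at this
  rw [← this, Real.sqrt_sq (norm_nonneg _)]

/-- By the mean value inequality on the convex set J, the difference quotients are dominated by the
weight bounding the derivative, so pointwise differentiability becomes differentiability in L². -/
theorem hasDerivAt_toL2 {J : Set ℝ} (hJ : IsOpen J) (hJc : Convex ℝ J) {u u₁ : ℝ → ℝ → ℝ}
    {w : ℝ → ℝ} (hw : MemLp w 2 (volume : Measure ℝ))
    (hd : ∀ l ∈ J, ∀ x, HasDerivAt (fun l => u l x) (u₁ l x) l)
    (hc : ∀ l ∈ J, Continuous (u l)) (hc₁ : ∀ l ∈ J, Continuous (u₁ l))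
    (hb : ∀ l ∈ J, ∀ x, |u l x| ≤ w x) (hb₁ : ∀ l ∈ J, ∀ x, |u₁ l x| ≤ w x) {l : ℝ} (hl : l ∈ J) :
    HasDerivAt (fun l => toL2 (u l)) (toL2 (u₁ l)) l := by
  have hm : ∀ l ∈ J, MemLp (u l) 2 (volume : Measure ℝ) := fun l hl =>
    hw.mono' (hc l hl).aestronglyMeasurable (ae_of_all _ (hb l hl))
  have hev : ∀ᶠ l' in 𝓝[≠] l, l' ∈ J := nhdsWithin_le_nhds (hJ.mem_nhds hl)
  rw [hasDerivAt_iff_tendsto_slope]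
  have key : Tendsto (fun l' => toL2 ((l' - l)⁻¹ • (u l' - u l))) (𝓝[≠] l) (𝓝 (toL2 (u₁ l))) := by
    refine tendsto_toL2 (w := w) ?_ (hc₁ l hl) hw ?_ (hb₁ l hl) ?_
    · filter_upwards [hev] with l' hl'
      exact ((hc l' hl').sub (hc l hl)).const_smul _
    · filter_upwards [hev, self_mem_nhdsWithin] with l' hl' hne x
      have := hJc.norm_image_sub_le_of_norm_hasDerivWithin_le (f := fun l => u l x)
        (f' := fun l => u₁ l x) (C := w x) (fun y hy => (hd y hy x).hasDerivWithinAt)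
        (fun y hy => hb₁ y hy x) hl hl'
      simp only [Pi.smul_apply, Pi.sub_apply, smul_eq_mul]
      rw [abs_mul, abs_inv, inv_mul_le_iff₀ (abs_pos.2 (sub_ne_zero.2 hne)), mul_comm]
      exact this
    · intro x
      exact hasDerivAt_iff_tendsto_slope.1 (hd l hl x)
  refine key.congr' ?_
  filter_upwards [hev] with l' hl'
  rw [slope_def_module, toL2_sub (hm l' hl') (hm l hl), toL2_smul _ ((hm l' hl').sub (hm l hl))]

/-! ### Twice differentiable families with bounds -/

/-- A family `u(l, ·)`, `l ∈ J`, of continuous functions which is `C²` with respect to `l`, with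
derivatives `u₁` and `u₂`, all of them bounded by `w`. -/
structure TameWith (J : Set ℝ) (w : ℝ → ℝ) (u u₁ u₂ : ℝ → ℝ → ℝ) : Prop where
  hasDerivAt : ∀ l ∈ J, ∀ x, HasDerivAt (fun l => u l x) (u₁ l x) l
  hasDerivAt₁ : ∀ l ∈ J, ∀ x, HasDerivAt (fun l => u₁ l x) (u₂ l x) l
  continuousOn₂ : ∀ x, ContinuousOn (fun l => u₂ l x) J
  continuous : ∀ l ∈ J, Continuous (u l)
  continuous₁ : ∀ l ∈ J, Continuous (u₁ l)
  continuous₂ : ∀ l ∈ J, Continuous (u₂ l)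
  bound : ∀ l ∈ J, ∀ x, |u l x| ≤ w x
  bound₁ : ∀ l ∈ J, ∀ x, |u₁ l x| ≤ w x
  bound₂ : ∀ l ∈ J, ∀ x, |u₂ l x| ≤ w x

namespace TameWith

variable {J : Set ℝ} {w w' : ℝ → ℝ} {u u₁ u₂ v v₁ v₂ : ℝ → ℝ → ℝ}

theorem mono (h : TameWith J w u u₁ u₂) (hw : ∀ x, w x ≤ w' x) : TameWith J w' u u₁ u₂ :=
  { h with
    bound := fun l hl x => (h.bound l hl x).trans (hw x)
    bound₁ := fun l hl x => (h.bound₁ l hl x).trans (hw x)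
    bound₂ := fun l hl x => (h.bound₂ l hl x).trans (hw x) }

theorem add (h : TameWith J w u u₁ u₂) (h' : TameWith J w' v v₁ v₂) :
    TameWith J (w + w') (u + v) (u₁ + v₁) (u₂ + v₂) where
  hasDerivAt l hl x := (h.hasDerivAt l hl x).add (h'.hasDerivAt l hl x)
  hasDerivAt₁ l hl x := (h.hasDerivAt₁ l hl x).add (h'.hasDerivAt₁ l hl x)
  continuousOn₂ x := (h.continuousOn₂ x).add (h'.continuousOn₂ x)
  continuous l hl := (h.continuous l hl).add (h'.continuous l hl)
  continuous₁ l hl := (h.continuous₁ l hl).add (h'.continuous₁ l hl)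
  continuous₂ l hl := (h.continuous₂ l hl).add (h'.continuous₂ l hl)
  bound l hl x := (abs_add_le _ _).trans (add_le_add (h.bound l hl x) (h'.bound l hl x))
  bound₁ l hl x := (abs_add_le _ _).trans (add_le_add (h.bound₁ l hl x) (h'.bound₁ l hl x))
  bound₂ l hl x := (abs_add_le _ _).trans (add_le_add (h.bound₂ l hl x) (h'.bound₂ l hl x))

theorem mul (h : TameWith J w u u₁ u₂) (h' : TameWith J w' v v₁ v₂) :
    -- The second derivative of a product, with its cross term counted twice, has four terms.
    TameWith J (fun x => 4 * (w x * w' x)) (u * v) (u₁ * v + u * v₁)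
      ((u₂ * v + u₁ * v₁) + (u₁ * v₁ + u * v₂)) := by
  have hb : ∀ {a b : ℝ} {x : ℝ}, |a| ≤ w x → |b| ≤ w' x → |a * b| ≤ w x * w' x := by
    intro a b x ha hb
    rw [abs_mul]
    exact mul_le_mul ha hb (abs_nonneg _) ((abs_nonneg _).trans ha)
  constructor
  · exact fun l hl x => (h.hasDerivAt l hl x).mul (h'.hasDerivAt l hl x)
  · exact fun l hl x => ((h.hasDerivAt₁ l hl x).mul (h'.hasDerivAt l hl x)).add
      ((h.hasDerivAt l hl x).mul (h'.hasDerivAt₁ l hl x))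
  · intro x
    have c0 : ContinuousOn (fun l => u l x) J := fun l hl =>
      (h.hasDerivAt l hl x).continuousAt.continuousWithinAt
    have c1 : ContinuousOn (fun l => u₁ l x) J := fun l hl =>
      (h.hasDerivAt₁ l hl x).continuousAt.continuousWithinAt
    have d0 : ContinuousOn (fun l => v l x) J := fun l hl =>
      (h'.hasDerivAt l hl x).continuousAt.continuousWithinAt
    have d1 : ContinuousOn (fun l => v₁ l x) J := fun l hl =>
      (h'.hasDerivAt₁ l hl x).continuousAt.continuousWithinAt
    exact (((h.continuousOn₂ x).mul d0).add (c1.mul d1)).add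
      ((c1.mul d1).add (c0.mul (h'.continuousOn₂ x)))
  · exact fun l hl => (h.continuous l hl).mul (h'.continuous l hl)
  · exact fun l hl => ((h.continuous₁ l hl).mul (h'.continuous l hl)).add
      ((h.continuous l hl).mul (h'.continuous₁ l hl))
  · exact fun l hl => (((h.continuous₂ l hl).mul (h'.continuous l hl)).add
      ((h.continuous₁ l hl).mul (h'.continuous₁ l hl))).add
      (((h.continuous₁ l hl).mul (h'.continuous₁ l hl)).add
      ((h.continuous l hl).mul (h'.continuous₂ l hl)))
  · intro l hl x
    have h1 := hb (h.bound l hl x) (h'.bound l hl x)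
    have := (abs_nonneg _).trans h1
    exact h1.trans (by linarith)
  · intro l hl x
    have h1 := hb (h.bound₁ l hl x) (h'.bound l hl x)
    have h2 := hb (h.bound l hl x) (h'.bound₁ l hl x)
    have := (abs_nonneg _).trans h1
    exact (abs_add_le _ _).trans (by simp only [Pi.mul_apply]; linarith)
  · intro l hl x
    have h1 := hb (h.bound₂ l hl x) (h'.bound l hl x)
    have h2 := hb (h.bound₁ l hl x) (h'.bound₁ l hl x)
    have h3 := hb (h.bound l hl x) (h'.bound₂ l hl x)
    refine (abs_add_le _ _).trans ?_
    refine (add_le_add (abs_add_le _ _) (abs_add_le _ _)).trans ?_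
    simp only [Pi.mul_apply]
    linarith

theorem comp (h : TameWith J w u u₁ u₂) {S : Set ℝ} {φ φ₁ φ₂ : ℝ → ℝ}
    (hS : ∀ l ∈ J, ∀ x, u l x ∈ S) (hd : ∀ y ∈ S, HasDerivAt φ (φ₁ y) y)
    (hd₁ : ∀ y ∈ S, HasDerivAt φ₁ (φ₂ y) y) (hc : ContinuousOn φ₂ S)
    (hb : ∀ l ∈ J, ∀ x, |φ (u l x)| ≤ w' x) (hb₁ : ∀ l ∈ J, ∀ x, |φ₁ (u l x)| ≤ w' x)
    (hb₂ : ∀ l ∈ J, ∀ x, |φ₂ (u l x)| ≤ w' x) :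
    TameWith J (fun x => w' x * (1 + w x) ^ 2) (fun l x => φ (u l x))
      (fun l x => φ₁ (u l x) * u₁ l x)
      (fun l x => φ₂ (u l x) * u₁ l x * u₁ l x + φ₁ (u l x) * u₂ l x) := by
  have c0 : ∀ x, ContinuousOn (fun l => u l x) J := fun x l hl =>
    (h.hasDerivAt l hl x).continuousAt.continuousWithinAt
  have c1 : ∀ x, ContinuousOn (fun l => u₁ l x) J := fun x l hl =>
    (h.hasDerivAt₁ l hl x).continuousAt.continuousWithinAt
  have e0 : ContinuousOn φ S := fun y hy => (hd y hy).continuousAt.continuousWithinAt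
  have e1 : ContinuousOn φ₁ S := fun y hy => (hd₁ y hy).continuousAt.continuousWithinAt
  constructor
  · exact fun l hl x => (hd _ (hS l hl x)).comp l (h.hasDerivAt l hl x)
  · exact fun l hl x => ((hd₁ _ (hS l hl x)).comp l (h.hasDerivAt l hl x)).mul
      (h.hasDerivAt₁ l hl x)
  · intro x
    exact (((hc.comp (c0 x) fun l hl => hS l hl x).mul (c1 x)).mul (c1 x)).add
      ((e1.comp (c0 x) fun l hl => hS l hl x).mul (h.continuousOn₂ x))
  · exact fun l hl => e0.comp_continuous (h.continuous l hl) (hS l hl)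
  · exact fun l hl => (e1.comp_continuous (h.continuous l hl) (hS l hl)).mul (h.continuous₁ l hl)
  · exact fun l hl => (((hc.comp_continuous (h.continuous l hl) (hS l hl)).mul
      (h.continuous₁ l hl)).mul (h.continuous₁ l hl)).add
      ((e1.comp_continuous (h.continuous l hl) (hS l hl)).mul (h.continuous₂ l hl))
  · intro l hl x
    have h1 := hb l hl x
    have h2 := (abs_nonneg _).trans h1
    have h3 := (abs_nonneg _).trans (h.bound l hl x)
    refine h1.trans (le_mul_of_one_le_right h2 ?_)
    nlinarith
  · intro l hl x
    have h1 := hb₁ l hl x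
    have h2 := (abs_nonneg _).trans h1
    have h3 := (abs_nonneg _).trans (h.bound l hl x)
    rw [abs_mul]
    refine mul_le_mul h1 ((h.bound₁ l hl x).trans ?_) (abs_nonneg _) h2
    nlinarith
  · intro l hl x
    have h1 := hb₁ l hl x
    have h1' := hb₂ l hl x
    have h2 := (abs_nonneg _).trans h1
    have h3 := (abs_nonneg _).trans (h.bound l hl x)
    have k1 := h.bound₁ l hl x
    have k2 := h.bound₂ l hl x
    refine (abs_add_le _ _).trans ?_
    rw [abs_mul, abs_mul, abs_mul]
    calc _ ≤ w' x * w x * w x + w' x * w x := by gcongr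
      _ ≤ _ := by nlinarith [mul_nonneg h2 h3]

theorem contDiffOn_toL2 (h : TameWith J w u u₁ u₂) (hJ : IsOpen J) (hJc : Convex ℝ J)
    (hw : MemLp w 2 (volume : Measure ℝ)) : ContDiffOn ℝ 2 (fun l => toL2 (u l)) J := by
  have d0 := fun l hl => hasDerivAt_toL2 hJ hJc hw h.hasDerivAt h.continuous h.continuous₁ h.bound
    h.bound₁ (l := l) hl
  have d1 := fun l hl => hasDerivAt_toL2 hJ hJc hw h.hasDerivAt₁ h.continuous₁ h.continuous₂
    h.bound₁ h.bound₂ (l := l) hl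
  have c2 : ContinuousOn (fun l => toL2 (u₂ l)) J := by
    intro l hl
    refine tendsto_toL2 (w := w) ?_ (h.continuous₂ l hl) hw ?_ (h.bound₂ l hl)
      fun x => h.continuousOn₂ x l hl
    · filter_upwards [self_mem_nhdsWithin] with l' hl' using h.continuous₂ l' hl'
    · filter_upwards [self_mem_nhdsWithin] with l' hl' using h.bound₂ l' hl'
  have e1 : ContDiffOn ℝ 1 (fun l => toL2 (u₁ l)) J := by
    have : (1 : WithTop ℕ∞) = 0 + 1 := by norm_num
    rw [this, contDiffOn_succ_iff_deriv_of_isOpen hJ]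
    refine ⟨fun l hl => (d1 l hl).differentiableAt.differentiableWithinAt, by simp, ?_⟩
    rw [contDiffOn_zero]
    exact c2.congr fun l hl => (d1 l hl).deriv
  have : (2 : WithTop ℕ∞) = 1 + 1 := by norm_num
  rw [this, contDiffOn_succ_iff_deriv_of_isOpen hJ]
  refine ⟨fun l hl => (d0 l hl).differentiableAt.differentiableWithinAt, by simp, ?_⟩
  exact e1.congr fun l hl => (d0 l hl).deriv

end TameWith

/-! ### Exponentially decaying weights -/

/-- The weight `K (1 + |x|)^n e^{-b|x|}`. -/
def polyExp (K : ℝ) (n : ℕ) (b x : ℝ) : ℝ := K * (1 + |x|) ^ n * Real.exp (-(b * |x|))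

theorem polyExp_mul (K K' : ℝ) (n n' : ℕ) (b b' x : ℝ) :
    polyExp K n b x * polyExp K' n' b' x = polyExp (K * K') (n + n') (b + b') x := by
  have : -((b + b') * |x|) = -(b * |x|) + -(b' * |x|) := by ring
  rw [polyExp, polyExp, polyExp, this, Real.exp_add, pow_add]
  ring

theorem polyExp_mono {K K' b b' : ℝ} {n n' : ℕ} (h0 : 0 ≤ K) (hK : K ≤ K') (hn : n ≤ n')
    (hb : b' ≤ b) (x : ℝ) : polyExp K n b x ≤ polyExp K' n' b' x := by
  have h1 : 1 ≤ 1 + |x| := by linarith [abs_nonneg x]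
  have h2 : b' * |x| ≤ b * |x| := mul_le_mul_of_nonneg_right hb (abs_nonneg x)
  have h3 := h0.trans hK
  rw [polyExp, polyExp]
  gcongr

theorem integrable_exp_neg_mul_abs {b : ℝ} (hb : 0 < b) :
    Integrable fun x : ℝ => Real.exp (-(b * |x|)) := by
  rw [← integrableOn_univ, ← Iic_union_Ioi (a := (0 : ℝ)), integrableOn_union]
  have hp : IntegrableOn (fun x : ℝ => Real.exp (-(b * |x|))) (Ioi 0) := by
    refine (exp_neg_integrableOn_Ioi 0 hb).congr_fun (fun x hx => ?_) measurableSet_Ioi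
    simp [abs_of_pos (mem_Ioi.1 hx)]
  refine ⟨?_, hp⟩
  rw [integrableOn_Iic_iff_integrableOn_Iio]
  have := hp.comp_neg
  simpa using this

/-- Half of the exponential rate absorbs the polynomial, through t^n ≤ n! e^t with t = b(1 + |x|)/2.
-/
theorem polyExp_le {K b : ℝ} (hK : 0 ≤ K) (hb : 0 < b) (n : ℕ) :
    ∃ C, ∀ x, polyExp K n b x ≤ C * Real.exp (-(b / 2 * |x|)) := by
  refine ⟨K * ((2 / b) ^ n * (n.factorial * Real.exp (b / 2))), fun x => ?_⟩
  have h1 := Real.pow_div_factorial_le_exp (x := b / 2 * (1 + |x|)) (by positivity) n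
  rw [div_le_iff₀ (by positivity), mul_pow] at h1
  have h2 : (1 + |x|) ^ n ≤ (2 / b) ^ n * (n.factorial * Real.exp (b / 2) * Real.exp (b / 2 * |x|)) := by
    have h3 : (2 / b) ^ n * (b / 2) ^ n = 1 := by
      rw [← mul_pow]; field_simp; simp
    have h4 := mul_le_mul_of_nonneg_left h1 (by positivity : 0 ≤ (2 / b) ^ n)
    rw [← mul_assoc, h3, one_mul] at h4
    refine h4.trans_eq ?_
    rw [mul_add, mul_one, Real.exp_add]; ring
  have h5 : Real.exp (-(b * |x|)) = Real.exp (-(b / 2 * |x|)) * Real.exp (-(b / 2 * |x|)) := by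
    rw [← Real.exp_add]; congr 1; ring
  have h6 : Real.exp (b / 2 * |x|) * Real.exp (-(b / 2 * |x|)) = 1 := by
    rw [← Real.exp_add]; simp
  rw [polyExp, h5]
  calc _ ≤ K * ((2 / b) ^ n * (n.factorial * Real.exp (b / 2) * Real.exp (b / 2 * |x|)))
        * (Real.exp (-(b / 2 * |x|)) * Real.exp (-(b / 2 * |x|))) := by gcongr
    _ = K * ((2 / b) ^ n * (n.factorial * Real.exp (b / 2))) * Real.exp (-(b / 2 * |x|))
        * (Real.exp (b / 2 * |x|) * Real.exp (-(b / 2 * |x|))) := by ring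
    _ = _ := by rw [h6, mul_one]

theorem continuous_polyExp (K : ℝ) (n : ℕ) (b : ℝ) : Continuous (polyExp K n b) := by
  unfold polyExp
  fun_prop

theorem integrable_polyExp {K b : ℝ} (hK : 0 ≤ K) (hb : 0 < b) (n : ℕ) :
    Integrable (polyExp K n b) := by
  obtain ⟨C, hC⟩ := polyExp_le hK hb n
  refine ((integrable_exp_neg_mul_abs (half_pos hb)).const_mul C).mono'
    (continuous_polyExp K n b).aestronglyMeasurable (ae_of_all _ fun x => ?_)
  rw [Real.norm_eq_abs, abs_of_nonneg (by unfold polyExp; positivity)]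
  exact hC x

theorem memLp_polyExp {K b : ℝ} (hK : 0 ≤ K) (hb : 0 < b) (n : ℕ) :
    MemLp (polyExp K n b) 2 (volume : Measure ℝ) := by
  rw [memLp_two_iff_integrable_sq (continuous_polyExp K n b).aestronglyMeasurable]
  refine (integrable_polyExp (mul_nonneg hK hK) (add_pos hb hb) (n + n)).congr
    (ae_of_all _ fun x => ?_)
  simp only
  rw [sq, polyExp_mul]

/-- Families which are `C²` with respect to the parameter and decay like `e^{-b|x|}`, up to
polynomial factors. -/
def IsTame (J : Set ℝ) (b : ℝ) (u : ℝ → ℝ → ℝ) : Prop :=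
  ∃ u₁ u₂ : ℝ → ℝ → ℝ, ∃ K : ℝ, ∃ n : ℕ, 0 ≤ K ∧ TameWith J (polyExp K n b) u u₁ u₂

namespace IsTame

variable {J : Set ℝ} {b b' : ℝ} {u v : ℝ → ℝ → ℝ}

theorem add (h : IsTame J b u) (h' : IsTame J b v) : IsTame J b (fun l x => u l x + v l x) := by
  obtain ⟨u₁, u₂, K, n, hK, hu⟩ := h
  obtain ⟨v₁, v₂, K', n', hK', hv⟩ := h'
  refine ⟨u₁ + v₁, u₂ + v₂, K + K', n + n', by positivity, (hu.add hv).mono fun x => ?_⟩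
  have h1 := polyExp_mono hK le_rfl (Nat.le_add_right n n') (le_refl b) x
  have h2 := polyExp_mono hK' le_rfl (Nat.le_add_left n' n) (le_refl b) x
  refine (add_le_add h1 h2).trans_eq ?_
  simp only [polyExp]; ring

theorem mul (h : IsTame J b u) (h' : IsTame J b' v) :
    IsTame J (b + b') (fun l x => u l x * v l x) := by
  obtain ⟨u₁, u₂, K, n, hK, hu⟩ := h
  obtain ⟨v₁, v₂, K', n', hK', hv⟩ := h'
  refine ⟨_, _, 4 * (K * K'), n + n', by positivity, (hu.mul hv).mono fun x => ?_⟩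
  rw [polyExp_mul]
  simp only [polyExp]
  exact le_of_eq (by ring)

theorem mul_left (h : IsTame J 0 u) (h' : IsTame J b v) : IsTame J b (fun l x => u l x * v l x) := by
  simpa using h.mul h'

theorem mono (h : IsTame J b u) (hb : b' ≤ b) : IsTame J b' u := by
  obtain ⟨u₁, u₂, K, n, hK, hu⟩ := h
  exact ⟨u₁, u₂, K, n, hK, hu.mono fun x => polyExp_mono hK le_rfl le_rfl hb x⟩

theorem comp (h : IsTame J 0 u) {S : Set ℝ} {φ φ₁ φ₂ : ℝ → ℝ} {K : ℝ} {n : ℕ} (hK : 0 ≤ K)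
    (hS : ∀ l ∈ J, ∀ x, u l x ∈ S) (hd : ∀ y ∈ S, HasDerivAt φ (φ₁ y) y)
    (hd₁ : ∀ y ∈ S, HasDerivAt φ₁ (φ₂ y) y) (hc : ContinuousOn φ₂ S)
    (hb : ∀ l ∈ J, ∀ x, |φ (u l x)| ≤ polyExp K n b x)
    (hb₁ : ∀ l ∈ J, ∀ x, |φ₁ (u l x)| ≤ polyExp K n b x)
    (hb₂ : ∀ l ∈ J, ∀ x, |φ₂ (u l x)| ≤ polyExp K n b x) :
    IsTame J b (fun l x => φ (u l x)) := by
  obtain ⟨u₁, u₂, K', n', hK', hu⟩ := h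
  refine ⟨_, _, K * (1 + K') ^ 2, n + 2 * n', by positivity,
    (hu.comp hS hd hd₁ hc hb hb₁ hb₂).mono fun x => ?_⟩
  have h1 : 1 + polyExp K' n' 0 x ≤ (1 + K') * (1 + |x|) ^ n' := by
    have : 1 ≤ (1 + |x|) ^ n' := one_le_pow₀ (by linarith [abs_nonneg x])
    simp only [polyExp, zero_mul, neg_zero, Real.exp_zero, mul_one]
    linarith
  have h0 : 0 ≤ polyExp K' n' 0 x := by unfold polyExp; positivity
  have h2 : 0 ≤ polyExp K n b x := by unfold polyExp; positivity
  calc _ ≤ polyExp K n b x * ((1 + K') * (1 + |x|) ^ n') ^ 2 := by gcongr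
    _ = _ := by simp only [polyExp]; ring

theorem comp_bounded (h : IsTame J 0 u) {S : Set ℝ} {φ φ₁ φ₂ : ℝ → ℝ} {K : ℝ}
    (hS : ∀ l ∈ J, ∀ x, u l x ∈ S) (hd : ∀ y ∈ S, HasDerivAt φ (φ₁ y) y)
    (hd₁ : ∀ y ∈ S, HasDerivAt φ₁ (φ₂ y) y) (hc : ContinuousOn φ₂ S)
    (hb : ∀ l ∈ J, ∀ x, |φ (u l x)| ≤ K ∧ |φ₁ (u l x)| ≤ K ∧ |φ₂ (u l x)| ≤ K) :
    IsTame J 0 (fun l x => φ (u l x)) := by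
  have hp : ∀ x, K ≤ polyExp |K| 0 0 x := fun x => by
    simpa [polyExp] using le_abs_self K
  exact h.comp (abs_nonneg K) hS hd hd₁ hc (fun l hl x => (hb l hl x).1.trans (hp x))
    (fun l hl x => (hb l hl x).2.1.trans (hp x)) (fun l hl x => (hb l hl x).2.2.trans (hp x))

theorem contDiffOn_toL2 (h : IsTame J b u) (hb : 0 < b) (hJ : IsOpen J) (hJc : Convex ℝ J) :
    ContDiffOn ℝ 2 (fun l => toL2 (u l)) J := by
  obtain ⟨u₁, u₂, K, n, hK, hu⟩ := h
  exact hu.contDiffOn_toL2 hJ hJc (memLp_polyExp hK hb n)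

theorem memLp (h : IsTame J b u) (hb : 0 < b) {l : ℝ} (hl : l ∈ J) :
    MemLp (u l) 2 (volume : Measure ℝ) := by
  obtain ⟨u₁, u₂, K, n, hK, hu⟩ := h
  exact (memLp_polyExp hK hb n).mono' (hu.continuous l hl).aestronglyMeasurable
    (ae_of_all _ (hu.bound l hl))

-- Differentiability on the closed interval provides, by compactness, the bounds on the open one.
theorem const {l₁ l₂ : ℝ} {g g₁ g₂ : ℝ → ℝ} (hd : ∀ l ∈ Icc l₁ l₂, HasDerivAt g (g₁ l) l)
    (hd₁ : ∀ l ∈ Icc l₁ l₂, HasDerivAt g₁ (g₂ l) l) (hc : ContinuousOn g₂ (Icc l₁ l₂)) :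
    IsTame (Ioo l₁ l₂) 0 (fun l _ => g l) := by
  have c0 : ContinuousOn g (Icc l₁ l₂) := fun l hl => (hd l hl).continuousAt.continuousWithinAt
  have c1 : ContinuousOn g₁ (Icc l₁ l₂) := fun l hl => (hd₁ l hl).continuousAt.continuousWithinAt
  obtain ⟨K₀, h0⟩ := isCompact_Icc.exists_bound_of_continuousOn c0
  obtain ⟨K₁, h1⟩ := isCompact_Icc.exists_bound_of_continuousOn c1
  obtain ⟨K₂, h2⟩ := isCompact_Icc.exists_bound_of_continuousOn hc
  have hsub : ∀ l ∈ Ioo l₁ l₂, l ∈ Icc l₁ l₂ := fun l hl => Ioo_subset_Icc_self hl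
  have hp : ∀ x, polyExp (|K₀| + |K₁| + |K₂|) 0 0 x = |K₀| + |K₁| + |K₂| := fun x => by
    simp [polyExp]
  have a0 := abs_nonneg K₀
  have a1 := abs_nonneg K₁
  have a2 := abs_nonneg K₂
  refine ⟨fun l _ => g₁ l, fun l _ => g₂ l, |K₀| + |K₁| + |K₂|, 0, by positivity,
    fun l hl _ => hd l (hsub l hl), fun l hl _ => hd₁ l (hsub l hl),
    fun _ => hc.mono Ioo_subset_Icc_self, fun _ _ => continuous_const, fun _ _ => continuous_const,
    fun _ _ => continuous_const, fun l hl x => ?_, fun l hl x => ?_, fun l hl x => ?_⟩ <;>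
    rw [hp]
  · exact (h0 l (hsub l hl)).trans (by linarith [le_abs_self K₀])
  · exact (h1 l (hsub l hl)).trans (by linarith [le_abs_self K₁])
  · exact (h2 l (hsub l hl)).trans (by linarith [le_abs_self K₂])

end IsTame

namespace IsTame

variable {J : Set ℝ} {b b' : ℝ} {u v : ℝ → ℝ → ℝ}

theorem congr (h : IsTame J b u) (hJ : IsOpen J) (huv : ∀ l ∈ J, ∀ x, v l x = u l x) :
    IsTame J b v := by
  obtain ⟨u₁, u₂, K, n, hK, hu⟩ := h
  refine ⟨u₁, u₂, K, n, hK, { hu with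
    hasDerivAt := fun l hl x => (hu.hasDerivAt l hl x).congr_of_eventuallyEq ?_
    continuous := fun l hl => ?_
    bound := fun l hl x => ?_ }⟩
  · filter_upwards [hJ.mem_nhds hl] with l' hl' using huv l' hl' x
  · rw [funext (huv l hl)]
    exact hu.continuous l hl
  · rw [huv l hl x]
    exact hu.bound l hl x

theorem comp_compact (h : IsTame J 0 u) {S : Set ℝ} {φ φ₁ φ₂ : ℝ → ℝ} (hSc : IsCompact S)
    (hS : ∀ l ∈ J, ∀ x, u l x ∈ S) (hd : ∀ y ∈ S, HasDerivAt φ (φ₁ y) y)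
    (hd₁ : ∀ y ∈ S, HasDerivAt φ₁ (φ₂ y) y) (hc : ContinuousOn φ₂ S) :
    IsTame J 0 (fun l x => φ (u l x)) := by
  have c0 : ContinuousOn φ S := fun l hl => (hd l hl).continuousAt.continuousWithinAt
  have c1 : ContinuousOn φ₁ S := fun l hl => (hd₁ l hl).continuousAt.continuousWithinAt
  obtain ⟨K₀, h0⟩ := hSc.exists_bound_of_continuousOn c0
  obtain ⟨K₁, h1⟩ := hSc.exists_bound_of_continuousOn c1
  obtain ⟨K₂, h2⟩ := hSc.exists_bound_of_continuousOn hc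
  refine h.comp_bounded (K := max K₀ (max K₁ K₂)) hS hd hd₁ hc fun l hl x => ⟨?_, ?_, ?_⟩
  · exact (h0 _ (hS l hl x)).trans (le_max_left _ _)
  · exact (h1 _ (hS l hl x)).trans ((le_max_left _ _).trans (le_max_right _ _))
  · exact (h2 _ (hS l hl x)).trans ((le_max_right _ _).trans (le_max_right _ _))

theorem inv (h : IsTame J 0 u) {k k' : ℝ} (hk : 0 < k) (hS : ∀ l ∈ J, ∀ x, u l x ∈ Icc k k') :
    IsTame J 0 (fun l x => (u l x)⁻¹) := by
  have hne : ∀ y ∈ Icc k k', y ≠ 0 := fun y hy => (hk.trans_le hy.1).ne'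
  refine h.comp_compact (φ := fun y => y⁻¹) (φ₁ := fun y => -(y ^ 2)⁻¹)
    (φ₂ := fun y => 2 * (y ^ 3)⁻¹) isCompact_Icc hS (fun y hy => hasDerivAt_inv (hne y hy))
    (fun y hy => ?_) ?_
  · have h0 := hne y hy
    refine (((hasDerivAt_pow 2 y).inv (pow_ne_zero 2 h0)).neg).congr_deriv ?_
    field_simp
    simp [mul_comm]
  · exact continuousOn_const.mul ((continuousOn_pow 3).inv₀ fun y hy => pow_ne_zero 3 (hne y hy))

theorem const_mul {l₁ l₂ : ℝ} (h : IsTame (Ioo l₁ l₂) b u) (r : ℝ) :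
    IsTame (Ioo l₁ l₂) b (fun l x => r * u l x) :=
  (IsTame.const (l₁ := l₁) (l₂ := l₂) (g := fun _ => r) (g₁ := fun _ => 0) (g₂ := fun _ => 0)
    (fun l _ => hasDerivAt_const l r) (fun l _ => hasDerivAt_const l 0)
    continuousOn_const).mul_left h

end IsTame

/-! ### The family of profiles -/

namespace LogProfile

variable {W : Well} (D : LogProfile W)

/-- The logarithmic amplitude `l + ℓ(θ)`. -/
def lev (l x : ℝ) : ℝ := l + logSech (D.theta l x)

/-- The profile. -/
def eta (l x : ℝ) : ℝ := Real.exp (D.Y (D.lev l x))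

/-- The first derivative of the profile. -/
def etaX (l x : ℝ) : ℝ := -Real.exp (l / 2) * Real.tanh (D.theta l x) * D.eta l x

/-- The second derivative of the profile. -/
def etaXX (l x : ℝ) : ℝ := W.V₁ (D.eta l x) / 2 - (W.s ^ 2 - Real.exp l) * D.eta l x

/-- The third derivative of the profile. -/
def etaXXX (l x : ℝ) : ℝ := (W.V₂ (D.eta l x) / 2 - (W.s ^ 2 - Real.exp l)) * D.etaX l x

/-- The function `η / (1 - η)`. -/
def vel (l x : ℝ) : ℝ := D.eta l x / (1 - D.eta l x)

/-- The first derivative of `η / (1 - η)`. -/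
def velX (l x : ℝ) : ℝ := D.etaX l x / (1 - D.eta l x) ^ 2

/-- The second derivative of `η / (1 - η)`. -/
def velXX (l x : ℝ) : ℝ :=
  D.etaXX l x / (1 - D.eta l x) ^ 2 + 2 * D.etaX l x ^ 2 / (1 - D.eta l x) ^ 3

variable {l : ℝ}

theorem lev_lt (hl : l < D.t₀) (x : ℝ) : D.lev l x < D.t₀ := D.add_logSech_lt hl _

theorem exp_lev (l x : ℝ) :
    Real.exp (D.lev l x) = Real.exp l * (1 - Real.tanh (D.theta l x) ^ 2) := by
  rw [lev, Real.exp_add, exp_logSech]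

theorem eta_pos (l x : ℝ) : 0 < D.eta l x := Real.exp_pos _

theorem eta_lt (hl : l < D.t₀) (x : ℝ) : D.eta l x < D.δ := D.exp_Y_lt _ (D.lev_lt hl x)

theorem eta_lt_half (hl : l < D.t₀) (x : ℝ) : D.eta l x < 1 / 2 := (D.eta_lt hl x).trans D.δ_lt

theorem eta_lt_one (hl : l < D.t₀) (x : ℝ) : D.eta l x < 1 :=
  (D.eta_lt_half hl x).trans (by norm_num)

theorem eta_zero (hl : l < D.t₀) : D.eta l 0 = Real.exp (D.Y l) := by
  simp [eta, lev, D.theta_zero hl]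

theorem etaX_zero (hl : l < D.t₀) : D.etaX l 0 = 0 := by
  simp [etaX, D.theta_zero hl]

/-- This exhibits η as a factor of V₁(η), so that the second derivative of the profile visibly
decays like η, with coefficients depending only on the level and Y₁. -/
theorem V₁_eta (hl : l < D.t₀) (x : ℝ) : W.V₁ (D.eta l x) = D.eta l x * (2 * W.s ^ 2
    - 2 * Real.exp (D.lev l x) - Real.exp (D.lev l x) * (D.Y₁ (D.lev l x))⁻¹) := by
  have h := D.eq_V₁ _ (D.lev_lt hl x)
  have hY : D.Y₁ (D.lev l x) ≠ 0 := (D.Y₁_pos hl _).ne'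
  rw [← eq_div_iff hY] at h
  change 2 * W.s ^ 2 * D.eta l x - W.V₁ (D.eta l x) - 2 * Real.exp (D.lev l x) * D.eta l x
    = Real.exp (D.lev l x) * D.eta l x / _ at h
  rw [div_eq_mul_inv] at h
  linarith

/-- By construction g(η) = e^l sech²θ, so e^l - g(η) = e^l tanh²θ is a perfect square. -/
theorem first_integral (hl : l < D.t₀) (x : ℝ) :
    D.etaX l x ^ 2 = W.V₀ (D.eta l x) - (W.s ^ 2 - Real.exp l) * D.eta l x ^ 2 := by
  have h := D.eq_V₀ _ (D.lev_lt hl x)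
  change W.s ^ 2 * D.eta l x ^ 2 - W.V₀ (D.eta l x)
    = D.eta l x ^ 2 * Real.exp (D.lev l x) at h
  rw [D.exp_lev] at h
  have h2 : Real.exp (l / 2) ^ 2 = Real.exp l := by rw [← Real.exp_nat_mul]; congr 1; push_cast; ring
  rw [etaX, mul_pow, mul_pow, neg_sq, h2]
  linarith

theorem hasDerivAt_eta (hl : l < D.t₀) (x : ℝ) : HasDerivAt (D.eta l) (D.etaX l x) x := by
  have h1 := ((hasDerivAt_logSech _).comp x (D.hasDerivAt_theta_right hl x)).const_add l
  have h2 := ((D.hasDerivAt₀ _ (D.lev_lt hl x)).comp x h1).exp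
  refine h2.congr_deriv ?_
  have hY : D.Y₁ (D.lev l x) ≠ 0 := (D.Y₁_pos hl _).ne'
  change Real.exp (D.Y (D.lev l x)) * (D.Y₁ (D.lev l x) * (-2 * Real.tanh (D.theta l x) *
    (Real.exp (l / 2) / 2 / D.Y₁ (D.lev l x)))) = _
  rw [etaX, eta]
  field_simp

theorem hasDerivAt_etaX (hl : l < D.t₀) (x : ℝ) : HasDerivAt (D.etaX l) (D.etaXX l x) x := by
  have h1 := ((hasDerivAt_tanh' _).comp x (D.hasDerivAt_theta_right hl x)).const_mul
    (-Real.exp (l / 2))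
  refine (h1.mul (D.hasDerivAt_eta hl x)).congr_deriv ?_
  have hY : D.Y₁ (D.lev l x) ≠ 0 := (D.Y₁_pos hl _).ne'
  have h2 : Real.exp l = Real.exp (l / 2) ^ 2 := by rw [← Real.exp_nat_mul]; congr 1; push_cast; ring
  rw [etaXX, D.V₁_eta hl, D.exp_lev, etaX, h2]
  change -Real.exp (l / 2) * ((1 - Real.tanh (D.theta l x) ^ 2) *
    (Real.exp (l / 2) / 2 / D.Y₁ (D.lev l x))) * _
    + -Real.exp (l / 2) * Real.tanh (D.theta l x) * _ = _
  field_simp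
  ring

theorem hasDerivAt_etaXX (hl : l < D.t₀) (x : ℝ) : HasDerivAt (D.etaXX l) (D.etaXXX l x) x := by
  have h0 := D.hasDerivAt_eta hl x
  have h1 := (W.hasDerivAt₁ _ (D.eta_lt_one hl x)).comp x h0
  refine ((h1.div_const 2).sub (h0.const_mul (W.s ^ 2 - Real.exp l))).congr_deriv ?_
  rw [etaXXX]; ring

theorem one_sub_eta_pos (hl : l < D.t₀) (x : ℝ) : 0 < 1 - D.eta l x :=
  sub_pos.2 (D.eta_lt_one hl x)

theorem hasDerivAt_vel (hl : l < D.t₀) (x : ℝ) : HasDerivAt (D.vel l) (D.velX l x) x := by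
  have h0 := D.hasDerivAt_eta hl x
  have hp := (D.one_sub_eta_pos hl x).ne'
  refine (h0.div (h0.const_sub 1) hp).congr_deriv ?_
  rw [velX]; ring

theorem hasDerivAt_velX (hl : l < D.t₀) (x : ℝ) : HasDerivAt (D.velX l) (D.velXX l x) x := by
  have h0 := D.hasDerivAt_eta hl x
  have hp := (D.one_sub_eta_pos hl x).ne'
  refine ((D.hasDerivAt_etaX hl x).div ((h0.const_sub 1).pow 2) (pow_ne_zero 2 hp)).congr_deriv ?_
  simp only [Pi.pow_apply]
  rw [velXX]
  push_cast
  field_simp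
  ring

/-! ### Decay and parameter regularity of the profiles -/

section Tame

variable {l₁ l₂ : ℝ}

theorem isTame_theta (h2 : l₂ < D.t₀) (h2' : l₂ ≤ 0) : IsTame (Ioo l₁ l₂) 0 D.theta := by
  have ht : ∀ l ∈ Ioo l₁ l₂, l < D.t₀ ∧ l ≤ 0 := fun l hl =>
    ⟨hl.2.trans h2, (hl.2.trans_le h2').le⟩
  have hp : ∀ x, |x| ≤ polyExp 200 2 0 x := fun x => by
    simp only [polyExp, zero_mul, neg_zero, Real.exp_zero, mul_one]
    nlinarith [abs_nonneg x]
  refine ⟨D.theta₁, D.theta₂, 200, 2, by norm_num, fun l hl x => D.hasDerivAt_theta (ht l hl).1 x,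
    fun l hl x => D.hasDerivAt_theta₁ (ht l hl).1 x,
    fun x => (D.continuousOn_theta₂ x).mono fun l hl => (ht l hl).1,
    fun l hl => D.continuous_theta (ht l hl).1, fun l hl => D.continuous_theta₁ (ht l hl).1,
    fun l hl => D.continuous_theta₂ (ht l hl).1,
    fun l hl x => (D.abs_theta_le (ht l hl).1 (ht l hl).2 x).trans (hp x),
    fun l hl x => (D.abs_theta₁_le (ht l hl).1 (ht l hl).2 x).trans (hp x),
    fun l hl x => (D.abs_theta₂_le (ht l hl).1 (ht l hl).2 x).trans_eq ?_⟩
  simp [polyExp]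

theorem isTame_tanh (h2 : l₂ < D.t₀) (h2' : l₂ ≤ 0) :
    IsTame (Ioo l₁ l₂) 0 (fun l x => Real.tanh (D.theta l x)) := by
  refine (D.isTame_theta h2 h2').comp_bounded (S := univ) (K := 2)
    (φ₁ := fun y => 1 - Real.tanh y ^ 2)
    (φ₂ := fun y => -(2 * Real.tanh y * (1 - Real.tanh y ^ 2))) (fun _ _ _ => mem_univ _)
    (fun y _ => hasDerivAt_tanh' y) (fun y _ => ?_) ?_ ?_
  · refine (((hasDerivAt_tanh' y).pow 2).const_sub 1).congr_deriv ?_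
    simp
  · have := continuous_tanh'
    exact Continuous.continuousOn (by fun_prop)
  · intro l hl x
    have h := abs_le.1 (abs_tanh_le (D.theta l x))
    set T := Real.tanh (D.theta l x)
    have h1 : 0 ≤ 1 - T ^ 2 := by nlinarith
    have h3 : |1 - T ^ 2| ≤ 1 := by rw [abs_of_nonneg h1]; nlinarith [sq_nonneg T]
    refine ⟨(abs_le.2 h).trans (by norm_num), h3.trans (by norm_num), ?_⟩
    rw [abs_neg, abs_mul, abs_mul, abs_two]
    have := mul_le_mul (abs_le.2 h) h3 (abs_nonneg _) zero_le_one
    linarith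

theorem isTame_lev (h2 : l₂ < D.t₀) (h2' : l₂ ≤ 0) : IsTame (Ioo l₁ l₂) 0 D.lev := by
  have hc : IsTame (Ioo l₁ l₂) 0 (fun l _ => l) :=
    IsTame.const (fun l _ => hasDerivAt_id l) (fun l _ => hasDerivAt_const l 1) continuousOn_const
  have ht : ∀ l ∈ Ioo l₁ l₂, l < D.t₀ ∧ l ≤ 0 := fun l hl =>
    ⟨hl.2.trans h2, (hl.2.trans_le h2').le⟩
  have hp : ∀ x, polyExp 2 1 0 x = 2 * (1 + |x|) := fun x => by simp [polyExp]
  refine hc.add ((D.isTame_theta h2 h2').comp (S := univ) (K := 2) (n := 1) (φ := logSech)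
    (φ₁ := fun y => -2 * Real.tanh y) (φ₂ := fun y => -2 * (1 - Real.tanh y ^ 2)) (by norm_num)
    (fun _ _ _ => mem_univ _) (fun y _ => hasDerivAt_logSech y)
    (fun y _ => (hasDerivAt_tanh' y).const_mul (-2)) ?_ ?_ ?_ ?_)
  · have := continuous_tanh'
    exact Continuous.continuousOn (by fun_prop)
  · intro l hl x
    rw [hp]
    linarith [abs_logSech_le (D.theta l x), D.abs_theta_le (ht l hl).1 (ht l hl).2 x]
  · intro l hl x
    rw [hp, abs_mul, abs_neg, abs_two]
    linarith [abs_tanh_le (D.theta l x), abs_nonneg x]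
  · intro l hl x
    rw [hp, abs_mul, abs_neg, abs_two]
    have h := abs_le.1 (abs_tanh_le (D.theta l x))
    have h1 : 0 ≤ 1 - Real.tanh (D.theta l x) ^ 2 := by nlinarith
    rw [abs_of_nonneg h1]
    nlinarith [sq_nonneg (Real.tanh (D.theta l x)), abs_nonneg x]

/-- Y has slope at least 10/11, the level lies below l₂ + 2 log 2 - 2|θ|, and |θ| ≥ (9/20)
e^{l₁/2}|x|. The rate is (10/11) · 2 · (9/20) = 9/11, and the log 2 term contributes 20/11. -/
theorem eta_le (h2 : l₂ < D.t₀) {l : ℝ} (hl : l ∈ Ioo l₁ l₂) (x : ℝ) :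
    D.eta l x ≤ Real.exp (D.Y l₂ + 20 / 11 * Real.log 2)
      * Real.exp (-(9 / 11 * Real.exp (l₁ / 2) * |x|)) := by
  have hlt := hl.2.trans h2
  have hle : D.lev l x ≤ l := by
    have := logSech_nonpos (D.theta l x)
    rw [lev]; linarith
  have h3 := mul_sub_le_of_deriv_ge (convex_Iio D.t₀) D.hasDerivAt₀ D.le_Y₁ (D.lev_lt hlt x) h2
    (hle.trans hl.2.le)
  have h4 := logSech_le (D.theta l x)
  have h5 := D.le_abs_theta hlt x
  have h6 : Real.exp (l₁ / 2) ≤ Real.exp (l / 2) := Real.exp_le_exp.2 (by linarith [hl.1])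
  have h7 := mul_le_mul_of_nonneg_right h6 (abs_nonneg x)
  rw [eta, ← Real.exp_add, Real.exp_le_exp]
  have h8 : D.lev l x ≤ l₂ + (2 * Real.log 2 - 2 * |D.theta l x|) := by
    rw [lev]; linarith [hl.2]
  linarith

theorem isTame_eta (h2 : l₂ < D.t₀) (h2' : l₂ ≤ 0) :
    IsTame (Ioo l₁ l₂) (9 / 11 * Real.exp (l₁ / 2)) D.eta := by
  set C := Real.exp (D.Y l₂ + 20 / 11 * Real.log 2)
  have hC : 0 < C := Real.exp_pos _
  have ht : ∀ l ∈ Ioo l₁ l₂, l < D.t₀ := fun l hl => hl.2.trans h2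
  -- The factors used for k are 1, Y₁ and Y₁² + Y₂, at most (10/9)² + 1/2 < 2 in absolute value.
  have hp : ∀ k : ℝ, ∀ l ∈ Ioo l₁ l₂, ∀ x, |k| ≤ 2 →
      |Real.exp (D.Y (D.lev l x)) * k| ≤ polyExp (2 * C) 0 (9 / 11 * Real.exp (l₁ / 2)) x := by
    intro k l hl x hk
    have h := D.eta_le h2 hl x
    rw [eta] at h
    rw [abs_mul, abs_of_pos (Real.exp_pos _), polyExp, pow_zero, mul_one, mul_comm 2, mul_assoc,
      mul_left_comm, mul_comm]
    exact mul_le_mul hk h (Real.exp_pos _).le zero_le_two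
  refine (D.isTame_lev h2 h2').comp (S := Iio D.t₀) (K := 2 * C) (n := 0)
    (φ := fun t => Real.exp (D.Y t)) (φ₁ := fun t => Real.exp (D.Y t) * D.Y₁ t)
    (φ₂ := fun t => Real.exp (D.Y t) * (D.Y₁ t * D.Y₁ t + D.Y₂ t)) (by positivity)
    (fun l hl x => D.lev_lt (ht l hl) x) (fun t h => (D.hasDerivAt₀ t h).exp) (fun t h => ?_) ?_ ?_
    ?_ ?_
  · refine ((D.hasDerivAt₀ t h).exp.mul (D.hasDerivAt₁ t h)).congr_deriv ?_
    ring
  · have c0 : ContinuousOn D.Y (Iio D.t₀) := fun t ht =>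
      (D.hasDerivAt₀ t ht).continuousAt.continuousWithinAt
    have c1 := D.continuousOn_Y₁
    have c2 := D.continuousOn_Y₂
    fun_prop
  · intro l hl x
    simpa using hp 1 l hl x (by norm_num)
  · intro l hl x
    refine hp _ l hl x ?_
    have h1 := D.le_Y₁ _ (D.lev_lt (ht l hl) x)
    have h3 := D.Y₁_le _ (D.lev_lt (ht l hl) x)
    rw [abs_le]; constructor <;> linarith
  · intro l hl x
    refine hp _ l hl x ?_
    have h1 := D.le_Y₁ _ (D.lev_lt (ht l hl) x)
    have h3 := D.Y₁_le _ (D.lev_lt (ht l hl) x)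
    have h4 := abs_le.1 (D.abs_Y₂_le _ (D.lev_lt (ht l hl) x))
    rw [abs_le]; constructor <;> nlinarith

theorem isTame_eta_zero (h2 : l₂ < D.t₀) (h2' : l₂ ≤ 0) : IsTame (Ioo l₁ l₂) 0 D.eta :=
  (D.isTame_eta h2 h2').mono (by positivity)

theorem isTame_exp : IsTame (Ioo l₁ l₂) 0 (fun l _ => Real.exp l) :=
  IsTame.const (fun l _ => Real.hasDerivAt_exp l) (fun l _ => Real.hasDerivAt_exp l)
    Real.continuous_exp.continuousOn

theorem isTame_exp_half : IsTame (Ioo l₁ l₂) 0 (fun l _ => Real.exp (l / 2)) :=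
  IsTame.const (fun l _ => hasDerivAt_exp_half l)
    (fun l _ => (hasDerivAt_exp_half l).div_const 2) (by fun_prop)

theorem isTame_one_const (r : ℝ) : IsTame (Ioo l₁ l₂) 0 (fun _ _ => r) :=
  IsTame.const (g := fun _ => r) (g₁ := fun _ => 0) (g₂ := fun _ => 0)
    (fun l _ => hasDerivAt_const l r) (fun l _ => hasDerivAt_const l 0) continuousOn_const

theorem isTame_etaX (h2 : l₂ < D.t₀) (h2' : l₂ ≤ 0) :
    IsTame (Ioo l₁ l₂) (9 / 11 * Real.exp (l₁ / 2)) D.etaX := by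
  refine ((((isTame_exp_half).const_mul (-1)).mul_left (D.isTame_tanh h2 h2')).mul_left
    (D.isTame_eta h2 h2')).congr isOpen_Ioo fun l hl x => ?_
  rw [etaX]; ring

theorem isTame_etaXX (h2 : l₂ < D.t₀) (h2' : l₂ ≤ 0) :
    IsTame (Ioo l₁ l₂) (9 / 11 * Real.exp (l₁ / 2)) D.etaXX := by
  have ht : ∀ l ∈ Ioo l₁ l₂, l < D.t₀ := fun l hl => hl.2.trans h2
  have hm := D.isTame_lev h2 h2' (l₁ := l₁)
  have he : IsTame (Ioo l₁ l₂) 0 (fun l x => Real.exp (D.lev l x)) := by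
    refine hm.comp_bounded (S := univ) (K := 1) (fun _ _ _ => mem_univ _)
      (fun y _ => Real.hasDerivAt_exp y) (fun y _ => Real.hasDerivAt_exp y)
      Real.continuous_exp.continuousOn fun l hl x => ?_
    have : |Real.exp (D.lev l x)| ≤ 1 := by
      rw [abs_of_pos (Real.exp_pos _), Real.exp_le_one_iff, lev]
      linarith [logSech_nonpos (D.theta l x), hl.2]
    exact ⟨this, this, this⟩
  have hY : IsTame (Ioo l₁ l₂) 0 (fun l x => D.Y₁ (D.lev l x)) := by
    refine hm.comp_bounded (S := Iio D.t₀) (K := 100) (fun l hl x => D.lev_lt (ht l hl) x)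
      D.hasDerivAt₁ D.hasDerivAt₂ D.continuousOn₃ fun l hl x => ?_
    have hlt := D.lev_lt (ht l hl) x
    refine ⟨?_, (D.abs_Y₂_le _ hlt).trans (by norm_num), D.abs_Y₃_le _ hlt⟩
    rw [abs_le]
    constructor <;> linarith [D.le_Y₁ _ hlt, D.Y₁_le _ hlt]
  have hYi := hY.inv (k := 10 / 11) (k' := 10 / 9) (by norm_num) fun l hl x =>
    ⟨D.le_Y₁ _ (D.lev_lt (ht l hl) x), D.Y₁_le _ (D.lev_lt (ht l hl) x)⟩
  have hsum := (isTame_exp (l₁ := l₁) (l₂ := l₂)).add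
    ((he.const_mul (-1)).add ((he.mul_left hYi).const_mul (-(1 / 2))))
  refine (hsum.mul_left (D.isTame_eta h2 h2')).congr isOpen_Ioo fun l hl x => ?_
  rw [etaXX, D.V₁_eta (ht l hl)]
  ring

theorem isTame_etaXXX (h2 : l₂ < D.t₀) (h2' : l₂ ≤ 0) :
    IsTame (Ioo l₁ l₂) (9 / 11 * Real.exp (l₁ / 2)) D.etaXXX := by
  have ht : ∀ l ∈ Ioo l₁ l₂, l < D.t₀ := fun l hl => hl.2.trans h2
  have hlt : ∀ y ∈ Icc (0 : ℝ) (1 / 2), y < 1 := fun y hy => hy.2.trans_lt (by norm_num)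
  have hV : IsTame (Ioo l₁ l₂) 0 (fun l x => W.V₂ (D.eta l x)) :=
    (D.isTame_eta_zero h2 h2').comp_compact (S := Icc 0 (1 / 2)) isCompact_Icc
      (fun l hl x => ⟨(D.eta_pos l x).le, (D.eta_lt_half (ht l hl) x).le⟩)
      (fun y hy => W.hasDerivAt₂ y (hlt y hy)) (fun y hy => W.hasDerivAt₃ y (hlt y hy))
      (W.continuousOn₄.mono hlt)
  refine ((((hV.const_mul (1 / 2)).add (isTame_one_const (-W.s ^ 2))).add isTame_exp).mul_left
    (D.isTame_etaX h2 h2')).congr isOpen_Ioo fun l hl x => ?_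
  rw [etaXXX]; ring

theorem isTame_inv_one_sub (h2 : l₂ < D.t₀) (h2' : l₂ ≤ 0) :
    IsTame (Ioo l₁ l₂) 0 (fun l x => (1 + -1 * D.eta l x)⁻¹) := by
  refine ((isTame_one_const 1).add ((D.isTame_eta_zero h2 h2').const_mul (-1))).inv
    (k := 1 / 2) (k' := 1) (by norm_num) fun l hl x => ?_
  have h1 := D.eta_pos l x
  have h3 := D.eta_lt_half (hl.2.trans h2) x
  constructor <;> linarith

theorem isTame_vel (h2 : l₂ < D.t₀) (h2' : l₂ ≤ 0) :
    IsTame (Ioo l₁ l₂) (9 / 11 * Real.exp (l₁ / 2)) D.vel := by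
  refine ((D.isTame_inv_one_sub h2 h2').mul_left (D.isTame_eta h2 h2')).congr isOpen_Ioo
    fun l hl x => ?_
  rw [vel, div_eq_inv_mul, neg_one_mul, ← sub_eq_add_neg]

theorem isTame_velX (h2 : l₂ < D.t₀) (h2' : l₂ ≤ 0) :
    IsTame (Ioo l₁ l₂) (9 / 11 * Real.exp (l₁ / 2)) D.velX := by
  have h := D.isTame_inv_one_sub h2 h2' (l₁ := l₁)
  refine ((h.mul_left h).mul_left (D.isTame_etaX h2 h2')).congr isOpen_Ioo fun l hl x => ?_
  rw [velX, div_eq_inv_mul, neg_one_mul, ← sub_eq_add_neg, sq, mul_inv]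

theorem isTame_velXX (h2 : l₂ < D.t₀) (h2' : l₂ ≤ 0) :
    IsTame (Ioo l₁ l₂) (9 / 11 * Real.exp (l₁ / 2)) D.velXX := by
  have h := D.isTame_inv_one_sub h2 h2' (l₁ := l₁)
  have hX := D.isTame_etaX h2 h2' (l₁ := l₁)
  refine (((h.mul_left h).mul_left (D.isTame_etaXX h2 h2')).add
    (((h.mul_left (h.mul_left h)).mul_left ((hX.mono (by positivity)).mul_left hX)).const_mul
      2)).congr isOpen_Ioo fun l hl x => ?_
  have hp := (D.one_sub_eta_pos (hl.2.trans h2) x).ne'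
  rw [velXX, neg_one_mul, ← sub_eq_add_neg]
  field_simp

end Tame

end LogProfile

/-! ### Sobolev functions from classical derivatives -/

theorem isClosed_sobolevSubmodule (k : ℕ) :
    IsClosed (sobolevSubmodule k : Set (PiLp 2 (fun _ : Fin (k + 1) => L2))) := by
  have : (sobolevSubmodule k : Set (PiLp 2 (fun _ : Fin (k + 1) => L2)))
      = ⋂ j : Fin k, (fun u : PiLp 2 (fun _ : Fin (k + 1) => L2) => (u j.castSucc, u j.succ)) ⁻¹'
        {p : L2 × L2 | HasWeakDeriv p.1 p.2} := by
    ext u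
    simp only [mem_iInter, mem_preimage, mem_ofPred_eq]
    rfl
  rw [this]
  exact isClosed_iInter fun j => isClosed_hasWeakDeriv.preimage (by fun_prop)

instance (k : ℕ) : CompleteSpace (sobolevSubmodule k) :=
  (isClosed_sobolevSubmodule k).completeSpace_coe

/-- The projection of `(g_0, …, g_k)` on the tuples of successive derivatives. -/
def sobolevOf {k : ℕ} (g : Fin (k + 1) → ℝ → ℝ) : H k :=
  (sobolevSubmodule k).orthogonalProjectionOnto (WithLp.toLp 2 fun j => toL2 (g j))

/-- A tuple of genuine successive derivatives already lies in the subspace, so the projection fixes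
it. Defining the element by a continuous linear projection lets C² dependence on a parameter be
checked entry by entry in L². -/
theorem der_sobolevOf {k : ℕ} {g : Fin (k + 1) → ℝ → ℝ}
    (hg : ∀ j, MemLp (g j) 2 (volume : Measure ℝ))
    (hd : ∀ j : Fin k, ∀ x, HasDerivAt (g j.castSucc) (g j.succ x) x) (j : Fin (k + 1)) :
    (sobolevOf g).der j = toL2 (g j) := by
  have hmem : (WithLp.toLp 2 fun j => toL2 (g j)) ∈ sobolevSubmodule k := fun j =>
    hasWeakDeriv_of_hasDerivAt (coeFn_toL2 (hg j.castSucc)) (coeFn_toL2 (hg j.succ)) (hd j)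
  rw [H.der, sobolevOf, Submodule.orthogonalProjectionOnto_mem_subspace_eq_self
    (⟨_, hmem⟩ : sobolevSubmodule k)]

theorem contDiffOn_sobolevOf {k : ℕ} {g : Fin (k + 1) → ℝ → ℝ → ℝ} {J : Set ℝ}
    (h : ∀ j, ContDiffOn ℝ 2 (fun l => toL2 (g j l)) J) :
    ContDiffOn ℝ 2 (fun l => sobolevOf fun j => g j l) J :=
  (sobolevSubmodule k).orthogonalProjectionOnto.contDiff.comp_contDiffOn
    ((contDiffOn_piLp 2).2 h)

/-! ### The branch -/

namespace LogProfile

variable {W : Well} (D : LogProfile W)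

/-- Upper end of the parameters. -/
def top : ℝ := min D.t₀ 0

/-- The decay rate degenerates as l₁ → -∞, but C² regularity and membership in L² need only a small
interval around each l. -/
theorem IsTame_contDiffOn {u : ℝ → ℝ → ℝ}
    (hu : ∀ l₁ l₂, l₂ < D.t₀ → l₂ ≤ 0 → IsTame (Ioo l₁ l₂) (9 / 11 * Real.exp (l₁ / 2)) u) :
    ContDiffOn ℝ 2 (fun l => toL2 (u l)) (Iio D.top) ∧
      ∀ l < D.top, MemLp (u l) 2 (volume : Measure ℝ) := by
  have key : ∀ l < D.top, ∃ l₁ l₂, l ∈ Ioo l₁ l₂ ∧ l₂ < D.t₀ ∧ l₂ ≤ 0 := by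
    intro l hl
    obtain ⟨l₂, h1, h2⟩ := exists_between hl
    exact ⟨l - 1, l₂, ⟨by linarith, h1⟩, h2.trans_le (min_le_left _ _),
      (h2.trans_le (min_le_right _ _)).le⟩
  constructor
  · intro l hl
    obtain ⟨l₁, l₂, hm, h1, h2⟩ := key l hl
    exact ((((hu l₁ l₂ h1 h2).contDiffOn_toL2 (by positivity) isOpen_Ioo (convex_Ioo _ _)) l
      hm).contDiffAt (isOpen_Ioo.mem_nhds hm)).contDiffWithinAt
  · intro l hl
    obtain ⟨l₁, l₂, hm, h1, h2⟩ := key l hl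
    exact (hu l₁ l₂ h1 h2).memLp (by positivity) hm

/-- The derivatives of `η`. -/
def etaTuple : Fin 4 → ℝ → ℝ → ℝ := ![D.eta, D.etaX, D.etaXX, D.etaXXX]

/-- The derivatives of `η / (1 - η)`. -/
def velTuple : Fin 3 → ℝ → ℝ → ℝ := ![D.vel, D.velX, D.velXX]

theorem etaTuple_spec (j : Fin 4) :
    ContDiffOn ℝ 2 (fun l => toL2 (D.etaTuple j l)) (Iio D.top) ∧
      ∀ l < D.top, MemLp (D.etaTuple j l) 2 (volume : Measure ℝ) := by
  fin_cases j
  · exact D.IsTame_contDiffOn fun _ _ h h' => D.isTame_eta h h'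
  · exact D.IsTame_contDiffOn fun _ _ h h' => D.isTame_etaX h h'
  · exact D.IsTame_contDiffOn fun _ _ h h' => D.isTame_etaXX h h'
  · exact D.IsTame_contDiffOn fun _ _ h h' => D.isTame_etaXXX h h'

theorem velTuple_spec (j : Fin 3) :
    ContDiffOn ℝ 2 (fun l => toL2 (D.velTuple j l)) (Iio D.top) ∧
      ∀ l < D.top, MemLp (D.velTuple j l) 2 (volume : Measure ℝ) := by
  fin_cases j
  · exact D.IsTame_contDiffOn fun _ _ h h' => D.isTame_vel h h'
  · exact D.IsTame_contDiffOn fun _ _ h h' => D.isTame_velX h h'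
  · exact D.IsTame_contDiffOn fun _ _ h h' => D.isTame_velXX h h'

theorem top_le : D.top ≤ D.t₀ := min_le_left _ _

theorem der_etaTuple {l : ℝ} (hl : l < D.top) (j : Fin 4) :
    (sobolevOf (k := 3) fun j => D.etaTuple j l).der j = toL2 (D.etaTuple j l) := by
  refine der_sobolevOf (fun j => (D.etaTuple_spec j).2 l hl) (fun j x => ?_) j
  have hl' := hl.trans_le D.top_le
  fin_cases j
  · exact D.hasDerivAt_eta hl' x
  · exact D.hasDerivAt_etaX hl' x
  · exact D.hasDerivAt_etaXX hl' x

theorem der_velTuple {l : ℝ} (hl : l < D.top) (j : Fin 3) :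
    (sobolevOf (k := 2) fun j => D.velTuple j l).der j = toL2 (D.velTuple j l) := by
  refine der_sobolevOf (fun j => (D.velTuple_spec j).2 l hl) (fun j x => ?_) j
  have hl' := hl.trans_le D.top_le
  fin_cases j
  · exact D.hasDerivAt_vel hl' x
  · exact D.hasDerivAt_velX hl' x

/-- The parameter `log(s² - c²)`. -/
def par (_D : LogProfile W) (c : ℝ) : ℝ := Real.log (W.s ^ 2 - c ^ 2)

/-- The branch of solitons. -/
def branch (c : ℝ) : X 2 :=
  WithLp.toLp 2 (sobolevOf (k := 3) fun j => D.etaTuple j (D.par c),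
    (c / 2) • sobolevOf (k := 2) fun j => D.velTuple j (D.par c))

theorem contDiffOn_branch {I : Set ℝ} (h0 : ∀ c ∈ I, W.s ^ 2 - c ^ 2 ≠ 0)
    (hI : ∀ c ∈ I, D.par c < D.top) : ContDiffOn ℝ 2 D.branch I := by
  have hp : ContDiffOn ℝ 2 D.par I :=
    (contDiffOn_const.sub (contDiffOn_id.pow 2)).log h0
  have h1 := (contDiffOn_sobolevOf (k := 3) fun j => (D.etaTuple_spec j).1).comp hp hI
  have h2 := (contDiffOn_sobolevOf (k := 2) fun j => (D.velTuple_spec j).1).comp hp hI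
  have h3 : ContDiffOn ℝ 2 (fun c : ℝ => c / 2) I := contDiffOn_id.div_const 2
  exact (WithLp.prodContinuousLinearEquiv 2 ℝ (H 3) (H 2)).symm.contDiff.comp_contDiffOn
    (h1.prodMk (h3.smul h2))

theorem eta_branch {c : ℝ} (hc : D.par c < D.top) :
    (D.branch c).eta =ᵐ[volume] D.eta (D.par c) := by
  have h : (D.branch c).fst.der 0 = toL2 (D.eta (D.par c)) := D.der_etaTuple hc 0
  rw [X.eta, h]
  exact coeFn_toL2 ((D.etaTuple_spec 0).2 _ hc)

theorem vel_branch {c : ℝ} (hc : D.par c < D.top) :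
    (D.branch c).vel =ᵐ[volume] fun x => c / 2 * D.vel (D.par c) x := by
  have h : (D.branch c).snd.der 0 = (c / 2) • toL2 (D.vel (D.par c)) := by
    have : (sobolevOf (k := 2) fun j => D.velTuple j (D.par c)).der 0 = toL2 (D.vel (D.par c)) :=
      D.der_velTuple hc 0
    rw [← this]
    rfl
  rw [X.vel, h]
  have hm : MemLp (D.vel (D.par c)) 2 (volume : Measure ℝ) := (D.velTuple_spec 0).2 _ hc
  filter_upwards [Lp.coeFn_smul (c / 2) (toL2 (D.vel (D.par c))), coeFn_toL2 hm] with x h1 h2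
  rw [h1, Pi.smul_apply, h2, smul_eq_mul]

theorem branch_mem_NX {c : ℝ} (hc : D.par c < D.top) : D.branch c ∈ NX 2 := by
  refine ⟨1 / 2, by norm_num, ?_⟩
  filter_upwards [D.eta_branch hc] with x hx
  rw [hx]
  exact (D.eta_lt_half (hc.trans_le D.top_le) x).le

end LogProfile

theorem contDiff_two_of_hasDerivAt {g g₁ g₂ : ℝ → ℝ} (h : ∀ x, HasDerivAt g (g₁ x) x)
    (h₁ : ∀ x, HasDerivAt g₁ (g₂ x) x) (hc : Continuous g₂) : ContDiff ℝ 2 g := by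
  have e1 : deriv g = g₁ := funext fun x => (h x).deriv
  have e2 : deriv g₁ = g₂ := funext fun x => (h₁ x).deriv
  have t1 : (1 : WithTop ℕ∞) = 0 + 1 := by norm_num
  have t2 : (2 : WithTop ℕ∞) = 1 + 1 := by norm_num
  rw [t2, contDiff_succ_iff_deriv, e1]
  refine ⟨fun x => (h x).differentiableAt, by simp, ?_⟩
  rw [t1, contDiff_succ_iff_deriv, e2]
  exact ⟨fun x => (h₁ x).differentiableAt, by simp, contDiff_zero.2 hc⟩

/-! ### The travelling wave equation -/

section TW

variable {f : ℝ → ℝ} {W : Well}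

/-- The well `W` is the one of the nonlinearity `f`. -/
structure Well.IsFor (W : Well) (f : ℝ → ℝ) : Prop where
  s_eq : W.s = soundSpeed f
  V₀_eq : ∀ η, W.V₀ η = 4 * (1 - η) * potential f (1 - η)
  V₁_eq : ∀ η, W.V₁ η = -4 * potential f (1 - η) + 4 * (1 - η) * f (1 - η)

theorem Well.IsFor.eq_f (hW : W.IsFor f) {η : ℝ} (hη : η < 1) :
    f (1 - η) = (W.V₁ η + W.V₀ η / (1 - η)) / (4 * (1 - η)) := by
  have := (sub_pos.2 hη).ne'
  rw [hW.V₀_eq, hW.V₁_eq]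
  field_simp
  ring

/-- Once the velocity is eliminated and (η')² is replaced by the first integral, the second equation
reduces to the formula for η'' by V₁. -/
theorem LogProfile.solvesTW (hW : W.IsFor f) (D : LogProfile W) {c : ℝ}
    (h0 : 0 < W.s ^ 2 - c ^ 2) (hc : D.par c < D.t₀) :
    SolvesTW f c (D.eta (D.par c)) (fun x => c / 2 * D.vel (D.par c) x) := by
  have hexp : Real.exp (D.par c) = W.s ^ 2 - c ^ 2 := Real.exp_log h0
  have d0 := D.hasDerivAt_eta hc
  have d1 := D.hasDerivAt_etaX hc
  have d2 := D.hasDerivAt_etaXX hc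
  have v0 := D.hasDerivAt_vel hc
  have v1 := D.hasDerivAt_velX hc
  have c0 : Continuous (D.eta (D.par c)) := continuous_iff_continuousAt.2 fun x => (d0 x).continuousAt
  have c1 : Continuous (D.etaX (D.par c)) :=
    continuous_iff_continuousAt.2 fun x => (d1 x).continuousAt
  have c2 : Continuous (D.etaXX (D.par c)) :=
    continuous_iff_continuousAt.2 fun x => (d2 x).continuousAt
  have hne := fun x => (D.one_sub_eta_pos hc x).ne'
  have cv : Continuous (D.velXX (D.par c)) :=
    (c2.div ((continuous_const.sub c0).pow 2) fun x => pow_ne_zero 2 (hne x)).add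
      ((continuous_const.mul (c1.pow 2)).div ((continuous_const.sub c0).pow 3)
        fun x => pow_ne_zero 3 (hne x))
  refine ⟨contDiff_two_of_hasDerivAt d0 d1 c2,
    contDiff_const.mul (contDiff_two_of_hasDerivAt v0 v1 cv), D.eta_lt_one hc, fun x => ?_,
    fun x => ?_⟩
  · have := hne x
    simp only [LogProfile.vel]
    field_simp
  · have e1 : deriv (D.eta (D.par c)) = D.etaX (D.par c) := funext fun x => (d0 x).deriv
    have e2 : deriv (D.etaX (D.par c)) = D.etaXX (D.par c) := funext fun x => (d1 x).deriv
    have hI := D.first_integral hc x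
    rw [e1, e2, hI, hW.eq_f (D.eta_lt_one hc x)]
    simp only [LogProfile.vel, LogProfile.etaXX, hexp]
    have := hne x
    field_simp
    ring

theorem LogProfile.isTravellingWave (hW : W.IsFor f) (D : LogProfile W) {c : ℝ}
    (h0 : 0 < W.s ^ 2 - c ^ 2) (hc : D.par c < D.top) :
    IsTravellingWave f c (D.branch c).toX0 := by
  obtain ⟨m, hm, h⟩ := D.branch_mem_NX hc
  have hc' := hc.trans_le D.top_le
  refine ⟨⟨m, hm, h⟩, D.eta (D.par c), fun x => c / 2 * D.vel (D.par c) x, D.eta_branch hc,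
    D.vel_branch hc, D.solvesTW hW h0 hc', ?_⟩
  by_contra! hcon
  -- A constant positive profile would not be square integrable on the line.
  have hconst : ∀ x, D.eta (D.par c) x = D.eta (D.par c) 0 := fun x =>
    (Prod.ext_iff.1 (hcon x 0)).1
  have hint := ((D.etaTuple_spec 0).2 _ hc).integrable_sq
  have : (fun x => D.etaTuple 0 (D.par c) x ^ 2) = fun _ => D.eta (D.par c) 0 ^ 2 :=
    funext fun x => congrArg (· ^ 2) (hconst x)
  rw [this, integrable_const_iff] at hint
  rcases hint with h | h
  · exact (pow_pos (D.eta_pos _ _) 2).ne' h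
  · exact absurd h.measure_univ_lt_top (by simp)

end TW

/-! ### The momentum along the branch -/

namespace LogProfile

variable {W : Well} (D : LogProfile W)

/-- The density of the momentum with respect to the phase. -/
def dens (t : ℝ) : ℝ := Real.exp (2 * D.Y t + Real.log (D.Y₁ t) - t) * (1 - Real.exp (D.Y t))⁻¹

theorem Y₁_pos' {t : ℝ} (ht : t < D.t₀) : 0 < D.Y₁ t := lt_of_lt_of_le (by norm_num) (D.le_Y₁ t ht)

theorem one_sub_exp_pos {t : ℝ} (ht : t < D.t₀) : 0 < 1 - Real.exp (D.Y t) := by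
  linarith [D.exp_Y_lt t ht, D.δ_lt]

theorem dens_pos {t : ℝ} (ht : t < D.t₀) : 0 < D.dens t :=
  mul_pos (Real.exp_pos _) (inv_pos.2 (D.one_sub_exp_pos ht))

/-- The exponent has derivative 2Y₁ + Y₂/Y₁ - 1 ≥ 20/11 - 11/20 - 1 > 0, and 1/(1 - e^Y) increases
with Y. -/
theorem dens_mono {t t' : ℝ} (h : t ≤ t') (ht' : t' < D.t₀) : D.dens t ≤ D.dens t' := by
  have ht := h.trans_lt ht'
  have h1 : 0 * (t' - t) ≤ (2 * D.Y t' + Real.log (D.Y₁ t') - t')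
      - (2 * D.Y t + Real.log (D.Y₁ t) - t) := by
    refine mul_sub_le_of_deriv_ge (φ := fun t => 2 * D.Y t + Real.log (D.Y₁ t) - t)
      (φ' := fun t => 2 * D.Y₁ t + D.Y₂ t / D.Y₁ t - 1) (convex_Iio D.t₀) (fun y hy => ?_)
      (fun y hy => ?_) ht ht' h
    · exact (((D.hasDerivAt₀ y hy).const_mul 2).add
        ((D.hasDerivAt₁ y hy).log (D.Y₁_pos' hy).ne')).sub (hasDerivAt_id y)
    · have h2 := D.le_Y₁ y hy
      have h3 := (abs_le.1 (D.abs_Y₂_le y hy)).1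
      have h4 : -(11 / 20) ≤ D.Y₂ y / D.Y₁ y := by
        rw [le_div_iff₀ (D.Y₁_pos' hy)]
        linarith
      linarith
  have h2 := mul_sub_le_of_deriv_ge (convex_Iio D.t₀) D.hasDerivAt₀ (fun y hy => (D.Y₁_pos' hy).le)
    ht ht' h
  have h3 : Real.exp (D.Y t) ≤ Real.exp (D.Y t') := Real.exp_le_exp.2 (by linarith)
  have h4 := D.one_sub_exp_pos ht'
  have h5 := D.one_sub_exp_pos ht
  exact mul_le_mul (Real.exp_le_exp.2 (by linarith)) (inv_anti₀ h4 (by linarith))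
    (inv_pos.2 h5).le (Real.exp_pos _).le

theorem surjective_theta {l : ℝ} (hl : l < D.t₀) : Function.Surjective (D.theta l) := by
  intro θ
  refine ⟨2 * primLog D.Y₁ l θ / Real.exp (l / 2), ?_⟩
  refine ((D.eq_inv_iff hl).1 ?_).symm
  field_simp

theorem injective_theta {l : ℝ} (hl : l < D.t₀) : Function.Injective (D.theta l) := by
  intro x y h
  have h1 := D.primLog_theta hl x
  rw [h, D.primLog_theta hl y] at h1
  have := Real.exp_pos (l / 2)
  have h2 : Real.exp (l / 2) * y = Real.exp (l / 2) * x := by linarith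
  exact (mul_left_cancel₀ this.ne' h2).symm

/-- The integral of the density. -/
def totalDens (l : ℝ) : ℝ := ∫ θ, Real.exp (logSech θ) * D.dens (l + logSech θ)

/-- Jacobian of x ↦ θ: dθ/dx = e^{l/2}/(2Y₁), and the factor e^{-t} in the density cancels e^l
sech²θ. -/
theorem deriv_theta_mul_dens {l : ℝ} (hl : l < D.t₀) (x : ℝ) :
    |Real.exp (l / 2) / 2 / D.Y₁ (l + logSech (D.theta l x))| •
      (Real.exp (logSech (D.theta l x)) * D.dens (l + logSech (D.theta l x)))
      = Real.exp (-(l / 2)) / 2 * (D.eta l x * D.vel l x) := by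
  have hY := D.Y₁_pos hl (D.theta l x)
  have h1 := D.one_sub_eta_pos hl x
  have e1 : D.dens (D.lev l x) = D.eta l x ^ 2 * D.Y₁ (D.lev l x) * (Real.exp (D.lev l x))⁻¹
      * (1 - D.eta l x)⁻¹ := by
    rw [dens, Real.exp_sub, Real.exp_add, Real.exp_log (show 0 < D.Y₁ (D.lev l x) from hY), two_mul, Real.exp_add, div_eq_mul_inv,
      ← sq]
    rfl
  rw [abs_of_pos (by positivity), smul_eq_mul]
  change _ / D.Y₁ (D.lev l x) * (_ * D.dens (D.lev l x)) = _
  rw [e1, vel, lev, Real.exp_add, Real.exp_neg]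
  have h2 : Real.exp l = Real.exp (l / 2) * Real.exp (l / 2) := by
    rw [← Real.exp_add]; congr 1; ring
  rw [h2]
  have := Real.exp_pos (l / 2)
  have := Real.exp_pos (logSech (D.theta l x))
  field_simp

theorem integrable_dens {l : ℝ} (hl : l < D.top) :
    Integrable fun θ => Real.exp (logSech θ) * D.dens (l + logSech θ) := by
  have hl' := hl.trans_le D.top_le
  have h := integrableOn_image_iff_integrableOn_abs_deriv_smul MeasurableSet.univ
    (fun x _ => (D.hasDerivAt_theta_right hl' x).hasDerivWithinAt) (D.injective_theta hl').injOn
    (fun θ => Real.exp (logSech θ) * D.dens (l + logSech θ))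
  rw [image_univ, (D.surjective_theta hl').range_eq, integrableOn_univ, integrableOn_univ] at h
  rw [h]
  simp only [D.deriv_theta_mul_dens hl']
  exact Integrable.const_mul (((D.etaTuple_spec 0).2 l hl).integrable_mul
    ((D.velTuple_spec 0).2 l hl)) _

theorem totalDens_eq {l : ℝ} (hl : l < D.t₀) :
    D.totalDens l = Real.exp (-(l / 2)) / 2 * ∫ x, D.eta l x * D.vel l x := by
  have h := integral_image_eq_integral_abs_deriv_smul MeasurableSet.univ
    (fun x _ => (D.hasDerivAt_theta_right hl x).hasDerivWithinAt) (D.injective_theta hl).injOn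
    (fun θ => Real.exp (logSech θ) * D.dens (l + logSech θ))
  rw [image_univ, (D.surjective_theta hl).range_eq, setIntegral_univ, setIntegral_univ] at h
  rw [totalDens, h]
  simp only [D.deriv_theta_mul_dens hl]
  rw [integral_const_mul]

/-- In the phase variable the domain of integration no longer depends on l, so monotonicity holds
already for the integrand. -/
theorem totalDens_mono {l l' : ℝ} (h : l ≤ l') (hl' : l' < D.top) :
    D.totalDens l ≤ D.totalDens l' :=
  integral_mono (D.integrable_dens (h.trans_lt hl')) (D.integrable_dens hl') fun θ =>
    mul_le_mul_of_nonneg_left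
      (D.dens_mono (by linarith) (D.add_logSech_lt (hl'.trans_le D.top_le) θ)) (Real.exp_pos _).le

theorem totalDens_pos {l : ℝ} (hl : l < D.top) : 0 < D.totalDens l := by
  have hp : ∀ θ, 0 < Real.exp (logSech θ) * D.dens (l + logSech θ) := fun θ =>
    mul_pos (Real.exp_pos _) (D.dens_pos (D.add_logSech_lt (hl.trans_le D.top_le) θ))
  rw [totalDens, integral_pos_iff_support_of_nonneg (fun θ => (hp θ).le) (D.integrable_dens hl)]
  have : (Function.support fun θ => Real.exp (logSech θ) * D.dens (l + logSech θ)) = univ :=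
    eq_univ_of_forall fun θ => (hp θ).ne'
  rw [this]
  simp

theorem momentum_branch {c : ℝ} (h0 : 0 < W.s ^ 2 - c ^ 2) (hc : D.par c < D.top) :
    momentum (D.branch c).toX0 = c * Real.sqrt (W.s ^ 2 - c ^ 2) / 2 * D.totalDens (D.par c) := by
  have e : momentum (D.branch c).toX0 = 1 / 2 * ∫ x, c / 2 * (D.eta (D.par c) x * D.vel (D.par c) x) := by
    rw [momentum]
    congr 1
    refine integral_congr_ae ?_
    filter_upwards [D.eta_branch hc, D.vel_branch hc] with x h1 h2
    change (D.branch c).eta x * (D.branch c).vel x = _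
    rw [h1, h2]; ring
  have h1 : Real.exp (D.par c / 2) = Real.sqrt (W.s ^ 2 - c ^ 2) := by
    rw [par, Real.sqrt_eq_rpow, Real.rpow_def_of_pos h0]
    congr 1; ring
  rw [e, integral_const_mul, D.totalDens_eq (hc.trans_le D.top_le), Real.exp_neg, h1]
  have := Real.sqrt_pos.2 h0
  field_simp

theorem differentiableAt_momentum_branch {I : Set ℝ} (hI : IsOpen I)
    (h : ContDiffOn ℝ 2 D.branch I) {c : ℝ} (hc : c ∈ I) :
    DifferentiableAt ℝ (fun c => momentum (D.branch c).toX0) c := by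
  have hd : DifferentiableAt ℝ (fun c => X.pair (D.branch c)) c :=
    (((X.pair (k := 2)).contDiff.comp_contDiffOn h).differentiableOn (by simp)).differentiableAt
      (hI.mem_nhds hc)
  have hd' : DifferentiableAt ℝ (fun c => L2Pair.swap (X.pair (D.branch c))) c :=
    L2Pair.swap.differentiableAt.comp c hd
  have e : (fun c => momentum (D.branch c).toX0)
      = fun c => (1 / 4 : ℝ) * inner ℝ (L2Pair.swap (X.pair (D.branch c))) (X.pair (D.branch c)) :=
    funext fun s => momentum_eq_pair _
  rw [e]
  exact (hd'.inner ℝ hd).const_mul _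

/-- The product of a decreasing function and an antitone positive function. -/
theorem _root_.DarkSoliton.deriv_neg_of_eq_mul {p φ N : ℝ → ℝ} {φ' c : ℝ} {I : Set ℝ} (hI : I ∈ 𝓝 c)
    (hp : DifferentiableAt ℝ p c) (hφ : HasDerivAt φ φ' c) (hφ' : φ' < 0) (hφ0 : 0 < φ c)
    (hN0 : 0 < N c) (hN : AntitoneOn N I) (he : ∀ x ∈ I, p x = φ x * N x) : deriv p c < 0 := by
  have hcI := mem_of_mem_nhds hI
  have hev : N =ᶠ[𝓝 c] fun x => p x / φ x := by
    filter_upwards [hI, hφ.continuousAt.eventually_ne hφ0.ne'] with x hx hx0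
    rw [he x hx]
    field_simp
  -- N is only known to be antitone; its differentiability follows from N = p/φ, without
  -- differentiating the integral.
  have hNd : DifferentiableAt ℝ N c := (hp.div hφ.differentiableAt hφ0.ne').congr_of_eventuallyEq hev
  have hN' : deriv N c ≤ 0 := by
    rw [← derivWithin_of_mem_nhds hI]
    exact hN.derivWithin_nonpos
  have h1 : HasDerivAt p (φ' * N c + φ c * deriv N c) c := by
    refine (hφ.mul hNd.hasDerivAt).congr_of_eventuallyEq ?_
    filter_upwards [hI] with x hx using he x hx
  rw [h1.deriv]
  nlinarith [mul_pos (neg_pos.2 hφ') hN0, mul_nonneg hφ0.le (neg_nonneg.2 hN')]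

/-- c√(s² - c²) decreases strictly when s² < 2c², and the remaining factor is positive and
nonincreasing in c, because log(s² - c²) decreases. -/
theorem deriv_momentum_branch_neg {a : ℝ} (ha : 0 < a) (h0 : ∀ c ∈ Ioo a W.s, D.par c < D.top)
    (h1 : ∀ c ∈ Ioo a W.s, W.s ^ 2 < 2 * c ^ 2) {c : ℝ} (hc : c ∈ Ioo a W.s) :
    deriv (fun c => momentum (D.branch c).toX0) c < 0 := by
  have hpos : ∀ c ∈ Ioo a W.s, 0 < W.s ^ 2 - c ^ 2 := fun c hc => by
    nlinarith [hc.1, hc.2]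
  have hbr := D.contDiffOn_branch (fun c hc => (hpos c hc).ne') h0
  have hs := Real.sqrt_pos.2 (hpos c hc)
  have hd : HasDerivAt (fun c => c * Real.sqrt (W.s ^ 2 - c ^ 2) / 2)
      ((W.s ^ 2 - 2 * c ^ 2) / (2 * Real.sqrt (W.s ^ 2 - c ^ 2))) c := by
    have h2 : HasDerivAt (fun c => W.s ^ 2 - c ^ 2) (-(2 * c)) c := by
      simpa using (hasDerivAt_pow 2 c).const_sub (W.s ^ 2)
    refine (((hasDerivAt_id c).mul (h2.sqrt (hpos c hc).ne')).div_const 2).congr_deriv ?_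
    have h3 := Real.sq_sqrt (hpos c hc).le
    simp only [id]
    field_simp
    rw [h3]
    ring
  refine deriv_neg_of_eq_mul (N := fun c => D.totalDens (D.par c)) (Ioo_mem_nhds hc.1 hc.2)
    (D.differentiableAt_momentum_branch isOpen_Ioo hbr hc) hd ?_ ?_ (D.totalDens_pos (h0 c hc)) ?_
    fun x hx => D.momentum_branch (hpos x hx) (h0 x hx)
  · exact div_neg_of_neg_of_pos (by linarith [h1 c hc]) (by positivity)
  · have := ha.trans hc.1
    positivity
  · intro x hx y hy hxy
    refine D.totalDens_mono (Real.log_le_log (hpos y hy) ?_) (h0 x hx)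
    nlinarith [hx.1]

end LogProfile

/-! ### Uniqueness of the profile -/

theorem exists_Icc_of_lt_one {y : ℝ → ℝ} (hy : Continuous y) (h1 : ∀ x, y x < 1) (a b : ℝ) :
    ∃ m M, M < 1 ∧ ∀ x ∈ Icc a b, y x ∈ Icc m M := by
  rcases (Icc a b).eq_empty_or_nonempty with he | hne
  · exact ⟨0, 0, one_pos, fun x hx => by simp [he] at hx⟩
  obtain ⟨x, _, hx⟩ := isCompact_Icc.exists_isMaxOn hne hy.continuousOn
  obtain ⟨x', _, hx'⟩ := isCompact_Icc.exists_isMinOn hne hy.continuousOn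
  exact ⟨y x', y x, h1 x, fun z hz => ⟨hx' hz, hx hz⟩⟩

/-- On a bounded interval both solutions stay in a compact subset of (-∞, 1), where V₁ is Lipschitz,
so the first order system has a unique solution. -/
theorem Well.ode_unique (W : Well) (k : ℝ) {y y' z z' : ℝ → ℝ} {x₀ : ℝ}
    (hy : ∀ x, HasDerivAt y (y' x) x) (hy' : ∀ x, HasDerivAt y' (W.V₁ (y x) / 2 - k * y x) x)
    (hy1 : ∀ x, y x < 1) (hz : ∀ x, HasDerivAt z (z' x) x)
    (hz' : ∀ x, HasDerivAt z' (W.V₁ (z x) / 2 - k * z x) x) (hz1 : ∀ x, z x < 1)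
    (h0 : y x₀ = z x₀) (h0' : y' x₀ = z' x₀) : y = z := by
  funext x
  have cy : Continuous y := continuous_iff_continuousAt.2 fun x => (hy x).continuousAt
  have cz : Continuous z := continuous_iff_continuousAt.2 fun x => (hz x).continuousAt
  have cy' : Continuous y' := continuous_iff_continuousAt.2 fun x => (hy' x).continuousAt
  have cz' : Continuous z' := continuous_iff_continuousAt.2 fun x => (hz' x).continuousAt
  set a := min x x₀ - 1
  set b := max x x₀ + 1
  obtain ⟨m₁, M₁, hM₁, hb₁⟩ := exists_Icc_of_lt_one cy hy1 a b
  obtain ⟨m₂, M₂, hM₂, hb₂⟩ := exists_Icc_of_lt_one cz hz1 a b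
  set m := min m₁ m₂
  set M := max M₁ M₂
  have hM : M < 1 := max_lt hM₁ hM₂
  have hS : ∀ η ∈ Icc m M, η < 1 := fun η hη => hη.2.trans_lt hM
  have cV : ContinuousOn W.V₂ (Icc m M) := fun η hη =>
    (W.hasDerivAt₂ η (hS η hη)).continuousAt.continuousWithinAt
  obtain ⟨B, hB⟩ := isCompact_Icc.exists_bound_of_continuousOn cV
  have hlip : ∀ p ∈ Icc m M, ∀ r ∈ Icc m M, |W.V₁ p - W.V₁ r| ≤ |B| * |p - r| := by
    intro p hp r hr
    exact (convex_Icc m M).norm_image_sub_le_of_norm_hasDerivWithin_le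
      (fun η hη => (W.hasDerivAt₁ η (hS η hη)).hasDerivWithinAt)
      (fun η hη => (hB η hη).trans (le_abs_self B)) hr hp
  set F : ℝ → ℝ × ℝ → ℝ × ℝ := fun _ p => (p.2, W.V₁ p.1 / 2 - k * p.1)
  set S : ℝ → Set (ℝ × ℝ) := fun _ => Prod.fst ⁻¹' Icc m M
  have hF : ∀ t ∈ Ioo a b, LipschitzOnWith (Real.toNNReal (1 + |B| + |k|)) (F t) (S t) := by
    intro t _
    refine LipschitzOnWith.of_dist_le_mul fun p hp r hr => ?_
    rw [Real.coe_toNNReal _ (by positivity), Prod.dist_eq]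
    have e1 : dist p.1 r.1 ≤ dist p r := by rw [Prod.dist_eq]; exact le_max_left _ _
    have e2 : dist p.2 r.2 ≤ dist p r := by rw [Prod.dist_eq]; exact le_max_right _ _
    have e0 := dist_nonneg (x := p) (y := r)
    refine max_le ?_ ?_
    · refine e2.trans (le_mul_of_one_le_left e0 ?_)
      linarith [abs_nonneg B, abs_nonneg k]
    · have e3 := hlip p.1 hp r.1 hr
      rw [Real.dist_eq] at e1 ⊢
      have e4 : W.V₁ p.1 / 2 - k * p.1 - (W.V₁ r.1 / 2 - k * r.1)
          = (W.V₁ p.1 - W.V₁ r.1) / 2 - k * (p.1 - r.1) := by ring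
      change |W.V₁ p.1 / 2 - k * p.1 - (W.V₁ r.1 / 2 - k * r.1)| ≤ _
      rw [e4]
      refine (abs_sub _ _).trans ?_
      rw [abs_div, abs_mul, abs_two]
      have e5 := mul_le_mul_of_nonneg_left e1 (abs_nonneg B)
      have e6 := mul_le_mul_of_nonneg_left e1 (abs_nonneg k)
      have e7 := mul_nonneg (abs_nonneg B) e0
      linarith
  have hx : x ∈ Icc a b := ⟨by linarith [min_le_left x x₀], by linarith [le_max_left x x₀]⟩
  have hx₀ : x₀ ∈ Ioo a b := ⟨by linarith [min_le_right x x₀], by linarith [le_max_right x x₀]⟩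
  have := ODE_solution_unique_of_mem_Icc (v := F) (s := S) (f := fun x => (y x, y' x))
    (g := fun x => (z x, z' x)) hF hx₀ (cy.prodMk cy').continuousOn
    (fun t _ => (hy t).prodMk (hy' t))
    (fun t ht => ⟨(min_le_left _ _).trans (hb₁ t (Ioo_subset_Icc_self ht)).1,
      (hb₁ t (Ioo_subset_Icc_self ht)).2.trans (le_max_left _ _)⟩) (cz.prodMk cz').continuousOn
    (fun t _ => (hz t).prodMk (hz' t))
    (fun t ht => ⟨(min_le_right _ _).trans (hb₂ t (Ioo_subset_Icc_self ht)).1,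
      (hb₂ t (Ioo_subset_Icc_self ht)).2.trans (le_max_right _ _)⟩) (Prod.ext h0 h0') hx
  exact congrArg Prod.fst this

theorem ae_eq_of_hasWeakDeriv {u g : L2} {φ φ' : ℝ → ℝ} (hw : HasWeakDeriv u g)
    (hu : u =ᵐ[volume] φ) (h : ∀ x, HasDerivAt φ (φ' x) x) (hc : Continuous φ') :
    g =ᵐ[volume] φ' := by
  refine ae_eq_of_integral_contDiff_smul_eq ((Lp.memLp g).locallyIntegrable (by norm_num))
    hc.locallyIntegrable fun ψ hψ hs => ?_
  have hφ : Continuous φ := continuous_iff_continuousAt.2 fun x => (h x).continuousAt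
  have hd : Continuous (deriv ψ) := hψ.continuous_deriv (by simp)
  have e1 : (∫ x, u x * deriv ψ x) = ∫ x, φ x * deriv ψ x :=
    integral_congr_ae (by filter_upwards [hu] with x hx; rw [hx])
  have e2 : ∫ x, φ x * deriv ψ x = -∫ x, φ' x * ψ x := by
    refine integral_mul_deriv_eq_deriv_mul_of_integrable (fun x _ => h x)
      (fun x _ => (hψ.differentiable (by simp) x).hasDerivAt) ?_ ?_ ?_
    · exact (hφ.mul hd).integrable_of_hasCompactSupport hs.deriv.mul_left
    · exact (hc.mul hψ.continuous).integrable_of_hasCompactSupport hs.mul_left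
    · exact (hφ.mul hψ.continuous).integrable_of_hasCompactSupport hs.mul_left
  have := hw ψ hψ hs
  simp only [smul_eq_mul, mul_comm (ψ _)]
  linarith

theorem tendsto_cocompact_zero_of_memLp {y y' : ℝ → ℝ} (hy : ∀ x, HasDerivAt y (y' x) x)
    (h : MemLp y 2 (volume : Measure ℝ)) (h' : MemLp y' 2 (volume : Measure ℝ)) :
    Tendsto y (cocompact ℝ) (𝓝 0) := by
  have hd : ∀ x, HasDerivAt (fun x => y x ^ 2) (2 * (y x * y' x)) x := fun x => by
    refine ((hy x).pow 2).congr_deriv ?_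
    simp; ring
  have i1 : Integrable (fun x => y x ^ 2) := h.integrable_sq
  have i2 : Integrable (fun x => 2 * (y x * y' x)) := Integrable.const_mul (h.integrable_mul h') 2
  have key : Tendsto (fun x => y x ^ 2) (cocompact ℝ) (𝓝 0) := by
    rw [cocompact_eq_atBot_atTop]
    exact Tendsto.sup
      (tendsto_zero_of_hasDerivAt_of_integrableOn_Iic (a := 0) (fun x _ => hd x) i2.integrableOn
        i1.integrableOn)
      (tendsto_zero_of_hasDerivAt_of_integrableOn_Ioi (a := 0) (fun x _ => hd x) i2.integrableOn
        i1.integrableOn)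
  rw [tendsto_zero_iff_abs_tendsto_zero]
  have := (Real.continuous_sqrt.tendsto 0).comp key
  rw [Real.sqrt_zero] at this
  refine this.congr fun x => ?_
  exact Real.sqrt_sq_eq_abs (y x)

/-- A positive constant is not integrable on the line. This yields points where y and y' are
simultaneously small, as the energy identity requires. -/
theorem exists_sq_add_sq_lt {y y' : ℝ → ℝ} (h : MemLp y 2 (volume : Measure ℝ))
    (h' : MemLp y' 2 (volume : Measure ℝ)) {ε : ℝ} (hε : 0 < ε) : ∃ x, y x ^ 2 + y' x ^ 2 < ε := by
  by_contra! hcon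
  have hi : Integrable (fun x => y x ^ 2 + y' x ^ 2) := h.integrable_sq.add h'.integrable_sq
  have : Integrable (fun _ : ℝ => ε) := by
    refine hi.mono' aestronglyMeasurable_const (ae_of_all _ fun x => ?_)
    rw [Real.norm_eq_abs, abs_of_pos hε]
    exact hcon x
  rw [integrable_const_iff] at this
  rcases this with h | h
  · exact hε.ne' h
  · exact absurd h.measure_univ_lt_top (by simp)

/-! ### Classification of travelling waves -/

section Classification

variable {f : ℝ → ℝ} {W : Well} {c : ℝ} {η v : ℝ → ℝ}

theorem SolvesTW.vel_eq (h : SolvesTW f c η v) (x : ℝ) : v x = c / 2 * (η x / (1 - η x)) := by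
  have h1 := h.2.2.2.1 x
  have h2 := (sub_pos.2 (h.2.2.1 x)).ne'
  field_simp
  linarith

theorem SolvesTW.hasDerivAt (h : SolvesTW f c η v) (x : ℝ) : HasDerivAt η (deriv η x) x :=
  (h.1.differentiable (by simp) x).hasDerivAt

theorem SolvesTW.contDiff_deriv (h : SolvesTW f c η v) : ContDiff ℝ 1 (deriv η) :=
  ((contDiff_succ_iff_deriv (n := 1)).1 (by simpa [one_add_one_eq_two] using h.1)).2.2

theorem SolvesTW.hasDerivAt_deriv (h : SolvesTW f c η v) (x : ℝ) :
    HasDerivAt (deriv η) (deriv (deriv η) x) x :=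
  (h.contDiff_deriv.differentiable (by simp) x).hasDerivAt

theorem SolvesTW.second_deriv (hW : W.IsFor f) (h : SolvesTW f c η v) (x : ℝ) :
    2 * deriv (deriv η) x = W.V₁ (η x) - 2 * c ^ 2 * η x
      + (W.V₀ (η x) - c ^ 2 * η x ^ 2 - deriv η x ^ 2) / (1 - η x) := by
  have h1 := h.2.2.2.2 x
  have h2 := (sub_pos.2 (h.2.2.1 x)).ne'
  rw [h.vel_eq, hW.eq_f (h.2.2.1 x)] at h1
  field_simp at h1 ⊢
  linarith

/-- The quotient E = ((η')² - V₀(η) + c²η²)/(1 - η) is conserved, and it tends to 0 along points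
where η and η' both become small. -/
theorem SolvesTW.energy (hW : W.IsFor f) (h : SolvesTW f c η v)
    (hη : MemLp η 2 (volume : Measure ℝ)) (hη' : MemLp (deriv η) 2 (volume : Measure ℝ)) (x : ℝ) :
    deriv η x ^ 2 = W.V₀ (η x) - c ^ 2 * η x ^ 2 := by
  set E : ℝ → ℝ := fun x => (deriv η x ^ 2 - W.V₀ (η x) + c ^ 2 * η x ^ 2) / (1 - η x)
  have hne : ∀ x, 1 - η x ≠ 0 := fun x => (sub_pos.2 (h.2.2.1 x)).ne'
  have hE : ∀ x, HasDerivAt E 0 x := by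
    intro x
    have d0 := h.hasDerivAt x
    have d1 := h.hasDerivAt_deriv x
    have d2 := (W.hasDerivAt₀ _ (h.2.2.1 x)).comp x d0
    refine ((((d1.pow 2).sub d2).add ((d0.pow 2).const_mul (c ^ 2))).div (d0.const_sub 1)
      (hne x)).congr_deriv ?_
    have h2 := hne x
    have h3 := h.second_deriv hW x
    simp only [Pi.add_apply, Pi.sub_apply, Pi.pow_apply, Function.comp_apply]
    rw [div_eq_zero_iff]
    left
    have e : deriv (deriv η) x = (W.V₁ (η x) - 2 * c ^ 2 * η x
      + (W.V₀ (η x) - c ^ 2 * η x ^ 2 - deriv η x ^ 2) / (1 - η x)) / 2 := by linarith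
    rw [e]
    push_cast
    field_simp
    ring
  have hconst : ∀ x y, E x = E y := is_const_of_deriv_eq_zero
    (fun x => (hE x).differentiableAt) fun x => (hE x).deriv
  have hseq : ∀ n : ℕ, ∃ x, η x ^ 2 + deriv η x ^ 2 < 1 / ((n : ℝ) + 1) := fun n =>
    exists_sq_add_sq_lt hη hη' (by positivity)
  choose xs hxs using hseq
  have hlim0 : Tendsto (fun n => η (xs n) ^ 2) atTop (𝓝 0) :=
    squeeze_zero (fun n => sq_nonneg _) (fun n => by linarith [hxs n, sq_nonneg (deriv η (xs n))])
      tendsto_one_div_add_atTop_nhds_zero_nat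
  have hlim1 : Tendsto (fun n => deriv η (xs n) ^ 2) atTop (𝓝 0) :=
    squeeze_zero (fun n => sq_nonneg _) (fun n => by linarith [hxs n, sq_nonneg (η (xs n))])
      tendsto_one_div_add_atTop_nhds_zero_nat
  have hlim : Tendsto (fun n => η (xs n)) atTop (𝓝 0) := by
    rw [tendsto_zero_iff_abs_tendsto_zero]
    have := (Real.continuous_sqrt.tendsto 0).comp hlim0
    rw [Real.sqrt_zero] at this
    exact this.congr fun n => Real.sqrt_sq_eq_abs _
  have hV : Tendsto (fun n => W.V₀ (η (xs n))) atTop (𝓝 0) := by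
    have := (W.hasDerivAt₀ 0 one_pos).continuousAt.tendsto.comp hlim
    rwa [W.V₀_zero] at this
  have hE0 : Tendsto (fun n => E (xs n)) atTop (𝓝 0) := by
    have := (((hlim1.sub hV).add (hlim0.const_mul (c ^ 2))).div (hlim.const_sub 1) (by norm_num))
    have e : ((0 : ℝ) - 0 + c ^ 2 * 0) / (1 - 0) = 0 := by norm_num
    rw [e] at this
    exact this
  have hz : E x = 0 := by
    refine tendsto_nhds_unique ?_ hE0
    exact tendsto_const_nhds.congr fun n => hconst x (xs n)
  have := (div_eq_zero_iff.1 hz).resolve_right (hne x)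
  linarith

/-- g is strictly increasing on (0, δ) and takes the value e^l at exp(Y(l)). If M were at least δ,
then g would exceed e^l somewhere below M, against the assumed bound. -/
theorem LogProfile.eq_exp_Y (D : LogProfile W) {l M : ℝ} (hl : l < D.t₀) (hM : 0 < M)
    (hM0 : W.s ^ 2 - W.V₀ M / M ^ 2 = Real.exp l)
    (hle : ∀ η ∈ Ioc 0 M, W.s ^ 2 - W.V₀ η / η ^ 2 ≤ Real.exp l) : M = Real.exp (D.Y l) := by
  have hA : 0 < Real.exp (D.Y l) := Real.exp_pos _
  have hAδ := D.exp_Y_lt l hl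
  have hgA : W.s ^ 2 - W.V₀ (Real.exp (D.Y l)) / Real.exp (D.Y l) ^ 2 = Real.exp l := by
    have := D.eq_V₀ l hl
    field_simp
    linarith
  rcases lt_or_ge M D.δ with h | h
  · exact D.strictMonoOn.injOn ⟨hM, h⟩ ⟨hA, hAδ⟩ (hM0.trans hgA.symm)
  · obtain ⟨A', h1, h2⟩ := exists_between hAδ
    have h3 := D.strictMonoOn ⟨hA, hAδ⟩ ⟨hA.trans h1, h2⟩ h1
    have h4 := hle A' ⟨hA.trans h1, (h2.trans_le h).le⟩
    simp only at h3
    rw [hgA] at h3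
    exact absurd h4 (not_le.2 h3)

theorem SolvesTW.eq_translate (hW : W.IsFor f) (D : LogProfile W) (h : SolvesTW f c η v)
    (hη : MemLp η 2 (volume : Measure ℝ)) (hη' : MemLp (deriv η) 2 (volume : Measure ℝ))
    (hne : ∃ x, η x ≠ 0) (h0 : 0 < W.s ^ 2 - c ^ 2) (hc : D.par c < D.t₀) :
    ∃ a, ∀ x, η x = D.eta (D.par c) (x - a) := by
  have hexp : Real.exp (D.par c) = W.s ^ 2 - c ^ 2 := Real.exp_log h0
  have hen := h.energy hW hη hη'
  have hcont : Continuous η := h.1.continuous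
  have hlim := tendsto_cocompact_zero_of_memLp h.hasDerivAt hη hη'
  have hnn : ∀ x, 0 ≤ η x := by
    by_contra! hcon
    obtain ⟨x₁, hx₁⟩ := hcon
    obtain ⟨x₀, hx₀⟩ := hcont.exists_forall_le' x₁ (by
      filter_upwards [hlim.eventually_const_lt hx₁] with x hx using hx.le)
    have hd : deriv η x₀ = 0 :=
      IsLocalMin.deriv_eq_zero (Eventually.of_forall hx₀ : ∀ᶠ x in 𝓝 x₀, η x₀ ≤ η x)
    have hneg : η x₀ < 0 := (hx₀ x₁).trans_lt hx₁
    have h1 := hen x₀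
    have h2 := W.lower (η x₀) (h.2.2.1 x₀).le
    rw [hd] at h1
    have h3 : 0 < η x₀ ^ 2 := sq_pos_of_neg hneg
    have h4 : 0 < W.s ^ 2 * -η x₀ := mul_pos (pow_pos W.s_pos 2) (neg_pos.2 hneg)
    nlinarith [mul_pos h0 h3, mul_pos h4 h3]
  obtain ⟨x₁, hx₁⟩ := hne
  have hpos : 0 < η x₁ := lt_of_le_of_ne (hnn x₁) (Ne.symm hx₁)
  obtain ⟨x₀, hx₀⟩ := hcont.exists_forall_ge' x₁ (by
      filter_upwards [hlim.eventually_lt_const hpos] with x hx using hx.le)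
  have hd : deriv η x₀ = 0 :=
    IsLocalMax.deriv_eq_zero (Eventually.of_forall hx₀ : ∀ᶠ x in 𝓝 x₀, η x ≤ η x₀)
  have hM : 0 < η x₀ := hpos.trans_le (hx₀ x₁)
  have hM0 : W.s ^ 2 - W.V₀ (η x₀) / η x₀ ^ 2 = Real.exp (D.par c) := by
    have h1 := hen x₀
    rw [hd] at h1
    rw [hexp]
    field_simp
    linarith
  -- Every value between 0 and the maximum is attained, and (η')² ≥ 0 at such a point bounds g there
  -- by e^l.
  have hle : ∀ y ∈ Ioc 0 (η x₀), W.s ^ 2 - W.V₀ y / y ^ 2 ≤ Real.exp (D.par c) := by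
    intro y hy
    obtain ⟨x₂, hx₂⟩ := (hlim.eventually_lt_const hy.1).exists
    obtain ⟨x, hx⟩ := mem_range_of_exists_le_of_exists_ge hcont ⟨x₂, hx₂.le⟩ ⟨x₀, hy.2⟩
    have h1 := hen x
    rw [hx] at h1
    have h2 := sq_nonneg (deriv η x)
    have h3 : 0 < y ^ 2 := pow_pos hy.1 2
    have h4 : c ^ 2 ≤ W.V₀ y / y ^ 2 := by
      rw [le_div_iff₀ h3]; linarith
    rw [hexp]
    linarith
  have hMY := D.eq_exp_Y hc hM hM0 hle
  refine ⟨x₀, fun x => ?_⟩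
  have hsh : ∀ x, HasDerivAt (fun x : ℝ => x - x₀) 1 x := fun x => (hasDerivAt_id x).sub_const x₀
  -- On the zero energy level the second order equation loses its quotient term and becomes η'' =
  -- V₁(η)/2 - c²η. The wave and the profile share the height exp(Y(l)) and zero slope at the crest.
  have := W.ode_unique (c ^ 2) (y := η) (y' := deriv η)
    (z := fun x => D.eta (D.par c) (x - x₀)) (z' := fun x => D.etaX (D.par c) (x - x₀))
    (x₀ := x₀) h.hasDerivAt
    (fun x => by
      refine (h.hasDerivAt_deriv x).congr_deriv ?_
      have h1 := h.second_deriv hW x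
      rw [hen x, sub_self, zero_div] at h1
      linarith)
    h.2.2.1
    (fun x => by simpa using (D.hasDerivAt_eta hc (x - x₀)).comp_sub_const x x₀)
    (fun x => by
      have h1 := (D.hasDerivAt_etaX hc (x - x₀)).comp_sub_const x x₀
      rw [LogProfile.etaXX, hexp, sub_sub_cancel] at h1
      exact h1)
    (fun x => D.eta_lt_one hc _)
    (by simp only [sub_self]; rw [D.eta_zero hc]; exact hMY)
    (by simp only [sub_self]; rw [D.etaX_zero hc]; exact hd)
  exact congrFun this x

theorem LogProfile.unique (hW : W.IsFor f) (D : LogProfile W)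
    (h0 : 0 < W.s ^ 2 - c ^ 2) (hc : D.par c < D.top) {P : X 0} (hP : IsTravellingWave f c P) :
    ∃ a : ℝ, P = ((D.branch c).translate a).toX0 := by
  obtain ⟨_, η, v, hη, hv, h, hncst⟩ := hP
  have hc' := hc.trans_le D.top_le
  have hm : MemLp η 2 (volume : Measure ℝ) := (memLp_congr_ae hη).1 (Lp.memLp (P.fst.der 0))
  have hder := ae_eq_of_hasWeakDeriv (P.fst.2 0) (φ := η) hη h.hasDerivAt h.contDiff_deriv.continuous
  have hm' : MemLp (deriv η) 2 (volume : Measure ℝ) :=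
    (memLp_congr_ae hder).1 (Lp.memLp (P.fst.der 1))
  have hne : ∃ x, η x ≠ 0 := by
    by_contra! hcon
    obtain ⟨x, y, hxy⟩ := hncst
    refine hxy ?_
    rw [h.vel_eq, h.vel_eq, hcon x, hcon y]
  obtain ⟨a, ha⟩ := h.eq_translate hW D hm hm' hne h0 hc'
  refine ⟨a, ?_⟩
  have e1 : P.fst = ((D.branch c).translate a).toX0.fst := by
    refine H.eq_of_der_zero (Lp.ext ?_)
    change P.eta =ᵐ[volume] (L2.translate a ((D.branch c).fst.der 0) : ℝ → ℝ)
    filter_upwards [hη, L2.coeFn_translate a ((D.branch c).fst.der 0),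
      ae_comp_sub (D.eta_branch hc) a] with x h1 h2 h3
    rw [h1, h2, ha x]
    exact h3.symm
  have e2 : P.snd = ((D.branch c).translate a).toX0.snd := by
    refine H.eq_of_der_zero (Lp.ext ?_)
    change P.vel =ᵐ[volume] (L2.translate a ((D.branch c).snd.der 0) : ℝ → ℝ)
    filter_upwards [hv, L2.coeFn_translate a ((D.branch c).snd.der 0),
      ae_comp_sub (D.vel_branch hc) a] with x h1 h2 h3
    rw [h1, h2, h.vel_eq, ha x]
    exact h3.symm
  exact (WithLp.ofLp_injective 2) (Prod.ext e1 e2)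

end Classification

/-! ### Existence of the branch -/

theorem wellOf_isFor {f : ℝ → ℝ} (hf : ContDiffOn ℝ 3 f (Ici 0)) (hf1 : f 1 = 0)
    (hf1' : deriv f 1 < 0)
    (H1 : ∀ ρ : ℝ, 0 ≤ ρ → soundSpeed f ^ 2 / 4 * (1 - ρ) ^ 2 ≤ potential f ρ) :
    (wellOf hf hf1 hf1' H1).IsFor f :=
  ⟨rfl, fun _ => rfl, fun _ => rfl⟩

theorem exists_isTransonicBranch {f : ℝ → ℝ} (hf : ContDiffOn ℝ 3 f (Ici 0)) (hf1 : f 1 = 0)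
    (hf1' : deriv f 1 < 0)
    (H1 : ∀ ρ : ℝ, 0 ≤ ρ → soundSpeed f ^ 2 / 4 * (1 - ρ) ^ 2 ≤ potential f ρ) :
    ∃ (c₀ : ℝ) (Q : ℝ → X 2), IsTransonicBranch f c₀ Q := by
  have hW := wellOf_isFor hf hf1 hf1' H1
  set W := wellOf hf hf1 hf1' H1
  obtain ⟨D⟩ := exists_logProfile W
  have hs := W.s_pos
  have hs2 : 0 < W.s ^ 2 := pow_pos hs 2
  -- With s² - c² < e, the bound by e^top puts the parameter in the domain of the profiles, and the
  -- bound by s²/3 gives s² < 2c².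
  obtain ⟨e, he0, he⟩ := exists_between (lt_min (Real.exp_pos D.top) (by positivity : 0 < W.s ^ 2 / 3))
  have he1 : e < Real.exp D.top := he.trans_le (min_le_left _ _)
  have he2 : e < W.s ^ 2 / 3 := he.trans_le (min_le_right _ _)
  set a := Real.sqrt (W.s ^ 2 - e)
  have ha2 : a ^ 2 = W.s ^ 2 - e := Real.sq_sqrt (by linarith)
  have ha : 0 < a := Real.sqrt_pos.2 (by linarith)
  have hlt : ∀ c ∈ Ioo a W.s, 0 < W.s ^ 2 - c ^ 2 ∧ W.s ^ 2 - c ^ 2 < e := fun c hc =>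
    ⟨by nlinarith [hc.1, hc.2], by nlinarith [hc.1]⟩
  have hpar : ∀ c ∈ Ioo a W.s, D.par c < D.top := fun c hc =>
    (Real.log_lt_iff_lt_exp (hlt c hc).1).2 ((hlt c hc).2.trans he1)
  have hc2 : ∀ c ∈ Ioo a W.s, W.s ^ 2 < 2 * c ^ 2 := fun c hc => by
    linarith [(hlt c hc).2]
  refine ⟨a, D.branch, ?_⟩
  have hsf := hW.s_eq
  constructor
  · exact ha
  · rw [← hsf]
    nlinarith
  · rw [← hsf]
    exact fun c hc => D.branch_mem_NX (hpar c hc)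
  · rw [← hsf]
    exact fun c hc => D.isTravellingWave hW (hlt c hc).1 (hpar c hc)
  · rw [← hsf]
    exact fun c hc P hP => D.unique hW (hlt c hc).1 (hpar c hc) hP
  · rw [← hsf]
    exact D.contDiffOn_branch (fun c hc => (hlt c hc).1.ne') hpar
  · rw [← hsf]
    exact fun c hc => D.deriv_momentum_branch_neg ha hpar hc2 hc

end DarkSoliton

end

theorem mainTheorem4 (f : ℝ → ℝ)
    (hf : ContDiffOn ℝ 3 f (Set.Ici 0)) (hf1 : f 1 = 0) (hf1' : deriv f 1 < 0)
    (H1 : ∀ ρ : ℝ, 0 ≤ ρ → soundSpeed f ^ 2 / 4 * (1 - ρ) ^ 2 ≤ potential f ρ)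
    (H2 : ∃ M q : ℝ, 0 ≤ M ∧ 2 ≤ q ∧ ∀ ρ : ℝ, 2 ≤ ρ → potential f ρ ≤ M * |1 - ρ| ^ q)
    (H3 : deriv (deriv f) 1 + 3 * deriv f 1 ≠ 0) :
    (∃ (c₀ : ℝ) (Q : ℝ → X 2), IsTransonicBranch f c₀ Q) ∧
    ∀ (c₀ : ℝ) (Q : ℝ → X 2), IsTransonicBranch f c₀ Q →
    ∀ (N : ℕ) (cStar : Fin N → ℝ), cStar ∈ Adm N f c₀ →
    ∃ α₁ L₁ K₁ : ℝ, 0 < α₁ ∧ 0 < L₁ ∧ 0 < K₁ ∧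
    ∃ C A : X 0 → Fin N → ℝ,
      ContDiffOn ℝ 1 (fun P => (C P, A P)) (tube Q cStar α₁ L₁) ∧
      ∀ P ∈ tube Q cStar α₁ L₁,
        C P ∈ Adm N f c₀ ∧
        (∀ k : Fin N,
          innerDx (P - chain Q (C P) (A P)) ((Q (C P k)).translate (A P k)) = 0 ∧
          fderiv ℝ momentum ((Q (C P k)).translate (A P k)).toX0
            (P - chain Q (C P) (A P)) = 0) ∧
        ∀ α L : ℝ, α ≤ α₁ → L₁ ≤ L → ∀ aStar ∈ Pos N L,
          ‖P - chain Q cStar aStar‖ ≤ α →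
          ‖P - chain Q (C P) (A P)‖ + ‖C P - cStar‖ + ‖A P - aStar‖ ≤ K₁ * α :=
  ⟨exists_isTransonicBranch hf hf1 hf1' H1, fun _ _ h N cStar hc => h.exists_modulation N cStar hc⟩
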